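/- Let $\Pi=\{z=x+iy\in\mathbb C: y>0\}$ with Lebesgue area measure $dA$, $\partial=\frac12(\partial_x-i\partial_y)$, $\bar\partial=\frac12(\partial_x+i\partial_y)$, $\Delta=\partial_x^2+\partial_y^2$. Let $\mathcal A(\Pi)\subset L^2(\Pi,dA)$ be the Bergman space of square integrable holomorphic functions, $\mathcal A_n(\Pi)=\{f\in L^2(\Pi,dA):\bar\partial^n f=0\}$ (so $\mathcal A_0(\Pi)=\{0\}$), and $\mathcal A_{(n)}(\Pi)=\mathcal A_n(\Pi)\ominus\mathcal A_{n-1}(\Pi)$ the true poly-Bergman spaces. For $j\ge 0$ put $S_\Pi^j u=\frac1{j!}\,\partial^j[(z-\bar z)^j u]$. Let $\mathcal E$ be the linear span of the standard orthonormal basis $$e_k(z)=\sqrt{\tfrac{k+1}{\pi}}\;\frac{2\,(z-i)^k}{(z+i)^{k+2}},\qquad k=0,1,2,\dots,$$ of $\mathcal A(\Pi)$. A distributional symbol $F$ is a linear functional on a linear space of smooth functions on $\Pi$ which contains $C^\infty(\overline\Pi)\cap L^1(\Pi)$, such that the restriction of $F$ to the test functions is a distribution on $\Pi$. Put $\langle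 Fu,v\rangle:=(F,u\bar v)$ whenever $u\bar v$ lies in the domain of $F$; derivatives of $F$ and products of $F$ with $y$ are defined by transposition, $(\partial F,\varphi)=-(F,\partial\varphi)$ and so on, for all $\varphi$ for which the right-hand side is defined. For a linear space $D$ of functions that is dense in a closed subspace $H$ of $L^2(\Pi,dA)$, the Toeplitz operator $T_F$ in $H$ is called bounded if $\langle Fu,v\rangle$ is defined and $|\langle Fu,v\rangle|\le C\|u\|\|v\|$ for all $u,v\in D$; then $T_F$ is the bounded operator in $H$ with $\langle T_Fu,v\rangle=\langle Fu,v\rangle$, $u,v\in D$. Here $D=\mathcal E$ for $H=\mathcal A(\Pi)$ and $D=S_\Pi^j\mathcal E$ for $H=\mathcal A_{(j+1)}(\Pi)$. **Theorem.** Let $j\ge0$. The operator $S_\Pi^j$ restricts to a unitary operator $U:\mathcal A(\Pi)\to\mathcal A_{(j+1)}(\Pi)$, and there is a differential operator $$K=\underline K\big(\Delta(y^2\,\cdot),\ \bar\partial(y\,\cdot),\ \partial(y\,\cdot)\big)$$ of order $2j$, depending only on $j$, where $\underline K$ is a polynomial of degree $j$ with complex coefficients in these three (non-commuting) operators, with the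 following properties. If each differentiation has weight $-1$ and multiplication by $y$ has weight $1$, then all monomials of $\underline K$ have weight $0$; more precisely $KF=\sum_{k,l=0}^{j}c_{kl}\,\partial^k\bar\partial^l(y^{k+l}F)$ as distributions on $\Pi$, with constants $c_{kl}$ depending only on $j$ and $c_{jj}\ne0$. For every distributional symbol $F$: 1. For all $f,g\in\mathcal A(\Pi)$ for which both sides are defined, in particular for all $f,g\in\mathcal E$, $$\langle F\,S_\Pi^jf,\;S_\Pi^jg\rangle=\langle (KF)f,\;g\rangle .$$ 2. $T_F$ in $\mathcal A_{(j+1)}(\Pi)$ is bounded if and only if $T_{KF}$ in $\mathcal A(\Pi)$ is bounded. In this case both operators exist and are uniquely determined, $T_F=U\,T_{KF}\,U^{-1}$, so that they are unitarily equivalent (with the above normalization of $S_\Pi^j$, the numerical factor is $1$), and $\langle T_F S_\Pi^jf,S_\Pi^jg\rangle=\langle T_{KF}f,g\rangle$ for all $f,g\in\mathcal A(\Pi)$. Moreover, $T_F$ is compact, or belongs to the Schatten class of exponent $p$ (for any $0<p<\infty$), or has finite rank, or is zero, if and only if the same holds for $T_{KF}$. -/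

import Mathlib

open MeasureTheory Set TopologicalSpace
open scoped ContDiff Distributions ComplexConjugate

noncomputable section

namespace PolyBergman

/-! ### The half-plane, smooth functions on it, and differentiation -/

/-- The open upper half-plane `Π = {z ∈ ℂ : Im z > 0}`. -/
def halfPlane : Opens ℂ :=
  ⟨{z : ℂ | 0 < z.im}, isOpen_lt continuous_const Complex.continuous_im⟩

/-- The space `C^∞(Π)` of complex valued functions that are smooth (in the real sense) on `Π`;
they are extended by zero to `ℂ`, so that a function on `Π` has exactly one representative. -/
def smoothFunctions : Submodule ℂ (ℂ → ℂ) where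
  carrier := {f | ContDiffOn ℝ ∞ f halfPlane ∧ ∀ z ∉ halfPlane, f z = 0}
  add_mem' := by
    rintro f g ⟨hf, hf'⟩ ⟨hg, hg'⟩
    exact ⟨hf.add hg, fun z hz => by simp [hf' z hz, hg' z hz]⟩
  zero_mem' := ⟨contDiffOn_const, fun _ _ => rfl⟩
  smul_mem' := by
    rintro c f ⟨hf, hf'⟩
    exact ⟨hf.const_smul c, fun z hz => by simp [hf' z hz]⟩

/-- `C^∞(Π)` as a complex vector space. -/
abbrev Smooth : Type := ↥smoothFunctions

theorem contDiffOn_indicator {f : ℂ → ℂ} (hf : ContDiffOn ℝ ∞ f halfPlane) :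
    (halfPlane : Set ℂ).indicator f ∈ smoothFunctions :=
  ⟨hf.congr fun _ hz => indicator_of_mem hz f, fun _ hz => indicator_of_notMem hz f⟩

theorem differentiableAt_smooth (f : Smooth) {z : ℂ} (hz : z ∈ halfPlane) :
    DifferentiableAt ℝ (f : ℂ → ℂ) z :=
  (f.2.1.contDiffAt (halfPlane.isOpen.mem_nhds hz)).differentiableAt (by simp)

/-- The restriction to `Π` of a function that is smooth on `Π`, as an element of `C^∞(Π)`. -/
def Smooth.mk (f : ℂ → ℂ) (hf : ContDiffOn ℝ ∞ f halfPlane) : Smooth :=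
  ⟨(halfPlane : Set ℂ).indicator f, contDiffOn_indicator hf⟩

theorem contDiffOn_fderiv_apply (v : ℂ) (f : Smooth) :
    ContDiffOn ℝ ∞ (fun z => fderiv ℝ (f : ℂ → ℂ) z v) halfPlane :=
  (f.2.1.fderiv_of_isOpen halfPlane.isOpen (m := ∞) (by simp)).clm_apply contDiffOn_const

/-- The derivative in the real direction `v`, `f ↦ ∂_v f`, on `C^∞(Π)`. -/
def dirDeriv (v : ℂ) : Smooth →ₗ[ℂ] Smooth where
  toFun f := Smooth.mk (fun z => fderiv ℝ (f : ℂ → ℂ) z v) (contDiffOn_fderiv_apply v f)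
  map_add' f g := by
    ext z
    by_cases hz : z ∈ (halfPlane : Set ℂ)
    · have := fderiv_add (differentiableAt_smooth f hz) (differentiableAt_smooth g hz)
      simp [Smooth.mk, hz, this]
    · simp [Smooth.mk, hz]
  map_smul' c f := by
    ext z
    by_cases hz : z ∈ (halfPlane : Set ℂ)
    · have := fderiv_const_smul (differentiableAt_smooth f hz) c
      simp [Smooth.mk, hz, this]
    · simp [Smooth.mk, hz]

/-- The Wirtinger derivative `∂ = (∂_x - i ∂_y) / 2` on `C^∞(Π)`. -/
def dz : Smooth →ₗ[ℂ] Smooth :=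
  (1 / 2 : ℂ) • (dirDeriv 1 - Complex.I • dirDeriv Complex.I)

/-- The Cauchy-Riemann operator `∂̄ = (∂_x + i ∂_y) / 2` on `C^∞(Π)`. -/
def dzbar : Smooth →ₗ[ℂ] Smooth :=
  (1 / 2 : ℂ) • (dirDeriv 1 + Complex.I • dirDeriv Complex.I)

/-- The Laplacian `Δ = ∂_x² + ∂_y²` on `C^∞(Π)`. -/
def laplacian : Smooth →ₗ[ℂ] Smooth :=
  dirDeriv 1 ∘ₗ dirDeriv 1 + dirDeriv Complex.I ∘ₗ dirDeriv Complex.I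

/-- Multiplication by a smooth function on `C^∞(Π)`. -/
def mulBy (g : ℂ → ℂ) (hg : ContDiff ℝ ∞ g) : Smooth →ₗ[ℂ] Smooth where
  toFun f := ⟨fun z => g z * (f : ℂ → ℂ) z, hg.contDiffOn.mul f.2.1,
    fun z hz => by simp [f.2.2 z hz]⟩
  map_add' f h := by ext z; simp [mul_add]
  map_smul' c f := by ext z; simp [mul_left_comm]

/-- Multiplication by `y = Im z`. -/
def mulY : Smooth →ₗ[ℂ] Smooth :=
  mulBy (fun z => (z.im : ℂ)) (Complex.ofRealCLM.contDiff.comp Complex.imCLM.contDiff)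

/-- Multiplication by `z - z̄`. -/
def mulZSubConj : Smooth →ₗ[ℂ] Smooth :=
  mulBy (fun z => z - conj z) (contDiff_id.sub Complex.conjCLE.contDiff)

/-- The product `u v̄`. -/
def mulConj (u v : Smooth) : Smooth :=
  ⟨fun z => (u : ℂ → ℂ) z * conj ((v : ℂ → ℂ) z),
    u.2.1.mul (Complex.conjCLE.contDiff.comp_contDiffOn v.2.1),
    fun z hz => by simp [u.2.2 z hz]⟩

/-- The operator `S_Π^j u = ∂^j [(z - z̄)^j u] / j!`. -/
def creation (j : ℕ) : Smooth →ₗ[ℂ] Smooth :=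
  (1 / (j.factorial : ℂ)) • (dz ^ j * mulZSubConj ^ j : Module.End ℂ Smooth)

/-! ### Bergman, poly-Bergman and true poly-Bergman spaces on the half-plane -/

/-- Lebesgue area measure on `Π`. -/
def areaMeasure : Measure ℂ := volume.restrict (halfPlane : Set ℂ)

/-- The Hilbert space `L²(Π, dA)`. -/
abbrev L2 : Type := Lp ℂ 2 areaMeasure

/-- The classes in `L²(Π, dA)` that have a representative in a given linear space of smooth
functions. -/
def classesOf (V : Submodule ℂ Smooth) : Submodule ℂ L2 where
  carrier := {a | ∃ f ∈ V, (a : ℂ → ℂ) =ᵐ[areaMeasure] (f : ℂ → ℂ)}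
  add_mem' := by
    rintro a b ⟨f, hf, haf⟩ ⟨g, hg, hbg⟩
    exact ⟨f + g, V.add_mem hf hg, (Lp.coeFn_add a b).trans (haf.add hbg)⟩
  zero_mem' := ⟨0, V.zero_mem, Lp.coeFn_zero ℂ 2 areaMeasure⟩
  smul_mem' := by
    rintro c a ⟨f, hf, haf⟩
    exact ⟨c • f, V.smul_mem c hf, (Lp.coeFn_smul c a).trans (haf.const_smul c)⟩

/-- The holomorphic functions on `Π`. -/
def holomorphicFunctions : Submodule ℂ Smooth where
  carrier := {f | DifferentiableOn ℂ (f : ℂ → ℂ) halfPlane}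
  add_mem' hf hg := DifferentiableOn.add hf hg
  zero_mem' := differentiableOn_const 0
  smul_mem' c _ hf := DifferentiableOn.const_smul hf c

/-- The Bergman space `A(Π)` of square integrable holomorphic functions. -/
def bergman : Submodule ℂ L2 := classesOf holomorphicFunctions

/-- The poly-Bergman space `A_n(Π) = {f ∈ L²(Π) : ∂̄^n f = 0}`. -/
def polyBergman (n : ℕ) : Submodule ℂ L2 :=
  classesOf (LinearMap.ker (dzbar ^ n : Module.End ℂ Smooth))

/-- The true poly-Bergman space `A_{(j+1)}(Π) = A_{j+1}(Π) ⊖ A_j(Π)`, where `A_0(Π) = {0}`. -/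
def truePolyBergman (j : ℕ) : Submodule ℂ L2 :=
  polyBergman (j + 1) ⊓ (polyBergman j)ᗮ

/-- The elements of `A(Π)` as genuine functions. -/
def IsBergmanFunction (f : Smooth) : Prop :=
  f ∈ holomorphicFunctions ∧ MemLp (f : ℂ → ℂ) 2 areaMeasure

theorem contDiffOn_basis (k : ℕ) : ContDiffOn ℝ ∞
    (fun z : ℂ => (Real.sqrt ((k + 1) / Real.pi) : ℂ) *
      (2 * (z - Complex.I) ^ k / (z + Complex.I) ^ (k + 2))) halfPlane := by
  simp only [div_eq_mul_inv (2 * (_ : ℂ))]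
  refine contDiffOn_const.mul (ContDiffOn.mul ?_ (ContDiffOn.inv ?_ ?_))
  · exact (contDiff_const.mul ((contDiff_id.sub contDiff_const).pow k)).contDiffOn
  · exact ((contDiff_id.add contDiff_const).pow (k + 2)).contDiffOn
  · intro z hz h
    have h0 : z + Complex.I = 0 := eq_zero_of_pow_eq_zero h
    have h1 : z.im + 1 = 0 := by simpa using congrArg Complex.im h0
    have h2 : 0 < z.im := hz
    linarith

/-- The standard orthonormal basis of `A(Π)`,
`e_k(z) = √((k+1)/π) · 2 (z - i)^k / (z + i)^(k+2)`, `k = 0, 1, 2, …`. -/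
def basisFunction (k : ℕ) : Smooth := Smooth.mk _ (contDiffOn_basis k)

/-- The finite linear combinations of the standard basis functions. -/
def basisSpan : Submodule ℂ Smooth := Submodule.span ℂ (range basisFunction)

/-- The image under `S_Π^j` of the finite linear combinations of the standard basis functions. -/
def creationSpan (j : ℕ) : Submodule ℂ Smooth := basisSpan.map (creation j)

/-! ### Distributions on the half-plane -/

/-- A test function on `Π` as an element of `C^∞(Π)`. -/
def ofTest (φ : 𝓓(halfPlane, ℂ)) : Smooth :=
  ⟨φ, φ.contDiff.contDiffOn,
    fun _ hz => image_eq_zero_of_notMem_tsupport fun h => hz (φ.tsupport_subset h)⟩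

/-- The functions in `C^∞(Π̄) ∩ L¹(Π)`. -/
def IsSmoothUpToBoundaryL1 (φ : Smooth) : Prop :=
  (∃ ψ : ℂ → ℂ, ContDiffOn ℝ ∞ ψ {z : ℂ | 0 ≤ z.im} ∧ EqOn (φ : ℂ → ℂ) ψ halfPlane) ∧
    Integrable (φ : ℂ → ℂ) areaMeasure

/-- Linear functionals defined on some linear space of smooth functions on `Π`. -/
abbrev Functional : Type := Smooth →ₗ.[ℂ] ℂ

/-- `F` is a distribution on `Π` which is defined at least on `C^∞(Π̄) ∩ L¹(Π)`: it is a linear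
functional whose domain contains this space and whose restriction to the test functions is a
distribution, i.e. continuous on `𝓓(Π)`. -/
def IsSymbol (F : Functional) : Prop :=
  (∀ φ, IsSmoothUpToBoundaryL1 φ → φ ∈ F.domain) ∧
    ∃ T : 𝓓(halfPlane, ℂ) →L[ℂ] ℂ, ∀ φ, ∃ h : ofTest φ ∈ F.domain, F ⟨ofTest φ, h⟩ = T φ

/-- Two functionals define the same distribution on `Π`. -/
def EqAsDistributions (F G : Functional) : Prop :=
  ∀ φ : 𝓓(halfPlane, ℂ), ∃ (h : ofTest φ ∈ F.domain) (h' : ofTest φ ∈ G.domain),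
    F ⟨ofTest φ, h⟩ = G ⟨ofTest φ, h'⟩

/-- The functional `φ ↦ (F, L φ)`, defined for all `φ` with `L φ` in the domain of `F`. -/
def pullback (L : Smooth →ₗ[ℂ] Smooth) (F : Functional) : Functional where
  domain := F.domain.comap L
  toFun := F.toFun ∘ₗ L.restrict fun _ hx => hx

/-- `∂F`, that is `(∂F, φ) = -(F, ∂φ)`. -/
def distDz (F : Functional) : Functional := pullback (-dz) F

/-- `∂̄F`, that is `(∂̄F, φ) = -(F, ∂̄φ)`. -/
def distDzbar (F : Functional) : Functional := pullback (-dzbar) F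

/-- `ΔF`, that is `(ΔF, φ) = (F, Δφ)`. -/
def distLaplacian (F : Functional) : Functional := pullback laplacian F

/-- `yF`, that is `(yF, φ) = (F, yφ)`. -/
def distMulY (F : Functional) : Functional := pullback mulY F

/-! ### Polynomials in the operators `Δ(y²·)`, `∂̄(y·)`, `∂(y·)` -/

/-- The elementary operators on distributions: `Δ`, `∂`, `∂̄` and multiplication by `y`. -/
inductive Letter
  | lap
  | d
  | dbar
  | y

/-- The action of an elementary operator on distributions. -/
def Letter.act : Letter → Functional → Functional
  | .lap => distLaplacian
  | .d => distDz
  | .dbar => distDzbar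
  | .y => distMulY

/-- Every differentiation has weight `-1` (so `Δ` has weight `-2`), multiplication by `y` has
weight `1`. -/
def Letter.weight : Letter → ℤ
  | .lap => -2
  | .d => -1
  | .dbar => -1
  | .y => 1

/-- The three variables of the polynomial: `Δ(y²·)`, `∂̄(y·)` and `∂(y·)`. -/
inductive Gen
  | lapY2
  | dbarY
  | dY

/-- The elementary factors of the variables; the rightmost one acts first. -/
def Gen.factors : Gen → List Letter
  | .lapY2 => [.lap, .y, .y]
  | .dbarY => [.dbar, .y]
  | .dY => [.d, .y]

/-- Polynomials with complex coefficients in the three (non-commuting) variables `Δ(y²·)`,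
`∂̄(y·)`, `∂(y·)`; a monomial is a word in the variables. -/
abbrev OpPoly : Type := List Gen →₀ ℂ

/-- The elementary factors of a monomial. -/
def monomialFactors (w : List Gen) : List Letter := w.flatMap Gen.factors

/-- The weight of a monomial. -/
def monomialWeight (w : List Gen) : ℤ := ((monomialFactors w).map Letter.weight).sum

/-- The action of a monomial on distributions; the rightmost factor acts first. -/
def monomialAct (w : List Gen) (F : Functional) : Functional :=
  (monomialFactors w).foldr Letter.act F

/-- The distribution `KF`, where `K` is the operator given by the polynomial `P`. -/
def OpPoly.act (P : OpPoly) (F : Functional) : Functional :=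
  P.sum fun w c => c • monomialAct w F

/-- `P` has degree `n`. -/
def OpPoly.HasDegree (P : OpPoly) (n : ℕ) : Prop :=
  (∀ w ∈ P.support, w.length ≤ n) ∧ ∃ w ∈ P.support, w.length = n

/-! ### Toeplitz operators defined through sesquilinear forms -/

/-- The norm of `L²(Π, dA)`. -/
def l2norm (u : Smooth) : ℝ := (eLpNorm (u : ℂ → ℂ) 2 areaMeasure).toReal

/-- The sesquilinear form `⟨F u, v⟩ = (F, u v̄)` is defined and bounded, with respect to the norm
of `L²(Π, dA)`, for `u, v ∈ D`. -/
def FormBounded (D : Submodule ℂ Smooth) (F : Functional) : Prop :=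
  ∃ C : ℝ, ∀ u ∈ D, ∀ v ∈ D, ∃ h : mulConj u v ∈ F.domain,
    ‖F ⟨mulConj u v, h⟩‖ ≤ C * l2norm u * l2norm v

/-- `T` is the Toeplitz operator with symbol `F` in the space `H ⊆ L²(Π, dA)`: the bounded operator
with `⟨T u, v⟩ = (F, u v̄)` for all `u, v ∈ D`, where `D` is a linear space of functions in `H` on
which the form is initially given. (`inner ℂ b a` is linear in `a`, so that it is the scalar
product `⟨a, b⟩ = ∫ a b̄ dA`.) -/
def IsToeplitz (H : Submodule ℂ L2) (D : Submodule ℂ Smooth) (F : Functional)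
    (T : H →L[ℂ] H) : Prop :=
  ∀ u ∈ D, ∀ v ∈ D, ∃ a b : H,
    ((a : L2) : ℂ → ℂ) =ᵐ[areaMeasure] (u : ℂ → ℂ) ∧
    ((b : L2) : ℂ → ℂ) =ᵐ[areaMeasure] (v : ℂ → ℂ) ∧
    ∃ h : mulConj u v ∈ F.domain, inner ℂ b (T a) = F ⟨mulConj u v, h⟩

/-- The `n`-th singular number (`n = 0, 1, …`) of a bounded operator on a Hilbert space, i.e. its
distance in operator norm to the operators of rank at most `n`. -/
def singularNumber {H : Type*} [NormedAddCommGroup H] [InnerProductSpace ℂ H]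
    (T : H →L[ℂ] H) (n : ℕ) : ℝ :=
  sInf {r : ℝ | ∃ R : H →L[ℂ] H, (R : H →ₗ[ℂ] H).rank ≤ n ∧ r = ‖T - R‖}

/-- `T` belongs to the Schatten class of exponent `p`: its singular numbers are `p`-summable
(in particular they tend to zero, so that `T` is compact). -/
def IsSchatten {H : Type*} [NormedAddCommGroup H] [InnerProductSpace ℂ H]
    (p : ℝ) (T : H →L[ℂ] H) : Prop :=
  Summable fun n : ℕ => singularNumber T n ^ p

end PolyBergman

end

open PolyBergman

noncomputable section

namespace PolyBergman

/-! ### The ring of smooth functions and its derivations -/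

/-! The operator `K` is read off from the product `S^j f · conj (S^j g)`. Leibniz' rule gives `S^j f
= ∑ a_k y^k ∂^k f` with `a_j ≠ 0` (`creation_eq_sum_smul`). If `f` and `g` are holomorphic, `∂̄`
passes through `f` and `∂` annihilates `conj (∂^l g)`, so `∂^k f · conj (∂^l g) = ∂^k ∂̄^l (f ḡ)`.
Hence `S^j f · conj (S^j g) = L (f ḡ)` with `L = ∑ a_k conj(a_l) y^(k+l) ∂^k ∂̄^l`
(`mulConj_creation`), and `K` is the transpose of `L`: statement 1 is then `(F, Lφ) = (KF, φ)` at `φ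
= f ḡ`. That `L` is a polynomial of degree `j` in `y²Δ`, `y∂̄`, `y∂` follows by commuting powers of
`y` past derivatives; one factor `y²Δ` accounts for a pair `∂∂̄` (`weightZero_succ_succ`,
`exists_poly`).

The unitarity of `S^j` rests on `∫ S^j u · h̄ = const · ∫ y^j u · conj (∂̄^j h)`, obtained with
cutoffs. If `∂̄^j h = 0` it shows that `S^j u` is orthogonal to `A_j`. If `h = S^j v`, then `∂̄^j h
= ± ∂^j v`, and the same formula for the conjugate functions, on which `S^j` is the identity,
identifies the result with `∫ u v̄` (`integral_creation_mul_creation`). If `h ∈ A_(j+1)` is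
orthogonal to every `S^j e_k`, then the Cayley transform turns the integrals into radial moments of
a holomorphic function on the disc, whose Taylor coefficients must all vanish; so `∂̄^j h = 0`
(`iterate_dzbar_eq_zero_of_orthogonal`). For `j = 0` this is the totality of the basis, for general
`j` the surjectivity of `S^j` onto `A_(j+1)`. The extension by continuity is still given by the
differential expression, because `L²` convergence of holomorphic functions is locally uniform
together with all derivatives (`coeFn_creationExt`).

For statement 2, the forms of `F` on `S^j E` and of `KF` on `E` have equal values and the norms
agree, so they are bounded together; density and Riesz' theorem give unique operators
(`IsCore.existsUnique_isToeplitz`), which `S^j` intertwines. Compactness, singular numbers, rank and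
vanishing are unitary invariants. -/

theorem Smooth.ext_on {f g : Smooth} (h : ∀ z ∈ halfPlane, (f : ℂ → ℂ) z = (g : ℂ → ℂ) z) :
    f = g := by
  ext z
  by_cases hz : z ∈ halfPlane
  · exact h z hz
  · rw [f.2.2 z hz, g.2.2 z hz]

theorem Smooth.mk_apply {f : ℂ → ℂ} (hf : ContDiffOn ℝ ∞ f halfPlane) {z : ℂ}
    (hz : z ∈ halfPlane) : (Smooth.mk f hf : ℂ → ℂ) z = f z :=
  indicator_of_mem (s := (halfPlane : Set ℂ)) hz f

instance : Mul Smooth where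
  mul u v := ⟨fun z => (u : ℂ → ℂ) z * (v : ℂ → ℂ) z, u.2.1.mul v.2.1,
    fun z hz => by simp [u.2.2 z hz]⟩

/-- The unit is the indicator of `Π`, because elements of `Smooth` vanish off `Π`. With the ring
structure, `∂` and `∂̄` become derivations and `ring` applies to products of smooth functions. -/
instance : One Smooth where
  one := Smooth.mk (fun _ => 1) contDiffOn_const

theorem mul_apply (u v : Smooth) (z : ℂ) :
    ((u * v : Smooth) : ℂ → ℂ) z = (u : ℂ → ℂ) z * (v : ℂ → ℂ) z := rfl

theorem one_apply {z : ℂ} (hz : z ∈ halfPlane) : ((1 : Smooth) : ℂ → ℂ) z = 1 :=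
  Smooth.mk_apply contDiffOn_const hz

instance : CommRing Smooth :=
  { (inferInstance : AddCommGroup Smooth) with
    mul := (· * ·)
    one := 1
    mul_assoc := fun u v w => Subtype.ext (funext fun z => mul_assoc _ _ _)
    one_mul := fun u => Smooth.ext_on fun z hz => by rw [mul_apply, one_apply hz, one_mul]
    mul_one := fun u => Smooth.ext_on fun z hz => by rw [mul_apply, one_apply hz, mul_one]
    zero_mul := fun u => Subtype.ext (funext fun z => zero_mul _)
    mul_zero := fun u => Subtype.ext (funext fun z => mul_zero _)
    left_distrib := fun u v w => Subtype.ext (funext fun z => mul_add _ _ _)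
    right_distrib := fun u v w => Subtype.ext (funext fun z => add_mul _ _ _)
    mul_comm := fun u v => Subtype.ext (funext fun z => mul_comm _ _) }

instance : Algebra ℂ Smooth :=
  Algebra.ofModule (fun _ _ _ => Subtype.ext (funext fun _ => mul_assoc _ _ _))
    (fun _ _ _ => Subtype.ext (funext fun _ => mul_left_comm _ _ _))

theorem pow_apply (u : Smooth) (n : ℕ) {z : ℂ} (hz : z ∈ halfPlane) :
    ((u ^ n : Smooth) : ℂ → ℂ) z = (u : ℂ → ℂ) z ^ n := by
  induction n with
  | zero => simpa using one_apply hz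
  | succ n ih => rw [pow_succ, mul_apply, ih, pow_succ]

theorem add_apply (u v : Smooth) (z : ℂ) :
    ((u + v : Smooth) : ℂ → ℂ) z = (u : ℂ → ℂ) z + (v : ℂ → ℂ) z := rfl

theorem sub_apply (u v : Smooth) (z : ℂ) :
    ((u - v : Smooth) : ℂ → ℂ) z = (u : ℂ → ℂ) z - (v : ℂ → ℂ) z := rfl

theorem smul_apply (c : ℂ) (u : Smooth) (z : ℂ) :
    ((c • u : Smooth) : ℂ → ℂ) z = c * (u : ℂ → ℂ) z := rfl

theorem dirDeriv_apply (v : ℂ) (f : Smooth) {z : ℂ} (hz : z ∈ halfPlane) :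
    (dirDeriv v f : ℂ → ℂ) z = fderiv ℝ (f : ℂ → ℂ) z v :=
  Smooth.mk_apply (contDiffOn_fderiv_apply v f) hz

theorem dirDeriv_mul (v : ℂ) (f g : Smooth) :
    dirDeriv v (f * g) = f * dirDeriv v g + g * dirDeriv v f := by
  refine Smooth.ext_on fun z hz => ?_
  rw [add_apply, mul_apply, mul_apply, dirDeriv_apply v _ hz, dirDeriv_apply v _ hz,
    dirDeriv_apply v _ hz]
  have := fderiv_mul (differentiableAt_smooth f hz) (differentiableAt_smooth g hz)
  have h2 : ((f * g : Smooth) : ℂ → ℂ) = (f : ℂ → ℂ) * (g : ℂ → ℂ) := rfl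
  rw [h2, this]
  simp

/-- Both sides are values of the second Fréchet derivative, which is symmetric for smooth functions.
-/
theorem dirDeriv_comm (v w : ℂ) (f : Smooth) :
    dirDeriv v (dirDeriv w f) = dirDeriv w (dirDeriv v f) := by
  refine Smooth.ext_on fun z hz => ?_
  have key : ∀ v w : ℂ, (dirDeriv v (dirDeriv w f) : ℂ → ℂ) z =
      fderiv ℝ (fderiv ℝ (f : ℂ → ℂ)) z v w := by
    intro v w
    rw [dirDeriv_apply v _ hz]
    have h1 : (dirDeriv w f : ℂ → ℂ) =ᶠ[nhds z] fun z => fderiv ℝ (f : ℂ → ℂ) z w := by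
      filter_upwards [halfPlane.isOpen.mem_nhds hz] with x hx using dirDeriv_apply w f hx
    rw [h1.fderiv_eq]
    have h2 : DifferentiableAt ℝ (fderiv ℝ (f : ℂ → ℂ)) z :=
      ((f.2.1.fderiv_of_isOpen halfPlane.isOpen (m := ∞) (by simp)).contDiffAt
        (halfPlane.isOpen.mem_nhds hz)).differentiableAt (by simp)
    rw [fderiv_clm_apply h2 (differentiableAt_const _)]
    simp
  rw [key, key]
  have h3 : ContDiffAt ℝ ∞ (f : ℂ → ℂ) z := f.2.1.contDiffAt (halfPlane.isOpen.mem_nhds hz)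
  exact (h3.isSymmSndFDerivAt (by simp; exact WithTop.coe_le_coe.2 le_top)) v w

/-! ### Wirtinger derivatives as commuting derivations -/

theorem dz_eq (f : Smooth) :
    dz f = (1 / 2 : ℂ) • (dirDeriv 1 f - Complex.I • dirDeriv Complex.I f) := rfl

theorem dzbar_eq (f : Smooth) :
    dzbar f = (1 / 2 : ℂ) • (dirDeriv 1 f + Complex.I • dirDeriv Complex.I f) := rfl

theorem dz_mul (f g : Smooth) : dz (f * g) = f * dz g + g * dz f := by
  simp only [dz_eq, dirDeriv_mul, smul_sub, smul_add, mul_sub, mul_smul_comm]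
  abel

theorem dzbar_mul (f g : Smooth) : dzbar (f * g) = f * dzbar g + g * dzbar f := by
  simp only [dzbar_eq, dirDeriv_mul, smul_add, mul_add, mul_smul_comm]
  abel

/-- `∂` as a derivation. -/
def dzDer : Derivation ℂ Smooth Smooth := Derivation.mk' dz dz_mul

/-- `∂̄` as a derivation. -/
def dzbarDer : Derivation ℂ Smooth Smooth := Derivation.mk' dzbar dzbar_mul

theorem dzbar_one : dzbar 1 = 0 := dzbarDer.map_one_eq_zero

theorem dz_pow (f : Smooth) (n : ℕ) : dz (f ^ n) = (n : ℂ) • (f ^ (n - 1) * dz f) := by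
  have := dzDer.leibniz_pow f n
  rw [Nat.cast_smul_eq_nsmul]
  exact this

theorem dzbar_pow (f : Smooth) (n : ℕ) :
    dzbar (f ^ n) = (n : ℂ) • (f ^ (n - 1) * dzbar f) := by
  have := dzbarDer.leibniz_pow f n
  rw [Nat.cast_smul_eq_nsmul]
  exact this

theorem dz_dzbar (f : Smooth) : dz (dzbar f) = dzbar (dz f) := by
  simp only [dz_eq, dzbar_eq, map_smul, map_add, map_sub, dirDeriv_comm Complex.I 1]
  module

theorem laplacian_eq (f : Smooth) : laplacian f = (4 : ℂ) • dz (dzbar f) := by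
  have : laplacian f = dirDeriv 1 (dirDeriv 1 f) +
    dirDeriv Complex.I (dirDeriv Complex.I f) := rfl
  rw [this]
  simp only [dz_eq, dzbar_eq, map_smul, map_add, dirDeriv_comm Complex.I 1]
  match_scalars
  · norm_num
  · linear_combination Complex.I_mul_I
  all_goals ring

theorem iterate_dz_dzbar (k : ℕ) (f : Smooth) : (dz ^ k : Module.End ℂ Smooth) (dzbar f) =
    dzbar ((dz ^ k : Module.End ℂ Smooth) f) := by
  induction k with
  | zero => rfl
  | succ k ih => rw [pow_succ', Module.End.mul_apply, Module.End.mul_apply, ih, dz_dzbar]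

/-- The function `y = Im z` on `Π`. -/
def yS : Smooth := Smooth.mk (fun z => (z.im : ℂ))
  (Complex.ofRealCLM.contDiff.comp Complex.imCLM.contDiff).contDiffOn

theorem yS_apply {z : ℂ} (hz : z ∈ halfPlane) : (yS : ℂ → ℂ) z = z.im :=
  Smooth.mk_apply _ hz

theorem mulY_eq (f : Smooth) : mulY f = yS * f :=
  Smooth.ext_on fun z hz => by rw [mul_apply, yS_apply hz]; rfl

theorem mulZSubConj_eq (f : Smooth) : mulZSubConj f = (2 * Complex.I) • (yS * f) :=
  Smooth.ext_on fun z hz => by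
    rw [smul_apply, mul_apply, yS_apply hz]
    change (z - conj z) * _ = _
    rw [Complex.sub_conj]
    push_cast
    ring

theorem dirDeriv_yS (v : ℂ) : dirDeriv v yS = (v.im : ℂ) • (1 : Smooth) := by
  refine Smooth.ext_on fun z hz => ?_
  rw [dirDeriv_apply v _ hz, smul_apply, one_apply hz]
  have h1 : (yS : ℂ → ℂ) =ᶠ[nhds z] fun z => (z.im : ℂ) := by
    filter_upwards [halfPlane.isOpen.mem_nhds hz] with x hx using yS_apply hx
  rw [h1.fderiv_eq]
  have : HasFDerivAt (fun z : ℂ => (z.im : ℂ)) (Complex.ofRealCLM.comp Complex.imCLM) z :=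
    (Complex.ofRealCLM.comp Complex.imCLM).hasFDerivAt
  rw [this.fderiv]
  simp

theorem dz_yS : dz yS = (-Complex.I / 2) • (1 : Smooth) := by
  rw [dz_eq, dirDeriv_yS, dirDeriv_yS]
  simp only [Complex.one_im, Complex.I_im]
  module

theorem dzbar_yS : dzbar yS = (Complex.I / 2) • (1 : Smooth) := by
  rw [dzbar_eq, dirDeriv_yS, dirDeriv_yS]
  simp only [Complex.one_im, Complex.I_im]
  module

/-- Complex conjugation. -/
def conjS : Smooth →+* Smooth where
  toFun u := ⟨fun z => conj ((u : ℂ → ℂ) z), Complex.conjCLE.contDiff.comp_contDiffOn u.2.1,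
    fun z hz => by simp [u.2.2 z hz]⟩
  map_one' := Smooth.ext_on fun z hz => by simp [one_apply hz]
  map_mul' u v := Subtype.ext (funext fun z => by simp [mul_apply])
  map_zero' := Subtype.ext (funext fun z => by simp)
  map_add' u v := Subtype.ext (funext fun z => by simp)

theorem conjS_apply (u : Smooth) (z : ℂ) :
    (conjS u : ℂ → ℂ) z = conj ((u : ℂ → ℂ) z) := rfl

theorem conjS_conjS (u : Smooth) : conjS (conjS u) = u :=
  Subtype.ext (funext fun z => by simp [conjS_apply])

theorem conjS_smul (c : ℂ) (u : Smooth) : conjS (c • u) = conj c • conjS u :=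
  Subtype.ext (funext fun z => by simp [conjS_apply])

theorem conjS_yS : conjS yS = yS :=
  Smooth.ext_on fun z hz => by simp [conjS_apply, yS_apply hz]

theorem mulConj_eq (u v : Smooth) : mulConj u v = u * conjS v := rfl

theorem dirDeriv_conjS (v : ℂ) (u : Smooth) : dirDeriv v (conjS u) = conjS (dirDeriv v u) := by
  refine Smooth.ext_on fun z hz => ?_
  rw [conjS_apply, dirDeriv_apply v _ hz, dirDeriv_apply v _ hz]
  have h := (Complex.conjCLE : ℂ →L[ℝ] ℂ).hasFDerivAt.comp z
    (differentiableAt_smooth u hz).hasFDerivAt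
  have h2 : (conjS u : ℂ → ℂ) = (Complex.conjCLE : ℂ →L[ℝ] ℂ) ∘ (u : ℂ → ℂ) := rfl
  rw [h2, h.fderiv]
  simp

theorem dzbar_conjS (u : Smooth) : dzbar (conjS u) = conjS (dz u) := by
  rw [dz_eq, dzbar_eq, conjS_smul, map_sub, conjS_smul, dirDeriv_conjS, dirDeriv_conjS]
  simp [map_ofNat]

theorem dz_conjS (u : Smooth) : dz (conjS u) = conjS (dzbar u) := by
  rw [dz_eq, dzbar_eq, conjS_smul, map_add, conjS_smul, dirDeriv_conjS, dirDeriv_conjS]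
  simp [sub_eq_add_neg, map_ofNat]

theorem iterate_dzbar_conjS (k : ℕ) (u : Smooth) : (dzbar ^ k : Module.End ℂ Smooth) (conjS u) =
    conjS ((dz ^ k : Module.End ℂ Smooth) u) := by
  induction k with
  | zero => rfl
  | succ k ih => rw [pow_succ', pow_succ', Module.End.mul_apply, Module.End.mul_apply, ih,
      dzbar_conjS]

/-! ### Holomorphic functions as the kernel of `∂̄` -/

theorem mem_holomorphicFunctions_iff (f : Smooth) : f ∈ holomorphicFunctions ↔ dzbar f = 0 := by
  have key : ∀ z ∈ halfPlane, (DifferentiableAt ℂ (f : ℂ → ℂ) z ↔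
      (dzbar f : ℂ → ℂ) z = 0) := by
    intro z hz
    rw [differentiableAt_complex_iff_differentiableAt_real, dzbar_eq, smul_apply, add_apply,
      smul_apply, dirDeriv_apply _ _ hz, dirDeriv_apply _ _ hz]
    simp only [differentiableAt_smooth f hz, true_and, smul_eq_mul]
    constructor
    · intro h
      rw [h]
      linear_combination (1 / 2 : ℂ) * fderiv ℝ (f : ℂ → ℂ) z 1 * Complex.I_mul_I
    · intro h
      -- `-2i ∂̄f = Df(i) - i Df(1)`, and complex differentiability means that the right-hand side
      -- vanishes.
      linear_combination (-2 * Complex.I) * h +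
        fderiv ℝ (f : ℂ → ℂ) z Complex.I * Complex.I_mul_I
  constructor
  · intro h
    refine Smooth.ext_on fun z hz => ?_
    exact (key z hz).1 (DifferentiableOn.differentiableAt h (halfPlane.isOpen.mem_nhds hz))
  · intro h z hz
    refine ((key z hz).2 ?_).differentiableWithinAt
    rw [h]; rfl

theorem dz_apply_of_holomorphic {f : Smooth} (hf : f ∈ holomorphicFunctions) {z : ℂ}
    (hz : z ∈ halfPlane) : (dz f : ℂ → ℂ) z = deriv (f : ℂ → ℂ) z := by
  have hd : DifferentiableAt ℂ (f : ℂ → ℂ) z :=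
    DifferentiableOn.differentiableAt hf (halfPlane.isOpen.mem_nhds hz)
  rw [dz_eq, smul_apply, sub_apply, smul_apply, dirDeriv_apply _ _ hz, dirDeriv_apply _ _ hz,
    hd.fderiv_restrictScalars ℝ]
  have : fderiv ℂ (f : ℂ → ℂ) z Complex.I = Complex.I * deriv (f : ℂ → ℂ) z := by
    rw [← fderiv_apply_one_eq_deriv, ← smul_eq_mul, ← map_smul]; simp
  simp only [ContinuousLinearMap.coe_restrictScalars', this, fderiv_apply_one_eq_deriv]
  linear_combination (-1 / 2 : ℂ) * deriv (f : ℂ → ℂ) z * Complex.I_mul_I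

theorem dz_mem_holomorphicFunctions {f : Smooth} (hf : f ∈ holomorphicFunctions) :
    dz f ∈ holomorphicFunctions := by
  rw [mem_holomorphicFunctions_iff] at hf ⊢
  rw [← dz_dzbar, hf, map_zero]

theorem iterate_dz_mem_holomorphicFunctions {f : Smooth} (hf : f ∈ holomorphicFunctions) (k : ℕ) :
    (dz ^ k : Module.End ℂ Smooth) f ∈ holomorphicFunctions := by
  induction k with
  | zero => exact hf
  | succ k ih => rw [pow_succ']; exact dz_mem_holomorphicFunctions ih

/-! ### The operator `S^j` -/

theorem mulY_pow (m : ℕ) (u : Smooth) : (mulY ^ m : Module.End ℂ Smooth) u = yS ^ m * u := by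
  induction m with
  | zero => simp
  | succ m ih => rw [pow_succ', Module.End.mul_apply, ih, mulY_eq]; ring

theorem mulZSubConj_pow (m : ℕ) (u : Smooth) : (mulZSubConj ^ m : Module.End ℂ Smooth) u =
    (2 * Complex.I) ^ m • (yS ^ m * u) := by
  induction m with
  | zero => simp
  | succ m ih =>
    rw [pow_succ', Module.End.mul_apply, ih, mulZSubConj_eq, mul_smul_comm, smul_smul, ← mul_assoc,
      ← pow_succ', ← pow_succ']

theorem creation_apply (j : ℕ) (u : Smooth) : creation j u = (1 / (j.factorial : ℂ)) •
    (dz ^ j : Module.End ℂ Smooth) ((mulZSubConj ^ j : Module.End ℂ Smooth) u) := rfl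

theorem creation_zero (u : Smooth) : creation 0 u = u := by
  simp [creation_apply]

/-- The operator `R = (z - z̄) ∂`. -/
def raising : Smooth →ₗ[ℂ] Smooth := mulZSubConj ∘ₗ dz

theorem raising_apply (u : Smooth) : raising u = (2 * Complex.I) • (yS * dz u) :=
  mulZSubConj_eq _

/-- The commutation relation `[∂, z - z̄] = 1`, on which the recursions for `S^j` rest. -/
theorem dz_mulZSubConj (u : Smooth) : dz (mulZSubConj u) = u + mulZSubConj (dz u) := by
  rw [mulZSubConj_eq, mulZSubConj_eq, map_smul, dz_mul, dz_yS, mul_smul_comm, mul_one, smul_add,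
    smul_smul, add_comm]
  congr 1
  have : 2 * Complex.I * (-Complex.I / 2) = 1 := by linear_combination -Complex.I_mul_I
  rw [this, one_smul]

theorem iterate_dz_mulZSubConj (k : ℕ) (u : Smooth) :
    (dz ^ (k + 1) : Module.End ℂ Smooth) (mulZSubConj u) =
    ((k : ℂ) + 1) • (dz ^ k : Module.End ℂ Smooth) u +
      mulZSubConj ((dz ^ (k + 1) : Module.End ℂ Smooth) u) := by
  induction k with
  | zero => simp [dz_mulZSubConj]
  | succ k ih =>
    rw [pow_succ', Module.End.mul_apply, ih, map_add, dz_mulZSubConj, map_smul,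
      ← Module.End.mul_apply dz, ← Module.End.mul_apply dz, ← pow_succ', ← pow_succ']
    push_cast
    module

/-- Moving one factor `z - z̄` to the left past `∂^(j+1)` costs `(j+1) ∂^j`. So `S^j` is a
polynomial in the single first-order operator `R = (z - z̄)∂`, which makes induction on `j`
possible. -/
theorem creation_succ (j : ℕ) (u : Smooth) : creation (j + 1) u =
    (1 / ((j : ℂ) + 1)) • (raising (creation j u) + ((j : ℂ) + 1) • creation j u) := by
  rw [creation_apply, pow_succ' mulZSubConj, Module.End.mul_apply, iterate_dz_mulZSubConj,
    creation_apply, pow_succ' dz, Module.End.mul_apply]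
  set v := (dz ^ j : Module.End ℂ Smooth) ((mulZSubConj ^ j : Module.End ℂ Smooth) u)
  rw [map_smul, raising, LinearMap.comp_apply, Nat.factorial_succ]
  have h1 : ((j : ℂ) + 1) ≠ 0 := by exact_mod_cast j.succ_ne_zero
  have h2 : (j.factorial : ℂ) ≠ 0 := by exact_mod_cast j.factorial_ne_zero
  push_cast
  match_scalars <;> field_simp

/-- As a polynomial in `R`, `S^j` commutes with `R`, so the new factor may act first. This form
serves inductions in which the function under `S^j` changes at each step. -/
theorem creation_succ' (j : ℕ) (u : Smooth) : creation (j + 1) u =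
    (1 / ((j : ℂ) + 1)) • creation j (raising u + ((j : ℂ) + 1) • u) := by
  have key : ∀ j : ℕ, ∀ v, creation j (raising v) = raising (creation j v) := by
    intro j
    induction j with
    | zero => intro v; simp [creation_zero]
    | succ j ih => intro v; rw [creation_succ, ih, creation_succ, map_smul, map_add, map_smul]
  rw [creation_succ, map_add, map_smul, key]

/-- Leibniz' formula with all factors `z - z̄` on the left. The operators `T_k = (z - z̄)^k ∂^k`
satisfy `R T_k = k T_k + T_(k+1)`, and `creation_succ` turns this into a recursion for the
coefficients. -/
theorem creation_eq_sum (j : ℕ) (u : Smooth) : creation j u = ∑ k ∈ Finset.range (j + 1),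
    ((j.choose k : ℂ) / (k.factorial : ℂ)) •
      (mulZSubConj ^ k : Module.End ℂ Smooth) ((dz ^ k : Module.End ℂ Smooth) u) := by
  set T : ℕ → Smooth := fun k =>
    (mulZSubConj ^ k : Module.End ℂ Smooth) ((dz ^ k : Module.End ℂ Smooth) u) with hT
  have hR : ∀ k : ℕ, raising (T k) = (k : ℂ) • T k + T (k + 1) := by
    have h1 : ∀ (k : ℕ) (v : Smooth), raising ((mulZSubConj ^ k : Module.End ℂ Smooth) v) =
        (k : ℂ) • (mulZSubConj ^ k : Module.End ℂ Smooth) v +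
          (mulZSubConj ^ (k + 1) : Module.End ℂ Smooth) (dz v) := by
      intro k
      induction k with
      | zero => intro v; simp [raising]
      | succ k ih =>
        intro v
        have h2 : raising (mulZSubConj ((mulZSubConj ^ k : Module.End ℂ Smooth) v)) =
          mulZSubConj ((mulZSubConj ^ k : Module.End ℂ Smooth) v) +
            mulZSubConj (raising ((mulZSubConj ^ k : Module.End ℂ Smooth) v)) := by
          rw [raising, LinearMap.comp_apply, dz_mulZSubConj, map_add, LinearMap.comp_apply]
        rw [pow_succ', Module.End.mul_apply, h2, ih, map_add, map_smul,
          pow_succ' mulZSubConj (k + 1), Module.End.mul_apply]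
        push_cast
        module
    intro k
    rw [hT]
    simp only
    rw [h1, pow_succ' dz, Module.End.mul_apply]
  change creation j u = ∑ k ∈ Finset.range (j + 1),
    ((j.choose k : ℂ) / (k.factorial : ℂ)) • T k
  induction j with
  | zero => simp [creation_zero, hT]
  | succ j ih =>
    have h1 : ((j : ℂ) + 1) ≠ 0 := by exact_mod_cast j.succ_ne_zero
    -- Index shift; the factor `k` removes the added term at `k = 0`, where `k - 1` is truncated.
    have h3 : ∑ k ∈ Finset.range (j + 1), ((j.choose k : ℂ) / (k.factorial : ℂ)) • T (k + 1) =
        ∑ k ∈ Finset.range (j + 2), ((j.choose (k - 1) : ℂ) * k / (k.factorial : ℂ)) • T k := by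
      rw [Finset.sum_range_succ' _ (j + 1)]
      simp only [Nat.cast_zero, mul_zero, zero_div, zero_smul, add_zero, Nat.add_sub_cancel]
      refine Finset.sum_congr rfl fun k _ => ?_
      congr 1
      rw [Nat.factorial_succ]
      have : ((k : ℂ) + 1) ≠ 0 := by exact_mod_cast k.succ_ne_zero
      push_cast
      field_simp
    have h4 : ∑ k ∈ Finset.range (j + 1),
        ((j.choose k : ℂ) / (k.factorial : ℂ) * ((k : ℂ) + (j + 1))) • T k =
        ∑ k ∈ Finset.range (j + 2),
          ((j.choose k : ℂ) / (k.factorial : ℂ) * ((k : ℂ) + (j + 1))) • T k := by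
      rw [Finset.sum_range_succ _ (j + 1)]
      simp
    have h5 : raising (creation j u) + ((j : ℂ) + 1) • creation j u =
        ∑ k ∈ Finset.range (j + 1),
          ((j.choose k : ℂ) / (k.factorial : ℂ) * ((k : ℂ) + (j + 1))) • T k +
        ∑ k ∈ Finset.range (j + 1), ((j.choose k : ℂ) / (k.factorial : ℂ)) • T (k + 1) := by
      rw [ih, map_sum, Finset.smul_sum, ← Finset.sum_add_distrib, ← Finset.sum_add_distrib]
      refine Finset.sum_congr rfl fun k _ => ?_
      rw [map_smul, hR]
      module
    rw [creation_succ, h5, h3, h4, ← Finset.sum_add_distrib, Finset.smul_sum]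
    refine Finset.sum_congr rfl fun k _ => ?_
    rw [← add_smul, smul_smul]
    congr 1
    have h6 : (k.factorial : ℂ) ≠ 0 := by exact_mod_cast k.factorial_ne_zero
    field_simp
    rcases k with _ | k
    · simp
    · have h7 := Nat.choose_succ_succ j k
      have h8 : ((j.choose (k + 1) : ℂ)) * (k + 1) = j.choose k * ((j : ℂ) - k) := by
        rcases le_or_gt k j with h | h
        · rw [← Nat.cast_sub h]
          exact_mod_cast Nat.choose_succ_right_eq j k
        · rw [Nat.choose_eq_zero_of_lt h, Nat.choose_eq_zero_of_lt (h.trans k.lt_succ_self)]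
          simp
      rw [h7]
      push_cast
      linear_combination h8

theorem creation_eq_sum_smul (j : ℕ) (u : Smooth) :
    creation j u = ∑ k ∈ Finset.range (j + 1),
      ((j.choose k : ℂ) / (k.factorial : ℂ) * (2 * Complex.I) ^ k) •
        (yS ^ k * (dz ^ k : Module.End ℂ Smooth) u) := by
  rw [creation_eq_sum]
  exact Finset.sum_congr rfl fun k _ => by rw [mulZSubConj_pow, smul_smul]

theorem dzbar_mulZSubConj (u : Smooth) :
    dzbar (mulZSubConj u) = -u + mulZSubConj (dzbar u) := by
  rw [mulZSubConj_eq, mulZSubConj_eq, map_smul, dzbar_mul, dzbar_yS, mul_smul_comm, mul_one,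
    smul_add, smul_smul, add_comm]
  congr 1
  have : 2 * Complex.I * (Complex.I / 2) = -1 := by linear_combination Complex.I_mul_I
  rw [this, neg_one_smul]

/-- For holomorphic `f`, the product is a polynomial in `z̄` with holomorphic coefficients, and `∂̄`
differentiates it in `z̄`. -/
theorem dzbar_mulZSubConj_pow (k : ℕ) {f : Smooth} (hf : dzbar f = 0) :
    dzbar ((mulZSubConj ^ (k + 1) : Module.End ℂ Smooth) f) =
      (-((k : ℂ) + 1)) • (mulZSubConj ^ k : Module.End ℂ Smooth) f := by
  induction k with
  | zero => simp [dzbar_mulZSubConj, hf]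
  | succ k ih =>
    rw [pow_succ', Module.End.mul_apply, dzbar_mulZSubConj, ih, map_smul,
      ← Module.End.mul_apply mulZSubConj, ← pow_succ']
    push_cast
    module

theorem iterate_dzbar_mulZSubConj_pow (k : ℕ) {f : Smooth} (hf : dzbar f = 0) :
    (dzbar ^ k : Module.End ℂ Smooth) ((mulZSubConj ^ k : Module.End ℂ Smooth) f) =
      ((-1) ^ k * (k.factorial : ℂ)) • f := by
  induction k with
  | zero => simp
  | succ k ih =>
    rw [pow_succ dzbar, Module.End.mul_apply, dzbar_mulZSubConj_pow k hf, map_smul, ih, smul_smul,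
      Nat.factorial_succ]
    congr 1
    push_cast
    ring

/-- `∂̄^j S^j f = (-1)^j ∂^j f` for holomorphic `f`. -/
theorem iterate_dzbar_creation (j : ℕ) {f : Smooth} (hf : dzbar f = 0) :
    (dzbar ^ j : Module.End ℂ Smooth) (creation j f) =
      (-1 : ℂ) ^ j • (dz ^ j : Module.End ℂ Smooth) f := by
  have hcomm : ∀ (l : ℕ) (u : Smooth), (dzbar ^ l : Module.End ℂ Smooth)
      ((dz ^ j : Module.End ℂ Smooth) u) = (dz ^ j : Module.End ℂ Smooth)
      ((dzbar ^ l : Module.End ℂ Smooth) u) := by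
    intro l
    induction l with
    | zero => intro u; rfl
    | succ l ih =>
      intro u
      rw [pow_succ', Module.End.mul_apply, ih, ← iterate_dz_dzbar, Module.End.mul_apply]
  -- With `∂̄^j` moved past `∂^j`, it meets `(z - z̄)^j f` and produces `(-1)^j j! f`, which cancels
  -- the normalization `1 / j!`.
  rw [creation_apply, map_smul, hcomm, iterate_dzbar_mulZSubConj_pow j hf, map_smul, smul_smul]
  congr 1
  have : (j.factorial : ℂ) ≠ 0 := by exact_mod_cast j.factorial_ne_zero
  field_simp

theorem creation_mem_ker (j : ℕ) {f : Smooth} (hf : f ∈ holomorphicFunctions) :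
    creation j f ∈ LinearMap.ker (dzbar ^ (j + 1) : Module.End ℂ Smooth) := by
  have h := (mem_holomorphicFunctions_iff f).1 hf
  rw [LinearMap.mem_ker, pow_succ', Module.End.mul_apply, iterate_dzbar_creation j h, map_smul,
    ← iterate_dz_dzbar, h, map_zero, smul_zero]

/-! ### The weight zero operators `y^(k+l) ∂^k ∂̄^l` -/

/-- The operator `u ↦ y^(k+l) ∂^k ∂̄^l u`. -/
def weightZero (k l : ℕ) : Module.End ℂ Smooth := mulY ^ (k + l) * dz ^ k * dzbar ^ l

theorem weightZero_apply (k l : ℕ) (u : Smooth) : weightZero k l u =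
    yS ^ (k + l) * (dz ^ k : Module.End ℂ Smooth) ((dzbar ^ l : Module.End ℂ Smooth) u) := by
  rw [weightZero, Module.End.mul_apply, Module.End.mul_apply, mulY_pow]

/-- Commutes `y∂` with `y^m`, using `∂y = -i/2`. The case `m = 0` is separate in the proof because
of the truncated exponent `m - 1`. -/
theorem yS_mul_dz_pow_mul (m : ℕ) (v : Smooth) : yS * dz (yS ^ m * v) =
    yS ^ (m + 1) * dz v - (Complex.I / 2 * m) • (yS ^ m * v) := by
  rw [dz_mul, dz_pow, dz_yS]
  rcases m with _ | m
  · simp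
  · simp only [Nat.add_sub_cancel, mul_add, mul_smul_comm, mul_one, smul_smul]
    have h1 : yS * (yS ^ (m + 1) * dz v) = yS ^ (m + 1 + 1) * dz v := by ring
    have h2 : yS * (v * yS ^ m) = yS ^ (m + 1) * v := by ring
    rw [h1, h2]
    module

theorem yS_mul_dzbar_pow_mul (m : ℕ) (v : Smooth) : yS * dzbar (yS ^ m * v) =
    yS ^ (m + 1) * dzbar v + (Complex.I / 2 * m) • (yS ^ m * v) := by
  rw [dzbar_mul, dzbar_pow, dzbar_yS]
  rcases m with _ | m
  · simp
  · simp only [Nat.add_sub_cancel, mul_add, mul_smul_comm, mul_one, smul_smul]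
    have h1 : yS * (yS ^ (m + 1) * dzbar v) = yS ^ (m + 1 + 1) * dzbar v := by ring
    have h2 : yS * (v * yS ^ m) = yS ^ (m + 1) * v := by ring
    rw [h1, h2]
    module

theorem weightZero_succ_left (k l : ℕ) : weightZero (k + 1) l =
    (mulY * dz) * weightZero k l + (Complex.I / 2 * (k + l)) • weightZero k l := by
  ext1 u
  rw [LinearMap.add_apply, LinearMap.smul_apply, Module.End.mul_apply, Module.End.mul_apply,
    mulY_eq, weightZero_apply k, yS_mul_dz_pow_mul, weightZero_apply, pow_succ' dz,
    Module.End.mul_apply, show k + 1 + l = k + l + 1 by ring]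
  push_cast
  module

theorem weightZero_succ_right (k l : ℕ) : weightZero k (l + 1) =
    (mulY * dzbar) * weightZero k l - (Complex.I / 2 * (k + l)) • weightZero k l := by
  ext1 u
  rw [LinearMap.sub_apply, LinearMap.smul_apply, Module.End.mul_apply, Module.End.mul_apply,
    mulY_eq, weightZero_apply k l, yS_mul_dzbar_pow_mul, weightZero_apply, pow_succ' dzbar,
    Module.End.mul_apply, iterate_dz_dzbar, show k + (l + 1) = k + l + 1 by ring]
  push_cast
  module

theorem mulY_mulY_laplacian : (mulY * mulY * laplacian : Module.End ℂ Smooth) =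
    (4 : ℂ) • ((mulY * dz) * (mulY * dzbar)) + (2 * Complex.I) • (mulY * dzbar) := by
  ext1 u
  simp only [LinearMap.add_apply, LinearMap.smul_apply, Module.End.mul_apply, mulY_eq,
    laplacian_eq]
  have := yS_mul_dz_pow_mul 1 (dzbar u)
  rw [pow_one] at this
  rw [this, mul_smul_comm, mul_smul_comm]
  have h2 : yS * (yS * dz (dzbar u)) = yS ^ (1 + 1) * dz (dzbar u) := by ring
  rw [h2]
  push_cast
  module

/-- One variable `y²Δ` replaces the product of `y∂` and `y∂̄`, up to terms with fewer derivatives.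
This is why a polynomial of degree `j` suffices for an operator of order `2j`. -/
theorem weightZero_succ_succ (k l : ℕ) : weightZero (k + 1) (l + 1) =
    (1 / 4 : ℂ) • ((mulY * mulY * laplacian) * weightZero k l) +
      (Complex.I / 2 * (k + l)) • ((mulY * dzbar) * weightZero k l) -
      (Complex.I / 2 * (k + l)) • ((mulY * dz) * weightZero k l) +
      (((k : ℂ) + l) * (k + l + 1) / 4) • weightZero k l := by
  rw [weightZero_succ_left, weightZero_succ_right, mulY_mulY_laplacian]
  simp only [mul_sub, mul_smul_comm, add_mul, smul_mul_assoc, smul_add, smul_sub, smul_smul,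
    mul_assoc]
  push_cast
  match_scalars
  · norm_num
  · ring
  · ring
  · linear_combination (-((k : ℂ) + l) * (k + l + 1) / 4) * Complex.I_mul_I

/-- The source of `K`: by holomorphy, `∂^k f · conj (∂^l g) = ∂^k ∂̄^l (f ḡ)`, so the product
depends on `f ḡ` alone, through a differential operator. The identity is pointwise and needs no
integrability. -/
theorem mulConj_creation (j : ℕ) {f g : Smooth} (hf : f ∈ holomorphicFunctions)
    (hg : g ∈ holomorphicFunctions) : mulConj (creation j f) (creation j g) =
    ∑ k ∈ Finset.range (j + 1), ∑ l ∈ Finset.range (j + 1),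
      (((j.choose k : ℂ) / (k.factorial : ℂ) * (2 * Complex.I) ^ k) *
        conj ((j.choose l : ℂ) / (l.factorial : ℂ) * (2 * Complex.I) ^ l)) •
        weightZero k l (mulConj f g) := by
  have hol := (mem_holomorphicFunctions_iff _).1 hf
  have hbar : ∀ (l : ℕ) (v : Smooth), (dzbar ^ l : Module.End ℂ Smooth) (f * v) =
      f * (dzbar ^ l : Module.End ℂ Smooth) v := by
    intro l v
    induction l with
    | zero => rfl
    | succ l ih =>
      -- `∂̄f = 0`, so all antiholomorphic derivatives fall on the other factor.
      rw [pow_succ', Module.End.mul_apply, ih, dzbar_mul, hol, mul_zero, add_zero,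
        Module.End.mul_apply]
  have hdz : ∀ (k : ℕ) (v : Smooth), dz v = 0 → (dz ^ k : Module.End ℂ Smooth) (f * v) =
      (dz ^ k : Module.End ℂ Smooth) f * v := by
    intro k v hv
    induction k with
    | zero => rfl
    | succ k ih =>
      rw [pow_succ', Module.End.mul_apply, ih, dz_mul, hv, mul_zero, zero_add,
        Module.End.mul_apply, mul_comm]
  rw [mulConj_eq, creation_eq_sum_smul, creation_eq_sum_smul, map_sum, Finset.sum_mul_sum]
  refine Finset.sum_congr rfl fun k _ => Finset.sum_congr rfl fun l _ => ?_
  rw [conjS_smul, smul_mul_smul_comm, map_mul conjS, map_pow conjS, conjS_yS, weightZero_apply, mulConj_eq,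
    hbar, iterate_dzbar_conjS, hdz]
  · congr 1
    ring
  · rw [dz_conjS, (mem_holomorphicFunctions_iff _).1 (iterate_dz_mem_holomorphicFunctions hg l),
      map_zero]

/-! ### Values of functionals -/

/-- `φ` is in the domain of `F` and `F φ = v`. -/
def HasValue (F : Functional) (φ : Smooth) (v : ℂ) : Prop := ∃ h : φ ∈ F.domain, F ⟨φ, h⟩ = v

theorem HasValue.unique {F : Functional} {φ : Smooth} {v w : ℂ} (h : HasValue F φ v)
    (h' : HasValue F φ w) : v = w := by
  obtain ⟨h1, rfl⟩ := h
  obtain ⟨_, rfl⟩ := h'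
  rfl

theorem hasValue_of_mem {F : Functional} {φ : Smooth} (h : φ ∈ F.domain) :
    HasValue F φ (F ⟨φ, h⟩) := ⟨h, rfl⟩

theorem HasValue.add {F : Functional} {φ ψ : Smooth} {v w : ℂ} (h : HasValue F φ v)
    (h' : HasValue F ψ w) : HasValue F (φ + ψ) (v + w) := by
  obtain ⟨h1, rfl⟩ := h
  obtain ⟨h2, rfl⟩ := h'
  exact ⟨F.domain.add_mem h1 h2, F.map_add ⟨φ, h1⟩ ⟨ψ, h2⟩⟩

theorem HasValue.smul {F : Functional} {φ : Smooth} {v : ℂ} (h : HasValue F φ v) (c : ℂ) :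
    HasValue F (c • φ) (c * v) := by
  obtain ⟨h1, rfl⟩ := h
  exact ⟨F.domain.smul_mem c h1, F.map_smul c ⟨φ, h1⟩⟩

theorem hasValue_zero (F : Functional) : HasValue F 0 0 := ⟨F.domain.zero_mem, F.map_zero⟩

theorem HasValue.sum {ι : Type*} {F : Functional} {s : Finset ι} {φ : ι → Smooth} {v : ι → ℂ}
    (h : ∀ i ∈ s, HasValue F (φ i) (v i)) : HasValue F (∑ i ∈ s, φ i) (∑ i ∈ s, v i) := by
  classical
  induction s using Finset.induction_on with
  | empty => exact hasValue_zero F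
  | insert a s ha ih =>
    rw [Finset.sum_insert ha, Finset.sum_insert ha]
    exact (h a (Finset.mem_insert_self a s)).add
      (ih fun i hi => h i (Finset.mem_insert_of_mem hi))

theorem hasValue_pullback {L : Smooth →ₗ[ℂ] Smooth} {F : Functional} {φ : Smooth} {v : ℂ} :
    HasValue (pullback L F) φ v ↔ HasValue F (L φ) v := Iff.rfl

theorem hasValue_sum_left {ι : Type*} {s : Finset ι} {F : ι → Functional} {φ : Smooth}
    {v : ι → ℂ} (h : ∀ i ∈ s, HasValue (F i) φ (v i)) :
    HasValue (∑ i ∈ s, F i) φ (∑ i ∈ s, v i) := by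
  classical
  induction s using Finset.induction_on with
  | empty => exact ⟨Submodule.mem_top, rfl⟩
  | insert a s ha ih =>
    rw [Finset.sum_insert ha, Finset.sum_insert ha]
    obtain ⟨h1, h1'⟩ := h a (Finset.mem_insert_self a s)
    obtain ⟨h2, h2'⟩ := ih fun i hi => h i (Finset.mem_insert_of_mem hi)
    refine ⟨⟨h1, h2⟩, ?_⟩
    rw [← h1', ← h2']
    exact LinearPMap.add_apply _ _ _

theorem mem_domain_of_mem_domain_sum {ι : Type*} {s : Finset ι} {F : ι → Functional} {φ : Smooth}
    (h : φ ∈ (∑ i ∈ s, F i).domain) : ∀ i ∈ s, φ ∈ (F i).domain := by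
  classical
  induction s using Finset.induction_on with
  | empty => simp
  | insert a s ha ih =>
    rw [Finset.sum_insert ha] at h
    intro i hi
    rcases Finset.mem_insert.1 hi with rfl | hi
    · exact h.1
    · exact ih h.2 i hi

theorem HasValue.smul_left {F : Functional} {φ : Smooth} {v : ℂ} (h : HasValue F φ v) (c : ℂ) :
    HasValue (c • F) φ (c * v) := by
  obtain ⟨h1, rfl⟩ := h
  exact ⟨h1, LinearPMap.smul_apply c F ⟨φ, h1⟩⟩

/-! ### The transposed action of polynomials -/

/-- The transpose of a variable. -/
def Gen.trans : Gen → Module.End ℂ Smooth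
  | .lapY2 => mulY * mulY * laplacian
  | .dbarY => mulY * (-dzbar)
  | .dY => mulY * (-dz)

/-- The transpose of a monomial. -/
def wordTrans : List Gen → Module.End ℂ Smooth
  | [] => 1
  | g :: w => wordTrans w * g.trans

theorem wordTrans_append (v w : List Gen) : wordTrans (v ++ w) = wordTrans w * wordTrans v := by
  induction v with
  | nil => simp [wordTrans]
  | cons g v ih => rw [List.cons_append, wordTrans, ih, wordTrans, mul_assoc]

theorem monomialAct_eq (w : List Gen) (F : Functional) :
    monomialAct w F = pullback (wordTrans w) F := by
  induction w with
  | nil => rfl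
  | cons g w ih =>
    have : monomialAct (g :: w) F = g.factors.foldr Letter.act (monomialAct w F) := by
      simp [monomialAct, monomialFactors, List.flatMap_cons, List.foldr_append]
    rw [this, ih]
    cases g <;> rfl

/-- The transpose of the operator given by a polynomial. -/
def polyTrans : OpPoly →ₗ[ℂ] Module.End ℂ Smooth := Finsupp.linearCombination ℂ wordTrans

/-- A sum of partially defined functionals lives on the intersection of the domains, so `P.act F`
may be defined on less than `F ∘ polyTrans P`. The values agree once every monomial is defined at
`φ`; conversely, `wordTrans_mem_of_mem_domain` derives this from membership in the domain of `P.act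
F`. -/
theorem hasValue_act {P : OpPoly} {F : Functional} {φ : Smooth}
    (h : ∀ w ∈ P.support, wordTrans w φ ∈ F.domain) {v : ℂ} :
    HasValue (P.act F) φ v ↔ HasValue F (polyTrans P φ) v := by
  have h1 : ∀ w, ∃ v, w ∈ P.support → HasValue F (wordTrans w φ) v := by
    intro w
    by_cases hw : w ∈ P.support
    · exact ⟨_, fun _ => hasValue_of_mem (h w hw)⟩
    · exact ⟨0, fun h => absurd h hw⟩
  choose c hc using h1
  have h2 : HasValue (P.act F) φ (∑ w ∈ P.support, P w * c w) :=
    hasValue_sum_left fun w hw => HasValue.smul_left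
      (by rw [monomialAct_eq, hasValue_pullback]; exact hc w hw) _
  have h3 : HasValue F (polyTrans P φ) (∑ w ∈ P.support, P w * c w) := by
    have : polyTrans P φ = ∑ w ∈ P.support, P w • wordTrans w φ := by
      rw [polyTrans, Finsupp.linearCombination_apply, Finsupp.sum, LinearMap.sum_apply]
      rfl
    rw [this]
    exact HasValue.sum fun w hw => (hc w hw).smul _
  constructor
  · intro h; rwa [h.unique h2]
  · intro h; rwa [h.unique h3]

theorem wordTrans_mem_of_mem_domain {P : OpPoly} {F : Functional} {φ : Smooth}
    (h : φ ∈ (P.act F).domain) : ∀ w ∈ P.support, wordTrans w φ ∈ F.domain := by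
  intro w hw
  have := mem_domain_of_mem_domain_sum h w hw
  rw [LinearPMap.smul_domain, monomialAct_eq] at this
  exact this

theorem monomialWeight_eq_zero (w : List Gen) : monomialWeight w = 0 := by
  induction w with
  | nil => rfl
  | cons g w ih =>
    have : monomialWeight (g :: w) = (g.factors.map Letter.weight).sum + monomialWeight w := by
      simp [monomialWeight, monomialFactors, List.flatMap_cons]
    rw [this, ih]
    cases g <;> rfl

/-! ### Representation of operators by polynomials -/

/-- `T` is the transpose of a polynomial of degree at most `n` whose coefficient at the monomial
`(Δ(y²·))^n` is `c`. -/
def IsRepresented (T : Module.End ℂ Smooth) (n : ℕ) (c : ℂ) : Prop :=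
  ∃ P : OpPoly, (∀ w ∈ P.support, w.length ≤ n) ∧ P (List.replicate n Gen.lapY2) = c ∧
    polyTrans P = T

theorem isRepresented_zero (n : ℕ) : IsRepresented 0 n 0 := ⟨0, by simp, rfl, map_zero _⟩

theorem IsRepresented.add {T T' : Module.End ℂ Smooth} {n : ℕ} {c c' : ℂ}
    (h : IsRepresented T n c) (h' : IsRepresented T' n c') :
    IsRepresented (T + T') n (c + c') := by
  classical
  obtain ⟨P, h1, h2, h3⟩ := h
  obtain ⟨P', h1', h2', h3'⟩ := h'
  refine ⟨P + P', fun w hw => ?_, by rw [Finsupp.add_apply, h2, h2'], by rw [map_add, h3, h3']⟩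
  rcases Finset.mem_union.1 (Finsupp.support_add hw) with hw | hw
  exacts [h1 w hw, h1' w hw]

theorem IsRepresented.smul {T : Module.End ℂ Smooth} {n : ℕ} {c : ℂ}
    (h : IsRepresented T n c) (a : ℂ) : IsRepresented (a • T) n (a * c) := by
  obtain ⟨P, h1, h2, h3⟩ := h
  exact ⟨a • P, fun w hw => h1 w (Finsupp.support_smul hw), by simp [h2], by rw [map_smul, h3]⟩

theorem IsRepresented.sub {T T' : Module.End ℂ Smooth} {n : ℕ} {c c' : ℂ}
    (h : IsRepresented T n c) (h' : IsRepresented T' n c') :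
    IsRepresented (T - T') n (c - c') := by
  have := h.add (h'.smul (-1))
  convert this using 1
  · ext1 u
    simp [sub_eq_add_neg]
  · ring

theorem IsRepresented.sum {ι : Type*} {s : Finset ι} {T : ι → Module.End ℂ Smooth} {n : ℕ}
    {c : ι → ℂ} (h : ∀ i ∈ s, IsRepresented (T i) n (c i)) :
    IsRepresented (∑ i ∈ s, T i) n (∑ i ∈ s, c i) := by
  classical
  induction s using Finset.induction_on with
  | empty => exact isRepresented_zero n
  | insert a s ha ih =>
    rw [Finset.sum_insert ha, Finset.sum_insert ha]
    exact (h a (Finset.mem_insert_self a s)).add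
      (ih fun i hi => h i (Finset.mem_insert_of_mem hi))

/-- The pure word in `Δ(y²·)` of the larger length exceeds the old degree bound, so its coefficient
is zero. Following this single coefficient is enough to show in the end that the degree is exactly
`j`. -/
theorem IsRepresented.mono {T : Module.End ℂ Smooth} {n m : ℕ} {c : ℂ}
    (h : IsRepresented T n c) (hm : n < m) : IsRepresented T m 0 := by
  obtain ⟨P, h1, -, h3⟩ := h
  refine ⟨P, fun w hw => (h1 w hw).trans hm.le, ?_, h3⟩
  by_contra hne
  have := h1 _ (Finsupp.mem_support_iff.2 hne)
  rw [List.length_replicate] at this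
  omega

theorem append_injective (g : Gen) : Function.Injective fun w : List Gen => w ++ [g] :=
  fun _ _ h => List.append_cancel_right h

theorem polyTrans_mapDomain (g : Gen) (P : OpPoly) :
    polyTrans (P.mapDomain fun w => w ++ [g]) = g.trans * polyTrans P := by
  have : ∀ w : List Gen, wordTrans (w ++ [g]) = g.trans * wordTrans w := fun w => by
    rw [wordTrans_append]; simp [wordTrans]
  rw [polyTrans, Finsupp.linearCombination_mapDomain, Finsupp.linearCombination_apply,
    Finsupp.linearCombination_apply, Finsupp.sum, Finsupp.sum, Finset.mul_sum]
  exact Finset.sum_congr rfl fun w _ => by rw [mul_smul_comm, Function.comp_apply, this]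

/-- Transposition reverses products: multiplying the transpose on the left by a transposed variable
appends that variable at the right end of each word. -/
theorem IsRepresented.exists_mul {T : Module.End ℂ Smooth} {n : ℕ} {c : ℂ}
    (h : IsRepresented T n c) (g : Gen) : ∃ P : OpPoly, (∀ w ∈ P.support, w.length ≤ n + 1) ∧
      (∀ w, P (w ++ [g]) ≠ 0 → w.length ≤ n) ∧ P (List.replicate n Gen.lapY2 ++ [g]) = c ∧
      (∀ w, w ∉ range (fun w : List Gen => w ++ [g]) → P w = 0) ∧
      polyTrans P = g.trans * T := by
  classical
  obtain ⟨P, h1, h2, h3⟩ := h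
  refine ⟨P.mapDomain fun w => w ++ [g], fun w hw => ?_, fun w hw => ?_, ?_, fun w hw => ?_, ?_⟩
  · obtain ⟨v, hv, rfl⟩ := Finset.mem_image.1 (Finsupp.mapDomain_support hw)
    simpa using h1 v hv
  · rw [Finsupp.mapDomain_apply (append_injective g)] at hw
    exact h1 w (Finsupp.mem_support_iff.2 hw)
  · rw [Finsupp.mapDomain_apply (append_injective g), h2]
  · exact Finsupp.mapDomain_of_notMem_range _ _ hw
  · rw [polyTrans_mapDomain, h3]

theorem IsRepresented.lap_mul {T : Module.End ℂ Smooth} {n : ℕ} {c : ℂ}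
    (h : IsRepresented T n c) : IsRepresented ((mulY * mulY * laplacian) * T) (n + 1) c := by
  obtain ⟨P, h1, -, h3, -, h5⟩ := h.exists_mul .lapY2
  exact ⟨P, h1, by rw [List.replicate_succ', h3], h5⟩

theorem IsRepresented.trans_mul {T : Module.End ℂ Smooth} {n : ℕ} {c : ℂ}
    (h : IsRepresented T n c) {g : Gen} (hg : g ≠ .lapY2) :
    IsRepresented (g.trans * T) (n + 1) 0 := by
  obtain ⟨P, h1, -, -, h4, h5⟩ := h.exists_mul g
  refine ⟨P, h1, h4 _ ?_, h5⟩
  -- The pure word ends in `Δ(y²·)`, while every word of the new polynomial ends in `g`.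
  rintro ⟨w, hw⟩
  rw [List.replicate_succ'] at hw
  exact hg (by simpa using (List.append_inj' hw rfl).2)

theorem IsRepresented.dz_mul {T : Module.End ℂ Smooth} {n : ℕ} {c : ℂ}
    (h : IsRepresented T n c) : IsRepresented ((mulY * dz) * T) (n + 1) 0 := by
  have h1 := (h.trans_mul (g := .dY) (by simp)).smul (-1)
  rw [mul_zero] at h1
  convert h1 using 1
  ext1 u
  simp [Gen.trans, Module.End.mul_apply]

theorem IsRepresented.dzbar_mul {T : Module.End ℂ Smooth} {n : ℕ} {c : ℂ}
    (h : IsRepresented T n c) : IsRepresented ((mulY * dzbar) * T) (n + 1) 0 := by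
  have h1 := (h.trans_mul (g := .dbarY) (by simp)).smul (-1)
  rw [mul_zero] at h1
  convert h1 using 1
  ext1 u
  simp [Gen.trans, Module.End.mul_apply]

theorem isRepresented_one : IsRepresented 1 0 1 := by
  classical
  refine ⟨Finsupp.single [] 1, fun w hw => ?_, by simp, ?_⟩
  · have := Finsupp.support_single_subset hw
    rw [Finset.mem_singleton] at this
    simp [this]
  · simp [polyTrans, wordTrans]

theorem isRepresented_weightZero_diag (l : ℕ) :
    IsRepresented (weightZero l l) l ((1 / 4 : ℂ) ^ l) := by
  induction l with
  | zero =>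
    have : weightZero 0 0 = 1 := by ext1 u; simp [weightZero]
    rw [this, pow_zero]
    exact isRepresented_one
  | succ l ih =>
    rw [weightZero_succ_succ]
    -- Only the first summand of `weightZero_succ_succ` contributes to the tracked coefficient; its
    -- factor `1/4` comes from `Δ = 4 ∂∂̄`.
    have := (((ih.lap_mul.smul (1 / 4)).add (ih.dzbar_mul.smul (Complex.I / 2 * (l + l)))).sub
      (ih.dz_mul.smul (Complex.I / 2 * (l + l)))).add
      ((ih.mono l.lt_succ_self).smul (((l : ℂ) + l) * (l + l + 1) / 4))
    convert this using 1
    ring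

/-- Off the diagonal, the `d` excess derivatives are supplied by `y∂`, one variable each, so the
degree is bounded by the larger of the two orders. -/
theorem isRepresented_weightZero_left (l d : ℕ) :
    ∃ c, IsRepresented (weightZero (l + d) l) (l + d) c ∧ (0 < d → c = 0) := by
  induction d with
  | zero => exact ⟨_, isRepresented_weightZero_diag l, by simp⟩
  | succ d ih =>
    obtain ⟨c, ih, -⟩ := ih
    refine ⟨0, ?_, fun _ => rfl⟩
    rw [← add_assoc, weightZero_succ_left]
    have := ih.dz_mul.add ((ih.mono (l + d).lt_succ_self).smul
      (Complex.I / 2 * (((l + d : ℕ) : ℂ) + l)))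
    simpa using this

theorem isRepresented_weightZero_right (k d : ℕ) :
    ∃ c, IsRepresented (weightZero k (k + d)) (k + d) c ∧ (0 < d → c = 0) := by
  induction d with
  | zero => exact ⟨_, isRepresented_weightZero_diag k, by simp⟩
  | succ d ih =>
    obtain ⟨c, ih, -⟩ := ih
    refine ⟨0, ?_, fun _ => rfl⟩
    rw [← add_assoc, weightZero_succ_right]
    have := ih.dzbar_mul.sub ((ih.mono (k + d).lt_succ_self).smul
      (Complex.I / 2 * ((k : ℂ) + (k + d : ℕ))))
    simpa using this

theorem isRepresented_weightZero {j k l : ℕ} (hk : k ≤ j) (hl : l ≤ j) :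
    IsRepresented (weightZero k l) j (if k = j ∧ l = j then (1 / 4 : ℂ) ^ j else 0) := by
  split_ifs with h
  · rw [h.1, h.2]; exact isRepresented_weightZero_diag j
  · rcases le_or_gt l k with hlk | hlk
    · obtain ⟨d, rfl⟩ := Nat.exists_eq_add_of_le hlk
      obtain ⟨c, h1, h2⟩ := isRepresented_weightZero_left l d
      rcases hk.lt_or_eq with hk | rfl
      · exact h1.mono hk
      · rwa [h2 (by omega)] at h1
    · obtain ⟨d, rfl⟩ := Nat.exists_eq_add_of_le hlk.le
      obtain ⟨c, h1, h2⟩ := isRepresented_weightZero_right k d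
      rcases hl.lt_or_eq with hl | rfl
      · exact h1.mono hl
      · rwa [h2 (by omega)] at h1

/-! ### The operator `K` as a polynomial and as a sum of weight zero terms -/

/-- The coefficients of `S^j f = ∑ a_k y^k ∂^k f`. -/
def creationCoeff (j k : ℕ) : ℂ := (j.choose k : ℂ) / (k.factorial : ℂ) * (2 * Complex.I) ^ k

/-- The transpose of the differential operator `K`. -/
def symbolTrans (j : ℕ) : Module.End ℂ Smooth :=
  ∑ k ∈ Finset.range (j + 1), ∑ l ∈ Finset.range (j + 1),
    (creationCoeff j k * conj (creationCoeff j l)) • weightZero k l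

theorem symbolTrans_mulConj (j : ℕ) {f g : Smooth} (hf : f ∈ holomorphicFunctions)
    (hg : g ∈ holomorphicFunctions) :
    symbolTrans j (mulConj f g) = mulConj (creation j f) (creation j g) := by
  rw [mulConj_creation j hf hg, symbolTrans, LinearMap.sum_apply]
  refine Finset.sum_congr rfl fun k _ => ?_
  rw [LinearMap.sum_apply]
  rfl

theorem creationCoeff_self_ne_zero (j : ℕ) : creationCoeff j j ≠ 0 := by
  have : (j.factorial : ℂ) ≠ 0 := by exact_mod_cast j.factorial_ne_zero
  simp [creationCoeff, this]

/-- Among the terms of `symbolTrans`, only `k = l = j` reaches the word `(Δ(y²·))^j`. Its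
coefficient is `|a_j|² / 4^j ≠ 0`, so the degree is exactly `j`. -/
theorem exists_poly (j : ℕ) : ∃ P : OpPoly, P.HasDegree j ∧ polyTrans P = symbolTrans j := by
  have h : IsRepresented (symbolTrans j) j (∑ k ∈ Finset.range (j + 1),
      ∑ l ∈ Finset.range (j + 1), creationCoeff j k * conj (creationCoeff j l) *
        (if k = j ∧ l = j then (1 / 4 : ℂ) ^ j else 0)) :=
    IsRepresented.sum fun k hk => IsRepresented.sum fun l hl =>
      (isRepresented_weightZero (Nat.lt_succ_iff.1 (Finset.mem_range.1 hk))
        (Nat.lt_succ_iff.1 (Finset.mem_range.1 hl))).smul _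
  obtain ⟨P, h1, h2, h3⟩ := h
  refine ⟨P, ⟨h1, List.replicate j .lapY2, ?_, List.length_replicate⟩, h3⟩
  rw [Finsupp.mem_support_iff, h2, Finset.sum_eq_single j, Finset.sum_eq_single j]
  · simp [creationCoeff_self_ne_zero]
  · intro l _ hl; simp [hl]
  · simp
  · intro k _ hk; simp [hk]
  · simp

/-- The coefficients of `K F = ∑ c_kl ∂^k ∂̄^l (y^(k+l) F)`. -/
def symbolCoeff (j k l : ℕ) : ℂ :=
  (-1) ^ (k + l) * (creationCoeff j k * conj (creationCoeff j l))

theorem hasValue_iterate_pullback (L : Smooth →ₗ[ℂ] Smooth) (n : ℕ) (F : Functional) (φ : Smooth)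
    (v : ℂ) : HasValue ((pullback L)^[n] F) φ v ↔
      HasValue F ((L ^ n : Module.End ℂ Smooth) φ) v := by
  induction n generalizing φ with
  | zero => rfl
  | succ n ih =>
    rw [Function.iterate_succ_apply', hasValue_pullback, ih, pow_succ, Module.End.mul_apply]

theorem neg_pow_apply (L : Module.End ℂ Smooth) (n : ℕ) (φ : Smooth) :
    ((-L) ^ n) φ = (-1 : ℂ) ^ n • (L ^ n) φ := by
  induction n with
  | zero => simp
  | succ n ih =>
    rw [pow_succ', Module.End.mul_apply, ih, pow_succ' L, Module.End.mul_apply, map_smul,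
      LinearMap.neg_apply, pow_succ]
    module

theorem hasValue_symbol_sum {j : ℕ} {F : Functional} {φ : Smooth}
    (h : ∀ k l, weightZero k l φ ∈ F.domain) {v : ℂ} (hv : HasValue F (symbolTrans j φ) v) :
    HasValue (∑ k ∈ Finset.range (j + 1), ∑ l ∈ Finset.range (j + 1),
      symbolCoeff j k l • distDz^[k] (distDzbar^[l] (distMulY^[k + l] F))) φ v := by
  choose c hc using fun k l => (⟨_, hasValue_of_mem (h k l)⟩ : ∃ v, HasValue F (weightZero k l φ) v)
  have h1 : HasValue F (symbolTrans j φ) (∑ k ∈ Finset.range (j + 1),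
      ∑ l ∈ Finset.range (j + 1), creationCoeff j k * conj (creationCoeff j l) * c k l) := by
    rw [symbolTrans, LinearMap.sum_apply]
    refine HasValue.sum fun k _ => ?_
    rw [LinearMap.sum_apply]
    exact HasValue.sum fun l _ => (hc k l).smul _
  rw [hv.unique h1]
  refine hasValue_sum_left fun k _ => hasValue_sum_left fun l _ => ?_
  -- Each of the `k + l` transposed differentiations contributes a sign; `symbolCoeff` carries the
  -- same sign and cancels it.
  have h2 : HasValue (distDz^[k] (distDzbar^[l] (distMulY^[k + l] F))) φ
      ((-1) ^ (k + l) * c k l) := by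
    have e1 : distDz = pullback (-dz) := rfl
    have e2 : distDzbar = pullback (-dzbar) := rfl
    have e3 : distMulY = pullback mulY := rfl
    rw [e1, e2, e3, hasValue_iterate_pullback, hasValue_iterate_pullback,
      hasValue_iterate_pullback, neg_pow_apply, neg_pow_apply, map_smul, map_smul, map_smul,
      smul_smul, ← pow_add]
    have hcomm : (dzbar ^ l : Module.End ℂ Smooth) ((dz ^ k : Module.End ℂ Smooth) φ) =
        (dz ^ k : Module.End ℂ Smooth) ((dzbar ^ l : Module.End ℂ Smooth) φ) := by
      clear * -
      induction l with
      | zero => rfl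
      | succ l ih => rw [pow_succ', Module.End.mul_apply, ih, ← iterate_dz_dzbar,
          Module.End.mul_apply]
    rw [hcomm, add_comm l k]
    exact (hc k l).smul _
  have h3 := h2.smul_left (symbolCoeff j k l)
  convert h3 using 1
  rw [symbolCoeff]
  have : ((-1 : ℂ) ^ (k + l)) * (-1) ^ (k + l) = 1 := by rw [← mul_pow]; simp
  linear_combination (-(creationCoeff j k * conj (creationCoeff j l) * c k l)) * this

/-! ### Rational functions with decay -/

theorem add_I_ne_zero {z : ℂ} (hz : 0 ≤ z.im) : z + Complex.I ≠ 0 := by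
  intro h
  have h1 : z.im + 1 = 0 := by simpa using congrArg Complex.im h
  linarith

theorem contDiffOn_inv_add_I :
    ContDiffOn ℝ ∞ (fun z : ℂ => (z + Complex.I)⁻¹) {z : ℂ | 0 ≤ z.im} :=
  (contDiff_id.add contDiff_const).contDiffOn.inv fun _ hz => add_I_ne_zero hz

theorem halfPlane_subset : (halfPlane : Set ℂ) ⊆ {z : ℂ | 0 ≤ z.im} :=
  fun z hz => (show 0 < z.im from hz).le

theorem im_pos {z : ℂ} (hz : z ∈ halfPlane) : 0 < z.im := hz

/-- The function `1 / (z + i)`. -/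
def rhoS : Smooth := Smooth.mk _ (contDiffOn_inv_add_I.mono halfPlane_subset)

theorem rhoS_apply {z : ℂ} (hz : z ∈ halfPlane) : (rhoS : ℂ → ℂ) z = (z + Complex.I)⁻¹ :=
  Smooth.mk_apply _ hz

theorem hasDerivAt_rhoS {z : ℂ} (hz : z ∈ halfPlane) :
    HasDerivAt (rhoS : ℂ → ℂ) (-((z + Complex.I)⁻¹ ^ 2)) z := by
  have h1 : (rhoS : ℂ → ℂ) =ᶠ[nhds z] fun z => (z + Complex.I)⁻¹ := by
    filter_upwards [halfPlane.isOpen.mem_nhds hz] with x hx using rhoS_apply hx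
  refine HasDerivAt.congr_of_eventuallyEq ?_ h1
  have := ((hasDerivAt_id z).add_const Complex.I).inv (add_I_ne_zero (im_pos hz).le)
  have h2 : -((z + Complex.I)⁻¹ ^ 2) = -1 / (id z + Complex.I) ^ 2 := by
    rw [id, inv_pow, neg_div, one_div]
  rw [h2]
  exact this

theorem rhoS_mem_holomorphicFunctions : rhoS ∈ holomorphicFunctions :=
  fun _ hz => (hasDerivAt_rhoS hz).differentiableAt.differentiableWithinAt

theorem dzbar_rhoS : dzbar rhoS = 0 :=
  (mem_holomorphicFunctions_iff _).1 rhoS_mem_holomorphicFunctions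

theorem dz_rhoS : dz rhoS = -(rhoS ^ 2) := by
  refine Smooth.ext_on fun z hz => ?_
  rw [dz_apply_of_holomorphic rhoS_mem_holomorphicFunctions hz, (hasDerivAt_rhoS hz).deriv]
  have : ((-(rhoS ^ 2) : Smooth) : ℂ → ℂ) z = -(((rhoS ^ 2 : Smooth) : ℂ → ℂ) z) := rfl
  rw [this, pow_apply _ _ hz, rhoS_apply hz]

theorem im_mul_norm_rhoS_le {z : ℂ} (hz : z ∈ halfPlane) : z.im * ‖(rhoS : ℂ → ℂ) z‖ ≤ 1 := by
  have h0 := im_pos hz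
  rw [rhoS_apply hz, norm_inv, ← div_eq_mul_inv,
    div_le_one (norm_pos_iff.2 (add_I_ne_zero h0.le))]
  have h1 := Complex.abs_im_le_norm (z + Complex.I)
  have h2 : |(z + Complex.I).im| = z.im + 1 := by
    rw [Complex.add_im, Complex.I_im, abs_of_pos (by linarith)]
  linarith

theorem norm_rhoS_le {z : ℂ} (hz : z ∈ halfPlane) : ‖(rhoS : ℂ → ℂ) z‖ ≤ 1 := by
  have h0 := im_pos hz
  rw [rhoS_apply hz, norm_inv]
  apply inv_le_one_of_one_le₀
  have h1 := Complex.abs_im_le_norm (z + Complex.I)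
  have h2 : |(z + Complex.I).im| = z.im + 1 := by
    rw [Complex.add_im, Complex.I_im, abs_of_pos (by linarith)]
  linarith

theorem norm_rhoS_sq_le {z : ℂ} (hz : z ∈ halfPlane) :
    ‖(rhoS : ℂ → ℂ) z‖ ^ 2 ≤ (1 + ‖z‖ ^ 2)⁻¹ := by
  have h0 := im_pos hz
  rw [rhoS_apply hz, norm_inv, inv_pow]
  apply inv_anti₀ (by positivity)
  rw [← Complex.normSq_eq_norm_sq, ← Complex.normSq_eq_norm_sq, Complex.normSq_apply,
    Complex.normSq_apply]
  simp
  nlinarith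

/-- `|z + i|^(-4)` is at most `(1 + |z|²)^(-2)` on `Π`, which is integrable since its decay exponent
`4` exceeds the real dimension `2`. -/
theorem integrable_norm_rhoS_pow_four :
    Integrable (fun z => ‖(rhoS : ℂ → ℂ) z‖ ^ 4) areaMeasure := by
  have h1 : Integrable (fun z : ℂ => (1 + ‖z‖ ^ 2) ^ (-(4 : ℝ) / 2)) areaMeasure :=
    (integrable_rpow_neg_one_add_norm_sq (by rw [Complex.finrank_real_complex]; norm_num)).restrict
  refine h1.mono' ?_ ?_
  · have := (rhoS.2.1.continuousOn.norm.pow 4).aestronglyMeasurable (μ := volume)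
      halfPlane.isOpen.measurableSet
    exact this
  · refine (ae_restrict_iff' halfPlane.isOpen.measurableSet).2 (Filter.Eventually.of_forall ?_)
    intro z hz
    have h2 : (1 + ‖z‖ ^ 2) ^ (-(4 : ℝ) / 2) = ((1 + ‖z‖ ^ 2)⁻¹) ^ 2 := by
      rw [show -(4 : ℝ) / 2 = -(2 : ℕ) by norm_num, Real.rpow_neg (by positivity),
        Real.rpow_natCast, inv_pow]
    rw [h2, Real.norm_of_nonneg (by positivity), show 4 = 2 * 2 by norm_num, pow_mul]
    exact pow_le_pow_left₀ (by positivity) (norm_rhoS_sq_le hz) 2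

/-! ### Rational functions graded by decay: degree 2 is square integrable, degree 4 is in `C^∞(Π̄) ∩
L¹(Π)` -/

/-- The span of the functions `y^a (z + i)^(-p) (z̄ - i)^(-q)` with `a + m ≤ p + q`. -/
def decay (m : ℕ) : Submodule ℂ Smooth :=
  Submodule.span ℂ {u | ∃ a p q : ℕ, a + m ≤ p + q ∧ u = yS ^ a * rhoS ^ p * conjS rhoS ^ q}

theorem mem_decay {m a p q : ℕ} (h : a + m ≤ p + q) :
    yS ^ a * rhoS ^ p * conjS rhoS ^ q ∈ decay m :=
  Submodule.subset_span ⟨a, p, q, h, rfl⟩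

theorem rhoS_pow_mem_decay (p : ℕ) : rhoS ^ p ∈ decay p := by
  have := mem_decay (m := p) (a := 0) (p := p) (q := 0) (by simp)
  rwa [pow_zero, pow_zero, one_mul, mul_one] at this

theorem decay_anti {m n : ℕ} (h : m ≤ n) : decay n ≤ decay m :=
  Submodule.span_mono fun _ ⟨a, p, q, h1, h2⟩ => ⟨a, p, q, by omega, h2⟩

theorem yS_mul_mem_decay {m : ℕ} {u : Smooth} (hu : u ∈ decay (m + 1)) : yS * u ∈ decay m := by
  induction hu using Submodule.span_induction with
  | mem u hu =>
    obtain ⟨a, p, q, h, rfl⟩ := hu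
    have : yS * (yS ^ a * rhoS ^ p * conjS rhoS ^ q) =
      yS ^ (a + 1) * rhoS ^ p * conjS rhoS ^ q := by ring
    rw [this]
    exact mem_decay (by omega)
  | zero => simp
  | add u v _ _ hu hv => rw [mul_add]; exact add_mem hu hv
  | smul c u _ hu => rw [mul_smul_comm]; exact Submodule.smul_mem _ _ hu

theorem mul_mem_decay {m n : ℕ} {u v : Smooth} (hu : u ∈ decay m) (hv : v ∈ decay n) :
    u * v ∈ decay (m + n) := by
  induction hu using Submodule.span_induction with
  | mem u hu =>
    obtain ⟨a, p, q, h, rfl⟩ := hu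
    induction hv using Submodule.span_induction with
    | mem v hv =>
      obtain ⟨a', p', q', h', rfl⟩ := hv
      have : yS ^ a * rhoS ^ p * conjS rhoS ^ q * (yS ^ a' * rhoS ^ p' * conjS rhoS ^ q') =
        yS ^ (a + a') * rhoS ^ (p + p') * conjS rhoS ^ (q + q') := by ring
      rw [this]
      exact mem_decay (by omega)
    | zero => simp
    | add u v _ _ hu hv => rw [mul_add]; exact add_mem hu hv
    | smul c u _ hu => rw [mul_smul_comm]; exact Submodule.smul_mem _ _ hu
  | zero => simp
  | add u v _ _ hu hv => rw [add_mul]; exact add_mem hu hv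
  | smul c u _ hu => rw [smul_mul_assoc]; exact Submodule.smul_mem _ _ hu

theorem conjS_mem_decay {m : ℕ} {u : Smooth} (hu : u ∈ decay m) : conjS u ∈ decay m := by
  induction hu using Submodule.span_induction with
  | mem u hu =>
    obtain ⟨a, p, q, h, rfl⟩ := hu
    have : conjS (yS ^ a * rhoS ^ p * conjS rhoS ^ q) = yS ^ a * rhoS ^ q * conjS rhoS ^ p := by
      simp only [map_mul, map_pow, conjS_yS, conjS_conjS]
      ring
    rw [this]
    exact mem_decay (by omega)
  | zero => simp
  | add u v _ _ hu hv => rw [map_add]; exact add_mem hu hv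
  | smul c u _ hu => rw [conjS_smul]; exact Submodule.smul_mem _ _ hu

/-- A derivative either raises the exponent of `1/(z + i)` or lowers that of `y`; both improve the
decay by one. -/
theorem dz_mem_decay {m : ℕ} {u : Smooth} (hu : u ∈ decay m) : dz u ∈ decay (m + 1) := by
  induction hu using Submodule.span_induction with
  | mem u hu =>
    obtain ⟨a, p, q, h, rfl⟩ := hu
    have h0 : dz (conjS rhoS) = 0 := by rw [dz_conjS, dzbar_rhoS, map_zero]
    have : dz (yS ^ a * rhoS ^ p * conjS rhoS ^ q) =
        (-(p : ℂ)) • (yS ^ a * (rhoS ^ (p - 1) * rhoS ^ 2) * conjS rhoS ^ q) +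
        ((a : ℂ) * (-Complex.I / 2)) • (yS ^ (a - 1) * rhoS ^ p * conjS rhoS ^ q) := by
      rw [dz_mul, dz_mul, dz_pow, dz_pow, dz_pow, h0, dz_yS, dz_rhoS]
      simp only [mul_zero, smul_zero, zero_add, mul_smul_comm, mul_one, smul_smul, mul_add,
        mul_neg]
      rw [show conjS rhoS ^ q * (yS ^ a * (rhoS ^ (p - 1) * rhoS ^ 2)) =
        yS ^ a * (rhoS ^ (p - 1) * rhoS ^ 2) * conjS rhoS ^ q by ring,
        show conjS rhoS ^ q * (rhoS ^ p * yS ^ (a - 1)) =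
          yS ^ (a - 1) * rhoS ^ p * conjS rhoS ^ q by ring]
      module
    rw [this]
    refine add_mem (Submodule.smul_mem _ _ ?_) ?_
    · rw [← pow_add]; exact mem_decay (by omega)
    -- For `a = 0` the coefficient vanishes; there the truncated power `y^(a-1)` would not have
    -- gained decay.
    · rcases a with _ | a
      · simp
      · exact Submodule.smul_mem _ _ (mem_decay (by omega))
  | zero => simp
  | add u v _ _ hu hv => rw [map_add]; exact add_mem hu hv
  | smul c u _ hu => rw [map_smul]; exact Submodule.smul_mem _ _ hu

theorem dzbar_mem_decay {m : ℕ} {u : Smooth} (hu : u ∈ decay m) : dzbar u ∈ decay (m + 1) := by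
  rw [← conjS_conjS u, dzbar_conjS]
  exact conjS_mem_decay (dz_mem_decay (conjS_mem_decay hu))

/-- Each factor `y` is absorbed by one factor `|z + i|^(-1)`, since `y ≤ |z + i|`; the surplus
factors are at most `1`. -/
theorem exists_norm_le_of_mem_decay {m : ℕ} {u : Smooth} (hu : u ∈ decay m) :
    ∃ C : ℝ, 0 ≤ C ∧ ∀ z ∈ halfPlane, ‖(u : ℂ → ℂ) z‖ ≤ C * ‖(rhoS : ℂ → ℂ) z‖ ^ m := by
  induction hu using Submodule.span_induction with
  | mem u hu =>
    obtain ⟨a, p, q, h, rfl⟩ := hu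
    refine ⟨1, zero_le_one, fun z hz => ?_⟩
    rw [mul_apply, mul_apply, pow_apply _ _ hz, pow_apply _ _ hz, pow_apply _ _ hz, yS_apply hz,
      conjS_apply]
    simp only [norm_mul, norm_pow, RCLike.norm_conj, Complex.norm_real, Real.norm_eq_abs,
      abs_of_pos (im_pos hz)]
    set r := ‖(rhoS : ℂ → ℂ) z‖
    have h1 : z.im ^ a * r ^ p * r ^ q = (z.im * r) ^ a * r ^ (p + q - a) := by
      rw [mul_assoc, ← pow_add, mul_pow, mul_assoc, ← pow_add]
      congr 2
      omega
    rw [h1]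
    refine mul_le_mul (pow_le_one₀ (mul_nonneg (im_pos hz).le (norm_nonneg _))
      (im_mul_norm_rhoS_le hz)) ?_ (by positivity) zero_le_one
    exact pow_le_pow_of_le_one (norm_nonneg _) (norm_rhoS_le hz) (by omega)
  | zero => exact ⟨0, le_rfl, fun z _ => by simp⟩
  | add u v _ _ hu hv =>
    obtain ⟨C, hC, h1⟩ := hu
    obtain ⟨D, hD, h2⟩ := hv
    refine ⟨C + D, add_nonneg hC hD, fun z hz => ?_⟩
    rw [add_apply, add_mul]
    exact (norm_add_le _ _).trans (add_le_add (h1 z hz) (h2 z hz))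
  | smul c u _ hu =>
    obtain ⟨C, hC, h1⟩ := hu
    refine ⟨‖c‖ * C, by positivity, fun z hz => ?_⟩
    rw [smul_apply, norm_mul, mul_assoc]
    exact mul_le_mul_of_nonneg_left (h1 z hz) (norm_nonneg _)

theorem exists_extension_of_mem_decay {m : ℕ} {u : Smooth} (hu : u ∈ decay m) :
    ∃ ψ : ℂ → ℂ, ContDiffOn ℝ ∞ ψ {z : ℂ | 0 ≤ z.im} ∧ EqOn (u : ℂ → ℂ) ψ halfPlane := by
  induction hu using Submodule.span_induction with
  | mem u hu =>
    obtain ⟨a, p, q, h, rfl⟩ := hu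
    refine ⟨fun z => (z.im : ℂ) ^ a * (z + Complex.I)⁻¹ ^ p * (conj (z + Complex.I)⁻¹) ^ q,
      ?_, fun z hz => ?_⟩
    · have h1 : ContDiff ℝ ∞ fun z : ℂ => (z.im : ℂ) :=
        Complex.ofRealCLM.contDiff.comp Complex.imCLM.contDiff
      exact ((h1.contDiffOn.pow a).mul (contDiffOn_inv_add_I.pow p)).mul
        ((Complex.conjCLE.contDiff.comp_contDiffOn contDiffOn_inv_add_I).pow q)
    · have hz' : z ∈ halfPlane := hz
      rw [mul_apply, mul_apply, pow_apply _ _ hz', pow_apply _ _ hz', pow_apply _ _ hz',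
        yS_apply hz', conjS_apply, rhoS_apply hz']
  | zero => exact ⟨0, contDiffOn_const, fun z _ => rfl⟩
  | add u v _ _ hu hv =>
    obtain ⟨ψ, h1, h2⟩ := hu
    obtain ⟨χ, h3, h4⟩ := hv
    exact ⟨ψ + χ, h1.add h3, fun z hz => congrArg₂ (· + ·) (h2 hz) (h4 hz)⟩
  | smul c u _ hu =>
    obtain ⟨ψ, h1, h2⟩ := hu
    exact ⟨c • ψ, h1.const_smul c, fun z hz => congrArg (c • ·) (h2 hz)⟩

theorem aestronglyMeasurable_smooth (u : Smooth) :
    AEStronglyMeasurable (u : ℂ → ℂ) areaMeasure :=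
  u.2.1.continuousOn.aestronglyMeasurable halfPlane.isOpen.measurableSet

theorem ae_areaMeasure {p : ℂ → Prop} (h : ∀ z ∈ halfPlane, p z) : ∀ᵐ z ∂areaMeasure, p z :=
  (ae_restrict_iff' halfPlane.isOpen.measurableSet).2 (Filter.Eventually.of_forall h)

theorem integrable_of_mem_decay {u : Smooth} (hu : u ∈ decay 4) :
    Integrable (u : ℂ → ℂ) areaMeasure := by
  obtain ⟨C, -, hC⟩ := exists_norm_le_of_mem_decay hu
  exact (integrable_norm_rhoS_pow_four.const_mul C).mono' (aestronglyMeasurable_smooth u)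
    (ae_areaMeasure hC)

theorem isSmoothUpToBoundaryL1_of_mem_decay {u : Smooth} (hu : u ∈ decay 4) :
    IsSmoothUpToBoundaryL1 u :=
  ⟨exists_extension_of_mem_decay hu, integrable_of_mem_decay hu⟩

theorem memLp_norm_rhoS_sq : MemLp (fun z => ‖(rhoS : ℂ → ℂ) z‖ ^ 2) 2 areaMeasure := by
  refine (memLp_two_iff_integrable_sq ((aestronglyMeasurable_smooth rhoS).norm.pow 2)).2 ?_
  simpa only [Pi.pow_apply, ← pow_mul] using integrable_norm_rhoS_pow_four

theorem memLp_of_mem_decay {u : Smooth} (hu : u ∈ decay 2) :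
    MemLp (u : ℂ → ℂ) 2 areaMeasure := by
  obtain ⟨C, -, hC⟩ := exists_norm_le_of_mem_decay hu
  refine (memLp_norm_rhoS_sq.const_mul C).of_le (aestronglyMeasurable_smooth u)
    (ae_areaMeasure fun z hz => (hC z hz).trans (le_abs_self _))

/-! ### Weight zero operators preserve decay and compact supports -/

/-- A class of smooth functions indexed by their decay which is compatible with derivatives and
multiplication by `y`. -/
structure IsGraded (V : ℕ → Submodule ℂ Smooth) : Prop where
  dz_mem : ∀ {m u}, u ∈ V m → dz u ∈ V (m + 1)
  dzbar_mem : ∀ {m u}, u ∈ V m → dzbar u ∈ V (m + 1)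
  mulY_mem : ∀ {m u}, u ∈ V (m + 1) → mulY u ∈ V m

theorem isGraded_decay : IsGraded decay where
  dz_mem := dz_mem_decay
  dzbar_mem := dzbar_mem_decay
  mulY_mem hu := by rw [mulY_eq]; exact yS_mul_mem_decay hu

/-- Weight zero means that every derivative is compensated by a factor `y`, so the grade is
unchanged. The argument serves the decaying rational functions, and, with a constant grading, the
compactly supported functions. -/
theorem IsGraded.wordTrans_mem {V : ℕ → Submodule ℂ Smooth} (hV : IsGraded V) (w : List Gen)
    {m : ℕ} {u : Smooth} (hu : u ∈ V m) : wordTrans w u ∈ V m := by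
  induction w generalizing u with
  | nil => exact hu
  | cons g w ih =>
    rw [wordTrans, Module.End.mul_apply]
    refine ih ?_
    cases g with
    | lapY2 =>
      rw [Gen.trans, Module.End.mul_apply, Module.End.mul_apply, laplacian_eq]
      exact hV.mulY_mem (hV.mulY_mem (Submodule.smul_mem _ _ (hV.dz_mem (hV.dzbar_mem hu))))
    | dbarY => exact hV.mulY_mem (neg_mem (hV.dzbar_mem hu))
    | dY => exact hV.mulY_mem (neg_mem (hV.dz_mem hu))

theorem IsGraded.weightZero_mem {V : ℕ → Submodule ℂ Smooth} (hV : IsGraded V) (k l : ℕ)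
    {m : ℕ} {u : Smooth} (hu : u ∈ V m) : weightZero k l u ∈ V m := by
  have h1 : (dzbar ^ l : Module.End ℂ Smooth) u ∈ V (m + l) := by
    induction l with
    | zero => exact hu
    | succ l ih => rw [pow_succ', Module.End.mul_apply]; exact hV.dzbar_mem ih
  have h2 : (dz ^ k : Module.End ℂ Smooth) ((dzbar ^ l : Module.End ℂ Smooth) u) ∈
      V (m + l + k) := by
    induction k with
    | zero => exact h1
    | succ k ih => rw [pow_succ', Module.End.mul_apply]; exact hV.dz_mem ih
  have h3 : ∀ n v, v ∈ V (m + n) → (mulY ^ n : Module.End ℂ Smooth) v ∈ V m := by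
    intro n
    induction n with
    | zero => intro v hv; exact hv
    | succ n ih => intro v hv; rw [pow_succ, Module.End.mul_apply]; exact ih _ (hV.mulY_mem hv)
  rw [weightZero, Module.End.mul_apply, Module.End.mul_apply]
  exact h3 _ _ (by rwa [show m + (k + l) = m + l + k by ring])

theorem creation_mem_decay (j : ℕ) {m : ℕ} {u : Smooth} (hu : u ∈ decay m) :
    creation j u ∈ decay m := by
  rw [creation_eq_sum_smul]
  refine sum_mem fun k _ => Submodule.smul_mem _ _ ?_
  have := isGraded_decay.weightZero_mem k 0 hu
  rwa [weightZero_apply] at this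

/-! ### Compactly supported functions -/

/-- The smooth functions on `Π` with compact support. -/
def compactlySupported : Submodule ℂ Smooth where
  carrier := {u | HasCompactSupport (u : ℂ → ℂ) ∧ tsupport (u : ℂ → ℂ) ⊆ halfPlane}
  add_mem' := by
    rintro u v ⟨hu, hu'⟩ ⟨hv, hv'⟩
    exact ⟨hu.add hv, (tsupport_add _ _).trans (union_subset hu' hv')⟩
  zero_mem' := by
    refine ⟨HasCompactSupport.zero, ?_⟩
    have : tsupport ((0 : Smooth) : ℂ → ℂ) = ∅ := tsupport_eq_empty_iff.2 rfl
    rw [this]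
    exact empty_subset _
  smul_mem' := by
    rintro c u ⟨hu, hu'⟩
    exact ⟨hu.smul_left (f := fun _ => c), (tsupport_smul_subset_right (fun _ => c) _).trans hu'⟩

theorem mem_compactlySupported_of_subset {u v : Smooth} (hu : u ∈ compactlySupported)
    (h : ∀ z ∉ tsupport (u : ℂ → ℂ), (v : ℂ → ℂ) z = 0) : v ∈ compactlySupported := by
  have h1 : Function.support (v : ℂ → ℂ) ⊆ tsupport (u : ℂ → ℂ) := fun z hz => by
    by_contra hne
    exact hz (h z hne)
  have h2 : tsupport (v : ℂ → ℂ) ⊆ tsupport (u : ℂ → ℂ) := closure_minimal h1 isClosed_closure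
  exact ⟨hu.1.mono' h1, h2.trans hu.2⟩

theorem mul_mem_compactlySupported {u v : Smooth} (hu : u ∈ compactlySupported) :
    u * v ∈ compactlySupported :=
  mem_compactlySupported_of_subset hu fun z hz => by
    rw [mul_apply, image_eq_zero_of_notMem_tsupport hz, zero_mul]

theorem dirDeriv_mem_compactlySupported (v : ℂ) {u : Smooth} (hu : u ∈ compactlySupported) :
    dirDeriv v u ∈ compactlySupported :=
  mem_compactlySupported_of_subset hu fun z hz => by
    by_cases h : z ∈ halfPlane
    · rw [dirDeriv_apply v u h]
      have : (u : ℂ → ℂ) =ᶠ[nhds z] fun _ => 0 := by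
        filter_upwards [isClosed_closure.isOpen_compl.mem_nhds hz] with x hx
        exact image_eq_zero_of_notMem_tsupport hx
      rw [this.fderiv_eq]
      simp
    · exact (dirDeriv v u).2.2 z h

theorem dz_mem_compactlySupported {u : Smooth} (hu : u ∈ compactlySupported) :
    dz u ∈ compactlySupported := by
  rw [dz_eq]
  exact Submodule.smul_mem _ _ (sub_mem (dirDeriv_mem_compactlySupported _ hu)
    (Submodule.smul_mem _ _ (dirDeriv_mem_compactlySupported _ hu)))

theorem dzbar_mem_compactlySupported {u : Smooth} (hu : u ∈ compactlySupported) :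
    dzbar u ∈ compactlySupported := by
  rw [dzbar_eq]
  exact Submodule.smul_mem _ _ (add_mem (dirDeriv_mem_compactlySupported _ hu)
    (Submodule.smul_mem _ _ (dirDeriv_mem_compactlySupported _ hu)))

theorem isGraded_compactlySupported : IsGraded fun _ => compactlySupported where
  dz_mem := dz_mem_compactlySupported
  dzbar_mem := dzbar_mem_compactlySupported
  mulY_mem hu := by rw [mulY_eq, mul_comm]; exact mul_mem_compactlySupported hu

theorem contDiff_of_mem_compactlySupported {u : Smooth} (hu : u ∈ compactlySupported) :
    ContDiff ℝ ∞ (u : ℂ → ℂ) := by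
  refine contDiff_iff_contDiffAt.2 fun z => ?_
  by_cases hz : z ∈ tsupport (u : ℂ → ℂ)
  · exact u.2.1.contDiffAt (halfPlane.isOpen.mem_nhds (hu.2 hz))
  · refine (contDiffAt_const (c := (0 : ℂ))).congr_of_eventuallyEq ?_
    filter_upwards [isClosed_closure.isOpen_compl.mem_nhds hz] with x hx
    exact image_eq_zero_of_notMem_tsupport hx

theorem isSmoothUpToBoundaryL1_of_mem_compactlySupported {u : Smooth}
    (hu : u ∈ compactlySupported) : IsSmoothUpToBoundaryL1 u :=
  ⟨⟨u, (contDiff_of_mem_compactlySupported hu).contDiffOn, fun _ _ => rfl⟩,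
    ((contDiff_of_mem_compactlySupported hu).continuous.integrable_of_hasCompactSupport
      hu.1).restrict⟩

theorem ofTest_mem_compactlySupported (φ : 𝓓(halfPlane, ℂ)) : ofTest φ ∈ compactlySupported :=
  ⟨φ.hasCompactSupport, φ.tsupport_subset⟩

/-! ### The standard basis -/

/-- The Cayley transform `(z - i) / (z + i)`. -/
def cayS : Smooth := 1 - (2 * Complex.I) • rhoS

theorem cayS_apply {z : ℂ} (hz : z ∈ halfPlane) :
    (cayS : ℂ → ℂ) z = 1 - 2 * Complex.I * (z + Complex.I)⁻¹ := by
  rw [cayS, sub_apply, smul_apply, one_apply hz, rhoS_apply hz]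

theorem dzbar_cayS : dzbar cayS = 0 := by
  rw [cayS, map_sub, map_smul, dzbar_one, dzbar_rhoS, smul_zero, sub_zero]

theorem cayS_mem_decay : cayS ∈ decay 0 := by
  have h0 := rhoS_pow_mem_decay 0
  have h1 := decay_anti zero_le_one (rhoS_pow_mem_decay 1)
  rw [pow_zero] at h0
  rw [pow_one] at h1
  exact sub_mem h0 (Submodule.smul_mem _ _ h1)

theorem cayS_pow_mem_decay (k : ℕ) : cayS ^ k ∈ decay 0 := by
  induction k with
  | zero => exact rhoS_pow_mem_decay 0
  | succ k ih =>
    have h := mul_mem_decay ih cayS_mem_decay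
    rwa [zero_add, ← pow_succ] at h

theorem basisFunction_eq (k : ℕ) : basisFunction k =
    ((Real.sqrt ((k + 1) / Real.pi) : ℂ) * 2) • (cayS ^ k * rhoS ^ 2) := by
  refine Smooth.ext_on fun z hz => ?_
  have h1 : (basisFunction k : ℂ → ℂ) z = (Real.sqrt ((k + 1) / Real.pi) : ℂ) *
      (2 * (z - Complex.I) ^ k / (z + Complex.I) ^ (k + 2)) := Smooth.mk_apply _ hz
  have h2 := add_I_ne_zero (im_pos hz).le
  rw [h1, smul_apply, mul_apply, pow_apply _ _ hz, pow_apply _ _ hz, cayS_apply hz,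
    rhoS_apply hz]
  have h3 : 1 - 2 * Complex.I * (z + Complex.I)⁻¹ = (z - Complex.I) / (z + Complex.I) := by
    field_simp
    ring
  rw [h3, div_pow]
  field_simp
  ring

theorem cayS_pow_mul_mem_basisSpan (k : ℕ) : cayS ^ k * rhoS ^ 2 ∈ basisSpan := by
  have h := basisFunction_eq k
  have hne : (Real.sqrt ((k + 1) / Real.pi) : ℂ) * 2 ≠ 0 := by
    have : (0 : ℝ) < Real.sqrt ((k + 1) / Real.pi) := Real.sqrt_pos.2 (by positivity)
    have h3 : (Real.sqrt ((k + 1) / Real.pi) : ℂ) ≠ 0 := by exact_mod_cast this.ne'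
    exact mul_ne_zero h3 two_ne_zero
  have h2 : cayS ^ k * rhoS ^ 2 =
      ((Real.sqrt ((k + 1) / Real.pi) : ℂ) * 2)⁻¹ • basisFunction k := by
    rw [h, smul_smul, inv_mul_cancel₀ hne, one_smul]
  rw [h2]
  exact Submodule.smul_mem _ _ (Submodule.subset_span ⟨k, rfl⟩)

/-- `1/(z + i)` is an affine function of the Cayley transform, so extra powers of it stay in the
span. The totality argument at level `j` tests against the power `j + 2`. -/
theorem cayS_pow_mul_rhoS_pow_mem_basisSpan (k p : ℕ) :
    cayS ^ k * rhoS ^ (p + 2) ∈ basisSpan := by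
  induction p generalizing k with
  | zero => exact cayS_pow_mul_mem_basisSpan k
  | succ p ih =>
    have h : rhoS = (1 / (2 * Complex.I)) • (1 - cayS) := by
      rw [cayS, sub_sub_cancel, smul_smul, one_div, inv_mul_cancel₀ (by simp), one_smul]
    have h2 : cayS ^ k * rhoS ^ (p + 1 + 2) = (1 / (2 * Complex.I)) •
        (cayS ^ k * rhoS ^ (p + 2) - cayS ^ (k + 1) * rhoS ^ (p + 2)) := by
      have : cayS ^ k * rhoS ^ (p + 1 + 2) = cayS ^ k * rhoS ^ (p + 2) * rhoS := by ring
      rw [this]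
      nth_rw 2 [h]
      rw [mul_smul_comm]
      congr 1
      ring
    rw [h2]
    exact Submodule.smul_mem _ _ (sub_mem (ih k) (ih (k + 1)))

theorem basisFunction_mem_decay (k : ℕ) : basisFunction k ∈ decay 2 := by
  rw [basisFunction_eq]
  have h2 := mul_mem_decay (cayS_pow_mem_decay k) (rhoS_pow_mem_decay 2)
  rw [zero_add] at h2
  exact Submodule.smul_mem _ _ h2

theorem basisSpan_le_decay : basisSpan ≤ decay 2 := by
  refine Submodule.span_le.2 ?_
  rintro _ ⟨k, rfl⟩
  exact basisFunction_mem_decay k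

theorem basisFunction_mem_holomorphicFunctions (k : ℕ) :
    basisFunction k ∈ holomorphicFunctions := by
  rw [basisFunction_eq, mem_holomorphicFunctions_iff, map_smul, dzbar_mul, dzbar_pow, dzbar_pow,
    dzbar_cayS, dzbar_rhoS]
  simp only [mul_zero, smul_zero, add_zero]

theorem basisSpan_le_holomorphicFunctions : basisSpan ≤ holomorphicFunctions := by
  refine Submodule.span_le.2 ?_
  rintro _ ⟨k, rfl⟩
  exact basisFunction_mem_holomorphicFunctions k

theorem mulConj_mem_decay {u v : Smooth} (hu : u ∈ decay 2) (hv : v ∈ decay 2) :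
    mulConj u v ∈ decay 4 := by
  have h := mul_mem_decay hu (conjS_mem_decay hv)
  rwa [show 2 + 2 = 4 from rfl, ← mulConj_eq] at h

/-! ### Taylor coefficients of holomorphic functions as radially weighted moments -/

/-- On the circle `w̄ = r²/w`, so this is Cauchy's formula for the `k`-th Taylor coefficient. -/
theorem integral_circle_eq_coeff {G : ℂ → ℂ} {p : FormalMultilinearSeries ℂ ℂ ℂ} {R r : ℝ}
    (hG : DifferentiableOn ℂ G (Metric.ball 0 R)) (hp : HasFPowerSeriesAt G p 0)
    (hr : 0 < r) (hrR : r < R) (k : ℕ) :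
    ∫ θ in (-Real.pi)..Real.pi, conj (circleMap 0 r θ) ^ k * G (circleMap 0 r θ) =
      2 * Real.pi * (r : ℂ) ^ (2 * k) * p.coeff k := by
  have h1 : HasFPowerSeriesOnBall G (cauchyPowerSeries G 0 r) 0 (r.toNNReal : ENNReal) := by
    have h := hG.mono (Metric.closedBall_subset_ball hrR)
    rw [← Real.coe_toNNReal r hr.le] at h
    have := h.hasFPowerSeriesOnBall (Real.toNNReal_pos.2 hr)
    rwa [Real.coe_toNNReal r hr.le] at this
  have h2 : p = cauchyPowerSeries G 0 r := hp.eq_formalMultilinearSeries h1.hasFPowerSeriesAt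
  have h3 : p.coeff k = (2 * Real.pi * Complex.I : ℂ)⁻¹ •
      ∮ z in C(0, r), (1 / (z - 0)) ^ k • (z - 0)⁻¹ • G z := by
    rw [h2, FormalMultilinearSeries.coeff]
    exact cauchyPowerSeries_apply G 0 r k 1
  have hper : Function.Periodic
      (fun θ => conj (circleMap 0 r θ) ^ k * G (circleMap 0 r θ)) (2 * Real.pi) := fun θ => by
    simp only [periodic_circleMap 0 r θ]
  have h4 : ∫ θ in (-Real.pi)..Real.pi, conj (circleMap 0 r θ) ^ k * G (circleMap 0 r θ) =
      ∫ θ in (0)..(2 * Real.pi), conj (circleMap 0 r θ) ^ k * G (circleMap 0 r θ) := by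
    have := hper.intervalIntegral_add_eq (-Real.pi) 0
    rwa [show -Real.pi + 2 * Real.pi = Real.pi by ring, zero_add] at this
  rw [h4, h3, circleIntegral]
  have h5 : ∀ θ : ℝ, deriv (circleMap 0 r) θ • ((1 / (circleMap 0 r θ - 0)) ^ k •
      (circleMap 0 r θ - 0)⁻¹ • G (circleMap 0 r θ)) =
      (Complex.I * ((r : ℂ) ^ (2 * k))⁻¹) *
        (conj (circleMap 0 r θ) ^ k * G (circleMap 0 r θ)) := by
    intro θ
    have hne : circleMap 0 r θ ≠ 0 := circleMap_ne_center hr.ne'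
    have hc : circleMap 0 r θ * conj (circleMap 0 r θ) = (r : ℂ) ^ 2 := by
      rw [Complex.mul_conj, Complex.normSq_eq_norm_sq, norm_circleMap_zero, sq_abs]
      push_cast; rfl
    have hr0 : (r : ℂ) ≠ 0 := by exact_mod_cast hr.ne'
    have h6 : (1 / circleMap 0 r θ) ^ k = ((r : ℂ) ^ (2 * k))⁻¹ * conj (circleMap 0 r θ) ^ k := by
      rw [pow_mul, ← hc, mul_pow, one_div, inv_pow]
      have : conj (circleMap 0 r θ) ≠ 0 := by simpa using hne
      field_simp
    rw [deriv_circleMap, sub_zero, h6]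
    simp only [smul_eq_mul]
    field_simp
  simp only [h5]
  rw [intervalIntegral.integral_const_mul, smul_eq_mul]
  have hr0 : (r : ℂ) ≠ 0 := by exact_mod_cast hr.ne'
  have hpi : (Real.pi : ℂ) ≠ 0 := by exact_mod_cast Real.pi_ne_zero
  field_simp

/-- Polar coordinates reduce this to the circles. The weight vanishes from radius `R' < R` on, so
the integrand is continuous on the whole plane whatever `G` is outside its disc, which justifies
Fubini's theorem. -/
theorem integral_radial_eq_coeff {G : ℂ → ℂ} {p : FormalMultilinearSeries ℂ ℂ ℂ} {R R' : ℝ}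
    (hG : DifferentiableOn ℂ G (Metric.ball 0 R)) (hp : HasFPowerSeriesAt G p 0)
    (hR : R' < R) {κ : ℝ → ℝ} (hκ : Continuous κ) (hκ0 : ∀ r, R' ≤ r → κ r = 0) (k : ℕ) :
    ∫ w, (κ ‖w‖ : ℂ) * (conj w ^ k * G w) =
      ((∫ r in Ioi (0 : ℝ), κ r * r ^ (2 * k + 1) : ℝ) : ℂ) * (2 * Real.pi * p.coeff k) := by
  set f : ℂ → ℂ := fun w => (κ ‖w‖ : ℂ) * (conj w ^ k * G w) with hf
  have hf0 : ∀ w, R' ≤ ‖w‖ → f w = 0 := fun w hw => by simp [hf, hκ0 _ hw]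
  have hfc : Continuous f := by
    refine continuous_iff_continuousAt.2 fun w => ?_
    rcases lt_or_ge ‖w‖ R with hw | hw
    · have h1 : ContinuousAt G w :=
        (hG.differentiableAt (Metric.isOpen_ball.mem_nhds (by simpa using hw))).continuousAt
      have h2 : Continuous fun w : ℂ => (κ ‖w‖ : ℂ) :=
        Complex.continuous_ofReal.comp (hκ.comp continuous_norm)
      exact h2.continuousAt.mul ((Complex.continuous_conj.pow k).continuousAt.mul h1)
    · refine (continuousAt_const (y := (0 : ℂ))).congr ?_
      have : {w : ℂ | R' < ‖w‖} ∈ nhds w :=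
        (isOpen_lt continuous_const continuous_norm).mem_nhds (hR.trans_le hw)
      filter_upwards [this] with x hx
      exact (hf0 x (le_of_lt hx)).symm
  rw [← Complex.integral_comp_polarCoord_symm f]
  have htarget : polarCoord.target = Ioi (0 : ℝ) ×ˢ Ioo (-Real.pi) Real.pi := rfl
  have hpolar : ∀ q : ℝ × ℝ, Complex.polarCoord.symm q = circleMap 0 q.1 q.2 := fun q => by
    rw [Complex.polarCoord_symm_apply, circleMap, zero_add, Complex.exp_mul_I]
    push_cast; rfl
  simp only [hpolar]
  have hcm : Continuous fun q : ℝ × ℝ => circleMap 0 q.1 q.2 := by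
    unfold circleMap; fun_prop
  have hcont : Continuous fun q : ℝ × ℝ => q.1 • f (circleMap 0 q.1 q.2) :=
    continuous_fst.smul (hfc.comp hcm)
  have hint : IntegrableOn (fun q : ℝ × ℝ => q.1 • f (circleMap 0 q.1 q.2))
      (Ioi (0 : ℝ) ×ˢ Ioo (-Real.pi) Real.pi) (volume.prod volume) := by
    have h1 : IntegrableOn (fun q : ℝ × ℝ => q.1 • f (circleMap 0 q.1 q.2))
        (Icc (0 : ℝ) R' ×ˢ Icc (-Real.pi) Real.pi) (volume.prod volume) :=
      hcont.continuousOn.integrableOn_compact (isCompact_Icc.prod isCompact_Icc)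
    refine h1.of_forall_sdiff_eq_zero
      ((measurableSet_Ioi).prod measurableSet_Ioo) fun q hq => ?_
    have hq1 : R' ≤ q.1 := by
      by_contra hlt
      exact hq.2 ⟨⟨le_of_lt hq.1.1, (not_le.1 hlt).le⟩, Ioo_subset_Icc_self hq.1.2⟩
    rw [hf0 _ (by rw [norm_circleMap_zero, abs_of_pos hq.1.1]; exact hq1), smul_zero]
  rw [htarget, Measure.volume_eq_prod, setIntegral_prod _ hint, ← integral_complex_ofReal,
    ← integral_mul_const]
  refine setIntegral_congr_fun measurableSet_Ioi fun r hr => ?_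
  have hr : 0 < r := hr
  simp only
  rcases le_or_gt R' r with h | h
  · have : ∀ θ, f (circleMap 0 r θ) = 0 := fun θ =>
      hf0 _ (by rw [norm_circleMap_zero, abs_of_pos hr]; exact h)
    simp [this, hκ0 r h]
  · have h1 := integral_circle_eq_coeff hG hp hr (h.trans hR) k
    rw [intervalIntegral.integral_of_le (by linarith [Real.pi_pos]),
      integral_Ioc_eq_integral_Ioo] at h1
    simp only [hf, norm_circleMap_zero, abs_of_pos hr, Complex.real_smul]
    rw [integral_const_mul, integral_const_mul, h1]
    push_cast
    ring

theorem eqOn_zero_of_coeff_eq_zero {G : ℂ → ℂ} {p : FormalMultilinearSeries ℂ ℂ ℂ} {R : ℝ}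
    (hR : 0 < R) (hG : DifferentiableOn ℂ G (Metric.ball 0 R)) (hp : HasFPowerSeriesAt G p 0)
    (h : ∀ k, p.coeff k = 0) : EqOn G 0 (Metric.ball 0 R) := by
  have hp0 : p = 0 :=
    FormalMultilinearSeries.ext fun k => FormalMultilinearSeries.coeff_eq_zero.1 (h k)
  rw [hp0] at hp
  exact (hG.analyticOnNhd Metric.isOpen_ball).eqOn_zero_of_preconnected_of_eventuallyEq_zero
    (convex_ball _ _).isPreconnected (Metric.mem_ball_self hR) hp.eventually_eq_zero

/-! ### Square integrable smooth functions as elements of `L²` -/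

theorem inner_toLp {u v : ℂ → ℂ} (hu : MemLp u 2 areaMeasure) (hv : MemLp v 2 areaMeasure) :
    inner ℂ (hv.toLp v) (hu.toLp u) = ∫ z, u z * conj (v z) ∂areaMeasure := by
  rw [L2.inner_def]
  refine integral_congr_ae ?_
  filter_upwards [hu.coeFn_toLp, hv.coeFn_toLp] with z h1 h2
  rw [h1, h2, RCLike.inner_apply]

theorem norm_integral_mul_conj_le {u v : ℂ → ℂ} (hu : MemLp u 2 areaMeasure)
    (hv : MemLp v 2 areaMeasure) : ‖∫ z, u z * conj (v z) ∂areaMeasure‖ ≤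
      (eLpNorm u 2 areaMeasure).toReal * (eLpNorm v 2 areaMeasure).toReal := by
  rw [← inner_toLp hu hv, mul_comm, ← Lp.norm_toLp u hu, ← Lp.norm_toLp v hv]
  exact norm_inner_le_norm _ _

theorem eq_of_ae_eq {u v : Smooth} (h : (u : ℂ → ℂ) =ᵐ[areaMeasure] (v : ℂ → ℂ)) : u = v :=
  Smooth.ext_on fun _ hz => Measure.eqOn_open_of_ae_eq h halfPlane.isOpen
    u.2.1.continuousOn v.2.1.continuousOn hz

theorem memLp_of_ae_eq {a : L2} {u : ℂ → ℂ} (h : (a : ℂ → ℂ) =ᵐ[areaMeasure] u) :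
    MemLp u 2 areaMeasure := (memLp_congr_ae h).1 (Lp.memLp a)

theorem eq_toLp_of_ae_eq {a : L2} {u : ℂ → ℂ} (h : (a : ℂ → ℂ) =ᵐ[areaMeasure] u) :
    a = (memLp_of_ae_eq h).toLp u :=
  Lp.ext (h.trans (memLp_of_ae_eq h).coeFn_toLp.symm)

/-! ### Point evaluations and completeness of the Bergman space -/

/-- A radial averaging kernel; the exponent is left as `2 * 0 + 1` to match
`integral_radial_eq_coeff` at `k = 0`. -/
theorem exists_bump {δ : ℝ} (hδ : 0 < δ) : ∃ κ : ℝ → ℝ, Continuous κ ∧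
    (∀ r, δ / 2 ≤ r → κ r = 0) ∧ 0 < ∫ r in Ioi (0 : ℝ), κ r * r ^ (2 * 0 + 1) := by
  set κ : ℝ → ℝ := fun r => max 0 (δ / 2 - r) with hκ
  have hκc : Continuous κ := by fun_prop
  have hκ0 : ∀ r, δ / 2 ≤ r → κ r = 0 := fun r hr => max_eq_left (by linarith)
  refine ⟨κ, hκc, hκ0, ?_⟩
  have h1 : ∫ r in Ioi (0 : ℝ), κ r * r ^ (2 * 0 + 1) =
      ∫ r in Ioc (0 : ℝ) (δ / 2), κ r * r ^ (2 * 0 + 1) := by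
    refine setIntegral_eq_of_subset_of_forall_sdiff_eq_zero measurableSet_Ioi
      Ioc_subset_Ioi_self fun r hr => ?_
    rw [hκ0 r (by
      by_contra h
      exact hr.2 ⟨hr.1, (not_le.1 h).le⟩), zero_mul]
  rw [h1, ← intervalIntegral.integral_of_le (by positivity)]
  refine intervalIntegral.intervalIntegral_pos_of_pos_on
    ((hκc.mul (by fun_prop)).intervalIntegrable _ _) (fun r hr => ?_) (by positivity)
  have : 0 < κ r := lt_max_of_lt_right (by linarith [hr.2])
  exact mul_pos this (pow_pos (show 0 < r from hr.1) _)

theorem memLp_translate {K : ℂ → ℂ} (hK : MemLp K 2 volume) (z : ℂ) :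
    MemLp (fun x => K (x - z)) 2 areaMeasure ∧
      (eLpNorm (fun x => K (x - z)) 2 areaMeasure).toReal ≤ (eLpNorm K 2 volume).toReal := by
  have hmp : MeasurePreserving (fun x : ℂ => x - z) volume volume :=
    measurePreserving_sub_right volume z
  have h1 : eLpNorm (K ∘ fun x => x - z) 2 volume = eLpNorm K 2 volume :=
    eLpNorm_comp_measurePreserving hK.1 hmp
  refine ⟨(hK.comp_measurePreserving hmp).restrict _, ENNReal.toReal_mono hK.2.ne ?_⟩
  rw [← h1]
  exact eLpNorm_mono_measure _ Measure.restrict_le_self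

/-- Averaging `f` over the disc about `z` with a fixed radial kernel returns a positive multiple of
`f z`, and Cauchy–Schwarz bounds the average. The discs lie in `Π` because `δ < Im z`, and
translation invariance makes the constant independent of `z`. -/
theorem exists_norm_apply_le {δ : ℝ} (hδ : 0 < δ) : ∃ C : ℝ, 0 ≤ C ∧ ∀ f ∈ holomorphicFunctions,
    MemLp (f : ℂ → ℂ) 2 areaMeasure → ∀ z : ℂ, δ < z.im →
      ‖(f : ℂ → ℂ) z‖ ≤ C * (eLpNorm (f : ℂ → ℂ) 2 areaMeasure).toReal := by
  obtain ⟨κ, hκc, hκ0, hcpos⟩ := exists_bump hδ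
  set c : ℝ := ∫ r in Ioi (0 : ℝ), κ r * r ^ (2 * 0 + 1) with hc
  have hcs : Continuous fun w : ℂ => (κ ‖w‖ : ℂ) :=
    Complex.continuous_ofReal.comp (hκc.comp continuous_norm)
  have hsupp : HasCompactSupport fun w : ℂ => (κ ‖w‖ : ℂ) := by
    refine HasCompactSupport.of_support_subset_isCompact (isCompact_closedBall 0 (δ / 2)) ?_
    intro w hw
    rw [mem_closedBall_zero_iff]
    by_contra h
    refine hw ?_
    simp only [hκ0 _ (not_le.1 h).le, Complex.ofReal_zero]
  have hm : MemLp (fun w : ℂ => (κ ‖w‖ : ℂ)) 2 volume := hcs.memLp_of_hasCompactSupport hsupp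
  set N : ℝ := (eLpNorm (fun w : ℂ => (κ ‖w‖ : ℂ)) 2 volume).toReal with hN
  refine ⟨N / (c * (2 * Real.pi)), by positivity, fun f hf hf2 z hz => ?_⟩
  have hball : ∀ w ∈ Metric.ball (0 : ℂ) δ, z + w ∈ halfPlane := fun w hw => by
    have h1 : |w.im| < δ := (Complex.abs_im_le_norm w).trans_lt (by simpa using hw)
    change 0 < (z + w).im
    rw [Complex.add_im]
    linarith [(abs_lt.1 h1).1]
  have hG : DifferentiableOn ℂ (fun w => (f : ℂ → ℂ) (z + w)) (Metric.ball 0 δ) :=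
    DifferentiableOn.comp (t := (halfPlane : Set ℂ)) hf (by fun_prop) hball
  obtain ⟨p, hp⟩ := hG.analyticAt (Metric.ball_mem_nhds 0 hδ)
  have h1 := integral_radial_eq_coeff hG hp (by linarith : δ / 2 < δ) hκc hκ0 0
  have hp0 : p.coeff 0 = (f : ℂ → ℂ) z := by
    have := hp.coeff_zero 1
    rw [add_zero] at this
    exact this
  rw [hp0] at h1
  simp only [pow_zero, one_mul] at h1
  obtain ⟨hm', hN'⟩ := memLp_translate hm z
  have h2 : ∫ w, (κ ‖w‖ : ℂ) * (f : ℂ → ℂ) (z + w) =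
      ∫ x, (f : ℂ → ℂ) x * conj (κ ‖x - z‖ : ℂ) ∂areaMeasure := by
    rw [← integral_sub_right_eq_self _ z]
    have h3 : ∫ x, (f : ℂ → ℂ) x * conj (κ ‖x - z‖ : ℂ) ∂areaMeasure =
        ∫ x, (f : ℂ → ℂ) x * conj (κ ‖x - z‖ : ℂ) := by
      refine setIntegral_eq_integral_of_forall_compl_eq_zero fun x hx => ?_
      rw [f.2.2 x hx, zero_mul]
    rw [h3]
    refine integral_congr_ae (Filter.Eventually.of_forall fun x => ?_)
    simp only [add_sub_cancel, Complex.conj_ofReal]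
    ring
  have h4 := norm_integral_mul_conj_le hf2 hm'
  rw [← h2, h1, norm_mul, Complex.norm_real, Real.norm_of_nonneg hcpos.le, norm_mul] at h4
  have h5 : ‖(2 * Real.pi : ℂ)‖ = 2 * Real.pi := by
    rw [norm_mul, Complex.norm_real, Real.norm_of_nonneg Real.pi_pos.le]; simp
  rw [h5] at h4
  have h6 : c * (2 * Real.pi * ‖(f : ℂ → ℂ) z‖) ≤
      (eLpNorm (f : ℂ → ℂ) 2 areaMeasure).toReal * N :=
    h4.trans (mul_le_mul_of_nonneg_left hN' ENNReal.toReal_nonneg)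
  rw [div_mul_eq_mul_div, le_div_iff₀ (by positivity)]
  linarith

theorem contDiffOn_of_differentiableOn {g : ℂ → ℂ} (hg : DifferentiableOn ℂ g halfPlane) :
    ContDiffOn ℝ ∞ g halfPlane :=
  (hg.contDiffOn (n := ∞) halfPlane.isOpen).restrict_scalars ℝ

/-- Point evaluations bounded uniformly on `Im z > δ` make an `L²`-convergent sequence converge
uniformly there; Weierstrass' theorem gives a holomorphic limit, and an almost everywhere convergent
subsequence identifies it with the `L²` limit. -/
theorem exists_tendstoLocallyUniformlyOn {a : ℕ → L2} {b : L2} {f : ℕ → Smooth}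
    (hf : ∀ n, f n ∈ holomorphicFunctions) (haf : ∀ n, (a n : ℂ → ℂ) =ᵐ[areaMeasure] (f n : ℂ → ℂ))
    (hab : Filter.Tendsto a Filter.atTop (nhds b)) :
    ∃ g ∈ holomorphicFunctions, (b : ℂ → ℂ) =ᵐ[areaMeasure] (g : ℂ → ℂ) ∧
      TendstoLocallyUniformlyOn (fun n => (f n : ℂ → ℂ)) (g : ℂ → ℂ) Filter.atTop halfPlane := by
  have hC : ∀ δ : ℝ, 0 < δ → ∃ C : ℝ, 0 ≤ C ∧ ∀ n m (z : ℂ), δ < z.im →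
      ‖(f n : ℂ → ℂ) z - (f m : ℂ → ℂ) z‖ ≤ C * ‖a n - a m‖ := by
    intro δ hδ
    obtain ⟨C, hC0, hC⟩ := exists_norm_apply_le hδ
    refine ⟨C, hC0, fun n m z hz => ?_⟩
    have h1 : ((a n - a m : L2) : ℂ → ℂ) =ᵐ[areaMeasure] ((f n - f m : Smooth) : ℂ → ℂ) :=
      (Lp.coeFn_sub _ _).trans ((haf n).sub (haf m))
    have h2 := hC (f n - f m) (sub_mem (hf n) (hf m)) (memLp_of_ae_eq h1) z hz
    rwa [← Lp.norm_toLp _ (memLp_of_ae_eq h1), ← eq_toLp_of_ae_eq h1] at h2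
  have hcauchy : ∀ z ∈ halfPlane, ∃ w, Filter.Tendsto (fun n => (f n : ℂ → ℂ) z) Filter.atTop
      (nhds w) := by
    intro z hz
    obtain ⟨C, hC0, hC⟩ := hC (z.im / 2) (half_pos hz)
    have h1 : z.im / 2 < z.im := half_lt_self hz
    refine cauchySeq_tendsto_of_complete (Metric.cauchySeq_iff.2 fun ε hε => ?_)
    -- `C + 1` rather than `C`, since `C` may be zero.
    obtain ⟨N, hN⟩ := Metric.cauchySeq_iff.1 hab.cauchySeq (ε / (C + 1)) (by positivity)
    refine ⟨N, fun m hm n hn => ?_⟩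
    have h2 := hN m hm n hn
    rw [dist_eq_norm] at h2 ⊢
    have h3 := hC m n z h1
    rw [lt_div_iff₀ (by positivity)] at h2
    have := norm_nonneg (a m - a n)
    nlinarith
  choose! g hg using hcauchy
  have hunif : ∀ δ : ℝ, 0 < δ → TendstoUniformlyOn (fun n => (f n : ℂ → ℂ)) g Filter.atTop
      {z | δ < z.im} := by
    intro δ hδ
    obtain ⟨C, hC0, hC⟩ := hC δ hδ
    refine Metric.tendstoUniformlyOn_iff.2 fun ε hε => ?_
    have h1 : ∀ᶠ n in Filter.atTop, ‖a n - b‖ < ε / (C + 1) := by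
      have := Metric.tendsto_nhds.1 hab (ε / (C + 1)) (by positivity)
      simpa only [dist_eq_norm] using this
    filter_upwards [h1] with n hn z hz
    have hz' : z ∈ halfPlane := lt_trans hδ hz
    have h2 : ‖(f n : ℂ → ℂ) z - g z‖ ≤ C * ‖a n - b‖ := by
      refine le_of_tendsto_of_tendsto ((tendsto_const_nhds.sub (hg z hz')).norm)
        (((tendsto_const_nhds.sub hab).norm).const_mul C) (Filter.Eventually.of_forall fun m => ?_)
      exact hC n m z hz
    rw [dist_comm, dist_eq_norm]
    rw [lt_div_iff₀ (by positivity)] at hn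
    have := norm_nonneg (a n - b)
    nlinarith
  have hloc : TendstoLocallyUniformlyOn (fun n => (f n : ℂ → ℂ)) g Filter.atTop halfPlane := by
    intro V hV z hz
    refine ⟨{w | z.im / 2 < w.im}, mem_nhdsWithin_of_mem_nhds
      ((isOpen_lt continuous_const Complex.continuous_im).mem_nhds (show z.im / 2 < z.im from half_lt_self hz)), ?_⟩
    exact hunif (z.im / 2) (half_pos hz) V hV
  have hgd : DifferentiableOn ℂ g halfPlane :=
    hloc.differentiableOn (Filter.Eventually.of_forall hf) halfPlane.isOpen
  have hgg : EqOn g (Smooth.mk g (contDiffOn_of_differentiableOn hgd) : ℂ → ℂ) halfPlane :=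
    fun z hz => (Smooth.mk_apply _ hz).symm
  refine ⟨Smooth.mk g (contDiffOn_of_differentiableOn hgd), hgd.congr fun z hz => (hgg hz).symm,
    ?_, hloc.congr_right hgg⟩
  obtain ⟨ns, hmono, hns⟩ := (tendstoInMeasure_of_tendsto_Lp hab).exists_seq_tendsto_ae
  have hall : ∀ᵐ z ∂areaMeasure, ∀ n, (a n : ℂ → ℂ) z = (f n : ℂ → ℂ) z := ae_all_iff.2 haf
  have hns2 : Filter.Tendsto ns Filter.atTop Filter.atTop := hmono.tendsto_atTop
  filter_upwards [hns, hall, ae_areaMeasure fun z hz => hz] with z h1 h2 hz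
  simp only [h2] at h1
  rw [← hgg hz]
  exact tendsto_nhds_unique h1 ((hg z hz).comp hns2)

theorem isClosed_bergman : IsClosed (bergman : Set L2) := by
  refine IsSeqClosed.isClosed fun a b ha hab => ?_
  choose f hf haf using ha
  obtain ⟨g, hg, hbg, -⟩ := exists_tendstoLocallyUniformlyOn hf haf hab
  exact ⟨g, hg, hbg⟩

instance : CompleteSpace bergman := isClosed_bergman.completeSpace_coe

theorem tendstoLocallyUniformlyOn_iterate_dz {f : ℕ → Smooth} {g : Smooth}
    (hf : ∀ n, f n ∈ holomorphicFunctions) (hg : g ∈ holomorphicFunctions)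
    (h : TendstoLocallyUniformlyOn (fun n => (f n : ℂ → ℂ)) (g : ℂ → ℂ) Filter.atTop halfPlane)
    (k : ℕ) : TendstoLocallyUniformlyOn
      (fun n => ((dz ^ k : Module.End ℂ Smooth) (f n) : ℂ → ℂ))
      ((dz ^ k : Module.End ℂ Smooth) g : ℂ → ℂ) Filter.atTop halfPlane := by
  induction k with
  | zero => exact h
  | succ k ih =>
    have h1 := ih.deriv (Filter.Eventually.of_forall fun n =>
      iterate_dz_mem_holomorphicFunctions (hf n) k) halfPlane.isOpen
    rw [pow_succ']
    refine (h1.congr fun n z hz => ?_).congr_right fun z hz => ?_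
    · exact (dz_apply_of_holomorphic (iterate_dz_mem_holomorphicFunctions (hf n) k) hz).symm
    · exact (dz_apply_of_holomorphic (iterate_dz_mem_holomorphicFunctions hg k) hz).symm

theorem tendsto_creation_apply {f : ℕ → Smooth} {g : Smooth}
    (hf : ∀ n, f n ∈ holomorphicFunctions) (hg : g ∈ holomorphicFunctions)
    (h : TendstoLocallyUniformlyOn (fun n => (f n : ℂ → ℂ)) (g : ℂ → ℂ) Filter.atTop halfPlane)
    (j : ℕ) {z : ℂ} (hz : z ∈ halfPlane) :
    Filter.Tendsto (fun n => (creation j (f n) : ℂ → ℂ) z) Filter.atTop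
      (nhds ((creation j g : ℂ → ℂ) z)) := by
  have key : ∀ u : Smooth, (creation j u : ℂ → ℂ) z = ∑ k ∈ Finset.range (j + 1),
      ((j.choose k : ℂ) / (k.factorial : ℂ) * (2 * Complex.I) ^ k) *
        (((yS ^ k : Smooth) : ℂ → ℂ) z * ((dz ^ k : Module.End ℂ Smooth) u : ℂ → ℂ) z) := by
    intro u
    rw [creation_eq_sum_smul]
    have : ∀ (s : Finset ℕ) (v : ℕ → Smooth),
        ((∑ k ∈ s, v k : Smooth) : ℂ → ℂ) z = ∑ k ∈ s, (v k : ℂ → ℂ) z := by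
      intro s v
      rw [AddSubmonoidClass.coe_finsetSum, Finset.sum_apply]
    rw [this]
    rfl
  simp only [key]
  refine tendsto_finsetSum _ fun k _ => Filter.Tendsto.const_mul _ (Filter.Tendsto.const_mul _ ?_)
  exact (tendstoLocallyUniformlyOn_iterate_dz hf hg h k).tendsto_at hz

/-! ### Integration by parts -/

theorem integral_dirDeriv_eq_zero (v : ℂ) {ψ : Smooth} (hψ : ψ ∈ compactlySupported) :
    ∫ z, (dirDeriv v ψ : ℂ → ℂ) z ∂areaMeasure = 0 := by
  have hc := contDiff_of_mem_compactlySupported hψ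
  have h1 : ∫ z, (dirDeriv v ψ : ℂ → ℂ) z ∂areaMeasure = ∫ z, fderiv ℝ (ψ : ℂ → ℂ) z v := by
    have h2 : ∫ z, (dirDeriv v ψ : ℂ → ℂ) z ∂areaMeasure =
        ∫ z in (halfPlane : Set ℂ), fderiv ℝ (ψ : ℂ → ℂ) z v :=
      setIntegral_congr_fun halfPlane.isOpen.measurableSet fun z hz => dirDeriv_apply v ψ hz
    rw [h2]
    refine setIntegral_eq_integral_of_forall_compl_eq_zero fun z hz => ?_
    have h3 : (ψ : ℂ → ℂ) =ᶠ[nhds z] fun _ => 0 := by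
      filter_upwards [isClosed_closure.isOpen_compl.mem_nhds fun h => hz (hψ.2 h)] with x hx
      exact image_eq_zero_of_notMem_tsupport hx
    rw [h3.fderiv_eq]
    simp
  rw [h1]
  have hi : Integrable (ψ : ℂ → ℂ) volume := hc.continuous.integrable_of_hasCompactSupport hψ.1
  have hi' : Integrable (fun z => fderiv ℝ (ψ : ℂ → ℂ) z v) volume :=
    ((hc.continuous_fderiv (by simp)).clm_apply continuous_const).integrable_of_hasCompactSupport
      (hψ.1.fderiv_apply ℝ v)
  -- Integration by parts against the constant `1`.
  have := integral_mul_fderiv_eq_neg_fderiv_mul_of_integrable (μ := volume) (𝕜 := ℂ) (v := v)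
    (f := fun _ : ℂ => (1 : ℂ)) (g := (ψ : ℂ → ℂ)) (by simp) (by simpa using hi')
    (by simpa using hi) (fun _ _ => differentiableAt_const _)
    (fun x _ => hc.differentiable (by simp) x)
  simpa using this

theorem integral_dz_eq_zero {ψ : Smooth} (hψ : ψ ∈ compactlySupported) :
    ∫ z, (dz ψ : ℂ → ℂ) z ∂areaMeasure = 0 := by
  have hi : ∀ v, Integrable (dirDeriv v ψ : ℂ → ℂ) areaMeasure := fun v =>
    (isSmoothUpToBoundaryL1_of_mem_compactlySupported (dirDeriv_mem_compactlySupported v hψ)).2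
  have h : ∀ z, (dz ψ : ℂ → ℂ) z = (1 / 2 : ℂ) * ((dirDeriv 1 ψ : ℂ → ℂ) z -
      Complex.I * (dirDeriv Complex.I ψ : ℂ → ℂ) z) := fun z => rfl
  simp only [h]
  rw [integral_const_mul, integral_sub (hi 1) ((hi Complex.I).const_mul _), integral_const_mul,
    integral_dirDeriv_eq_zero 1 hψ, integral_dirDeriv_eq_zero Complex.I hψ]
  simp

theorem integral_dz_mul {φ : Smooth} (hφ : φ ∈ compactlySupported) (h : Smooth) :
    ∫ z, (dz φ : ℂ → ℂ) z * conj ((h : ℂ → ℂ) z) ∂areaMeasure =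
      -∫ z, (φ : ℂ → ℂ) z * conj ((dzbar h : ℂ → ℂ) z) ∂areaMeasure := by
  have h1 := integral_dz_eq_zero (mul_mem_compactlySupported (v := conjS h) hφ)
  have h2 : ∀ z, (dz (φ * conjS h) : ℂ → ℂ) z = (φ : ℂ → ℂ) z * conj ((dzbar h : ℂ → ℂ) z) +
      (dz φ : ℂ → ℂ) z * conj ((h : ℂ → ℂ) z) := fun z => by
    rw [dz_mul, dz_conjS, add_apply, mul_apply, mul_apply, conjS_apply, conjS_apply]
    ring
  simp only [h2] at h1
  have hi : ∀ u v : Smooth, u ∈ compactlySupported →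
      Integrable (fun z => (u : ℂ → ℂ) z * conj ((v : ℂ → ℂ) z)) areaMeasure := fun u v hu =>
    (isSmoothUpToBoundaryL1_of_mem_compactlySupported
      (mul_mem_compactlySupported (v := conjS v) hu)).2
  rw [integral_add (hi _ _ hφ) (hi _ _ (dz_mem_compactlySupported hφ))] at h1
  linear_combination h1

theorem integral_iterate_dz_mul (j : ℕ) {φ : Smooth} (hφ : φ ∈ compactlySupported) (h : Smooth) :
    ∫ z, ((dz ^ j : Module.End ℂ Smooth) φ : ℂ → ℂ) z * conj ((h : ℂ → ℂ) z) ∂areaMeasure =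
      (-1) ^ j * ∫ z, (φ : ℂ → ℂ) z *
        conj (((dzbar ^ j : Module.End ℂ Smooth) h : ℂ → ℂ) z) ∂areaMeasure := by
  induction j generalizing φ with
  | zero => simp
  | succ j ih =>
    have h1 := ih (dz_mem_compactlySupported hφ)
    have h2 := integral_dz_mul hφ ((dzbar ^ j : Module.End ℂ Smooth) h)
    rw [pow_succ dz, Module.End.mul_apply, h1, h2, pow_succ' dzbar, Module.End.mul_apply,
      pow_succ]
    ring

/-- Compact support of `φ` removes all boundary terms, so `h` may be any smooth function; only its
`∂̄`-derivatives matter. -/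
theorem integral_creation_mul (j : ℕ) {φ : Smooth} (hφ : φ ∈ compactlySupported) (h : Smooth) :
    ∫ z, (creation j φ : ℂ → ℂ) z * conj ((h : ℂ → ℂ) z) ∂areaMeasure =
      (-1) ^ j * ((2 * Complex.I) ^ j / (j.factorial : ℂ)) *
        ∫ z, ((yS ^ j * φ : Smooth) : ℂ → ℂ) z *
          conj (((dzbar ^ j : Module.End ℂ Smooth) h : ℂ → ℂ) z) ∂areaMeasure := by
  have h0 : yS ^ j * φ ∈ compactlySupported := by
    rw [mul_comm]; exact mul_mem_compactlySupported hφ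
  have h1 : ∀ z, (creation j φ : ℂ → ℂ) z * conj ((h : ℂ → ℂ) z) =
      ((2 * Complex.I) ^ j / (j.factorial : ℂ)) *
        (((dz ^ j : Module.End ℂ Smooth) (yS ^ j * φ) : ℂ → ℂ) z * conj ((h : ℂ → ℂ) z)) := by
    intro z
    rw [creation_apply, mulZSubConj_pow, map_smul, smul_smul, smul_apply]
    ring
  simp only [h1]
  rw [integral_const_mul, integral_iterate_dz_mul j h0]
  ring

/-! ### Cutoff functions -/

/-- The function `y / |z + i|²`, a defining function of the boundary of `Π` and of infinity. -/
def bdry (z : ℂ) : ℝ := z.im * (Complex.normSq (z + Complex.I))⁻¹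

theorem normSq_add_I_pos {z : ℂ} (hz : z ∈ halfPlane) : 0 < Complex.normSq (z + Complex.I) :=
  Complex.normSq_pos.2 (add_I_ne_zero (im_pos hz).le)

theorem bdry_pos {z : ℂ} (hz : z ∈ halfPlane) : 0 < bdry z :=
  mul_pos (im_pos hz) (inv_pos.2 (normSq_add_I_pos hz))

theorem contDiffOn_bdry : ContDiffOn ℝ ∞ bdry halfPlane := by
  have h1 : ContDiff ℝ ∞ fun z : ℂ => Complex.normSq (z + Complex.I) := by
    simp only [Complex.normSq_apply]
    have hre : ContDiff ℝ ∞ fun z : ℂ => (z + Complex.I).re :=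
      Complex.reCLM.contDiff.comp (contDiff_id.add contDiff_const)
    have him : ContDiff ℝ ∞ fun z : ℂ => (z + Complex.I).im :=
      Complex.imCLM.contDiff.comp (contDiff_id.add contDiff_const)
    exact (hre.mul hre).add (him.mul him)
  exact Complex.imCLM.contDiff.contDiffOn.mul
    (h1.contDiffOn.inv fun z hz => (normSq_add_I_pos hz).ne')

theorem contDiffOn_comp_bdry {η : ℝ → ℝ} (hη : ContDiff ℝ ∞ η) (n : ℕ) :
    ContDiffOn ℝ ∞ (fun z => (η (n * bdry z) : ℂ)) halfPlane :=
  Complex.ofRealCLM.contDiff.comp_contDiffOn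
    (hη.comp_contDiffOn (contDiffOn_const.mul contDiffOn_bdry))

/-- The function `η (n y / |z + i|²)`. -/
def cut (η : ℝ → ℝ) (hη : ContDiff ℝ ∞ η) (n : ℕ) : Smooth :=
  Smooth.mk _ (contDiffOn_comp_bdry hη n)

theorem cut_apply {η : ℝ → ℝ} (hη : ContDiff ℝ ∞ η) (n : ℕ) {z : ℂ} (hz : z ∈ halfPlane) :
    (cut η hη n : ℂ → ℂ) z = η (n * bdry z) := Smooth.mk_apply _ hz

theorem contDiffOn_ofReal_bdry : ContDiffOn ℝ ∞ (fun z => (bdry z : ℂ)) halfPlane :=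
  Complex.ofRealCLM.contDiff.comp_contDiffOn contDiffOn_bdry

/-- The function `y / |z + i|²` as an element of `C^∞(Π)`. -/
def bdryS : Smooth := Smooth.mk _ contDiffOn_ofReal_bdry

theorem bdryS_apply {z : ℂ} (hz : z ∈ halfPlane) : (bdryS : ℂ → ℂ) z = bdry z :=
  Smooth.mk_apply _ hz

theorem bdryS_eq : bdryS = yS * rhoS * conjS rhoS := by
  refine Smooth.ext_on fun z hz => ?_
  rw [bdryS_apply hz, mul_apply, mul_apply, yS_apply hz, conjS_apply, rhoS_apply hz, bdry,
    mul_assoc, Complex.mul_conj, Complex.normSq_inv]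
  push_cast; rfl

theorem contDiff_mul_deriv {η : ℝ → ℝ} (hη : ContDiff ℝ ∞ η) :
    ContDiff ℝ ∞ fun t => t * deriv η t :=
  contDiff_id.mul (contDiff_infty_iff_deriv.1 hη).2

/-- The chain rule multiplied by `b = y/|z + i|²`: the factor `n b η'(n b)` is again a cutoff, with
profile `t η'(t)`, so no power of `n` is left over. -/
theorem dirDeriv_cut (v : ℂ) {η : ℝ → ℝ} (hη : ContDiff ℝ ∞ η) (n : ℕ) :
    (yS * rhoS * conjS rhoS) * dirDeriv v (cut η hη n) =
      cut _ (contDiff_mul_deriv hη) n * dirDeriv v (yS * rhoS * conjS rhoS) := by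
  rw [← bdryS_eq]
  refine Smooth.ext_on fun z hz => ?_
  have hb : HasFDerivAt bdry (fderiv ℝ bdry z) z :=
    ((contDiffOn_bdry.contDiffAt (halfPlane.isOpen.mem_nhds hz)).differentiableAt
      (by simp)).hasFDerivAt
  have hb' : HasFDerivAt (fun z => (bdry z : ℂ)) (Complex.ofRealCLM.comp (fderiv ℝ bdry z)) z :=
    Complex.ofRealCLM.hasFDerivAt.comp z hb
  have hη' : HasDerivAt η (deriv η (n * bdry z)) (n * bdry z) :=
    (hη.differentiable (by simp) _).hasDerivAt
  have hc : HasFDerivAt (fun z => (η (n * bdry z) : ℂ))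
      (Complex.ofRealCLM.comp (deriv η (n * bdry z) • ((n : ℝ) • fderiv ℝ bdry z))) z :=
    Complex.ofRealCLM.hasFDerivAt.comp z
      (hη'.comp_hasFDerivAt z (hb.const_mul (n : ℝ)))
  have e1 : (cut η hη n : ℂ → ℂ) =ᶠ[nhds z] fun z => (η (n * bdry z) : ℂ) := by
    filter_upwards [halfPlane.isOpen.mem_nhds hz] with x hx using cut_apply hη n hx
  have e2 : (bdryS : ℂ → ℂ) =ᶠ[nhds z] fun z => (bdry z : ℂ) := by
    filter_upwards [halfPlane.isOpen.mem_nhds hz] with x hx using bdryS_apply hx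
  rw [mul_apply, mul_apply, dirDeriv_apply _ _ hz, dirDeriv_apply _ _ hz, cut_apply _ _ hz,
    bdryS_apply hz, e1.fderiv_eq, e2.fderiv_eq, hc.fderiv, hb'.fderiv]
  simp only [ContinuousLinearMap.comp_apply, _root_.smul_apply,
    Complex.ofRealCLM_apply, smul_eq_mul]
  push_cast
  ring

/-- The bounded factor in `R (η (n g)) = (t η') (n g) q`. -/
def cutFactor : Smooth := 1 - (2 * Complex.I) • (yS * rhoS)

/-- `R` is homogeneous of weight zero and `R b = b q` with `q` bounded, so differentiating the
cutoff costs nothing as `n` grows. The identity is proved after multiplication by `b`, which has no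
zero in `Π`. -/
theorem raising_cut {η : ℝ → ℝ} (hη : ContDiff ℝ ∞ η) (n : ℕ) :
    raising (cut η hη n) = cut _ (contDiff_mul_deriv hη) n * cutFactor := by
  set b := yS * rhoS * conjS rhoS with hb
  have h1 : b * dz (cut η hη n) = cut _ (contDiff_mul_deriv hη) n * dz b := by
    rw [dz_eq, dz_eq, mul_smul_comm, mul_smul_comm, mul_sub, mul_sub, mul_smul_comm,
      mul_smul_comm, dirDeriv_cut, dirDeriv_cut]
  have h2 : (2 * Complex.I) • (yS * dz b) = b * cutFactor := by
    have h0 : dz (conjS rhoS) = 0 := by rw [dz_conjS, dzbar_rhoS, map_zero]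
    rw [hb, dz_mul, dz_mul, h0, dz_rhoS, dz_yS, cutFactor]
    simp only [mul_zero, zero_add, mul_smul_comm, mul_one, mul_add, smul_add, smul_smul, mul_sub,
      mul_neg, smul_neg]
    have h3 : 2 * Complex.I * (-Complex.I / 2) = 1 := by linear_combination -Complex.I_mul_I
    rw [h3, one_smul]
    have h4 : yS * (conjS rhoS * (yS * rhoS ^ 2)) = yS * rhoS * conjS rhoS * (yS * rhoS) := by ring
    have h5 : yS * (conjS rhoS * rhoS) = yS * rhoS * conjS rhoS := by ring
    rw [h4, h5]
    abel
  have h3 : b * raising (cut η hη n) = b * (cut _ (contDiff_mul_deriv hη) n * cutFactor) := by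
    rw [raising_apply, mul_smul_comm, mul_left_comm, h1, mul_left_comm b, ← h2, mul_smul_comm,
      mul_left_comm]
  refine Smooth.ext_on fun z hz => ?_
  have h4 := congrArg (fun u : Smooth => (u : ℂ → ℂ) z) h3
  simp only [mul_apply] at h4
  have h5 : (b : ℂ → ℂ) z ≠ 0 := by
    rw [hb, ← bdryS_eq, bdryS_apply hz]
    exact_mod_cast (bdry_pos hz).ne'
  rw [mul_apply]
  exact mul_left_cancel₀ h5 h4

/-- Smooth functions vanishing on `(-∞, 1)` and constant on `(2, ∞)`. -/
structure IsCutoff (η : ℝ → ℝ) : Prop where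
  contDiff : ContDiff ℝ ∞ η
  eq_zero : ∀ t < 1, η t = 0
  eq_const : ∃ c, ∀ t, 2 < t → η t = c

theorem IsCutoff.mul_deriv {η : ℝ → ℝ} (h : IsCutoff η) : IsCutoff fun t => t * deriv η t where
  contDiff := contDiff_mul_deriv h.contDiff
  eq_zero t ht := by
    have : η =ᶠ[nhds t] fun _ => 0 := by
      filter_upwards [isOpen_Iio.mem_nhds ht] with x hx using h.eq_zero x hx
    rw [this.deriv_eq]; simp
  eq_const := by
    obtain ⟨c, hc⟩ := h.eq_const
    refine ⟨0, fun t ht => ?_⟩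
    have : η =ᶠ[nhds t] fun _ => c := by
      filter_upwards [isOpen_Ioi.mem_nhds ht] with x hx using hc x hx
    rw [this.deriv_eq]; simp

theorem IsCutoff.exists_bound {η : ℝ → ℝ} (h : IsCutoff η) : ∃ M : ℝ, ∀ t, |η t| ≤ M := by
  obtain ⟨c, hc⟩ := h.eq_const
  obtain ⟨M, hM⟩ := (isCompact_Icc (a := (1 : ℝ)) (b := 2)).exists_bound_of_continuousOn
    h.contDiff.continuous.continuousOn
  refine ⟨max M |c|, fun t => ?_⟩
  rcases lt_or_ge t 1 with h1 | h1
  · rw [h.eq_zero t h1, abs_zero]; exact le_max_of_le_right (abs_nonneg c)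
  · rcases lt_or_ge 2 t with h2 | h2
    · rw [hc t h2]; exact le_max_right _ _
    · exact le_max_of_le_left (hM t ⟨h1, h2⟩)

theorem one_le_norm_add_I {z : ℂ} (hz : z ∈ halfPlane) :
    1 ≤ ‖z + Complex.I‖ ∧ z.im ≤ ‖z + Complex.I‖ := by
  have h0 := im_pos hz
  have h1 := Complex.abs_im_le_norm (z + Complex.I)
  have h2 : |(z + Complex.I).im| = z.im + 1 := by
    rw [Complex.add_im, Complex.I_im, abs_of_pos (by linarith)]
  constructor <;> linarith

/-- On the support `|z + i|² ≤ (n + 1) y`; together with `y ≤ |z + i|` and `1 ≤ |z + i|` this gives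
`|z + i| ≤ n + 1` and `y ≥ 1/(n + 1)`. Using `n + 1` avoids a separate case `n = 0`. -/
theorem cut_mem_compactlySupported {η : ℝ → ℝ} (h : IsCutoff η) (n : ℕ) :
    cut η h.contDiff n ∈ compactlySupported := by
  set K : Set ℂ := Metric.closedBall (-Complex.I) (n + 1) ∩ {z | 1 / ((n : ℝ) + 1) ≤ z.im} with hK
  have hn : (0 : ℝ) < (n : ℝ) + 1 := by positivity
  have hKc : IsCompact K :=
    (isCompact_closedBall _ _).inter_right (isClosed_le continuous_const Complex.continuous_im)
  have hKs : K ⊆ halfPlane := fun z hz =>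
    lt_of_lt_of_le (by positivity : (0 : ℝ) < 1 / ((n : ℝ) + 1)) hz.2
  have hsupp : Function.support (cut η h.contDiff n : ℂ → ℂ) ⊆ K := by
    intro z hz
    have hz0 : z ∈ halfPlane := by
      by_contra hne
      exact hz ((cut η h.contDiff n).2.2 z hne)
    have h1 : 1 ≤ n * bdry z := by
      by_contra hlt
      refine hz ?_
      rw [cut_apply _ _ hz0, h.eq_zero _ (not_le.1 hlt), Complex.ofReal_zero]
    have h2 : 1 ≤ (n + 1) * bdry z := by nlinarith [bdry_pos hz0]
    rw [bdry, Complex.normSq_eq_norm_sq, ← div_eq_mul_inv, mul_div_assoc', le_div_iff₀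
      (by have := (one_le_norm_add_I hz0).1; positivity), one_mul] at h2
    obtain ⟨h3, h4⟩ := one_le_norm_add_I hz0
    refine ⟨?_, ?_⟩
    · rw [Metric.mem_closedBall, dist_eq_norm, sub_neg_eq_add]
      nlinarith
    · change 1 / ((n : ℝ) + 1) ≤ z.im
      rw [div_le_iff₀ hn]
      nlinarith
  have hts : tsupport (cut η h.contDiff n : ℂ → ℂ) ⊆ K := closure_minimal hsupp hKc.isClosed
  exact ⟨HasCompactSupport.of_support_subset_isCompact hKc hsupp, hts.trans hKs⟩

theorem cutFactor_mem_decay : cutFactor ∈ decay 0 := by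
  have h0 := rhoS_pow_mem_decay 0
  rw [pow_zero] at h0
  have h1 := rhoS_pow_mem_decay 1
  rw [pow_one] at h1
  exact sub_mem h0 (Submodule.smul_mem _ _ (yS_mul_mem_decay h1))

theorem raising_mem_decay {m : ℕ} {u : Smooth} (hu : u ∈ decay m) : raising u ∈ decay m := by
  rw [raising_apply]
  exact Submodule.smul_mem _ _ (yS_mul_mem_decay (dz_mem_decay hu))

theorem raising_mul (u v : Smooth) : raising (u * v) = raising u * v + u * raising v := by
  simp only [raising_apply, dz_mul, mul_add, smul_add, mul_smul_comm, smul_mul_assoc]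
  rw [add_comm]
  congr 2 <;> ring

/-- The majorant for dominated convergence, uniform in `n`. The induction runs over all profiles and
all `u` at once, because `R` applied to `χ_n u` changes the profile to `t η'` in one term and `u` to
`R u` in the other. -/
theorem exists_norm_creation_cut_le (j : ℕ) {η : ℝ → ℝ} (h : IsCutoff η) {u : Smooth}
    (hu : u ∈ decay 2) : ∃ C : ℝ, ∀ (n : ℕ), ∀ z ∈ halfPlane,
      ‖(creation j (cut η h.contDiff n * u) : ℂ → ℂ) z‖ ≤ C * ‖(rhoS : ℂ → ℂ) z‖ ^ 2 := by
  induction j generalizing η u with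
  | zero =>
    obtain ⟨M, hM⟩ := h.exists_bound
    obtain ⟨C, hC0, hC⟩ := exists_norm_le_of_mem_decay hu
    refine ⟨M * C, fun n z hz => ?_⟩
    rw [creation_zero, mul_apply, norm_mul, cut_apply _ _ hz, Complex.norm_real, mul_assoc]
    exact mul_le_mul (hM _) (hC z hz) (norm_nonneg _) ((abs_nonneg _).trans (hM 0))
  | succ j ih =>
    have hq : cutFactor * u ∈ decay 2 := by
      have := mul_mem_decay cutFactor_mem_decay hu
      rwa [zero_add] at this
    obtain ⟨C, hC⟩ := ih h.mul_deriv hq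
    obtain ⟨D, hD⟩ := ih h (add_mem (raising_mem_decay hu)
      (Submodule.smul_mem _ ((j : ℂ) + 1) hu))
    refine ⟨‖1 / ((j : ℂ) + 1)‖ * (C + D), fun n z hz => ?_⟩
    have e : raising (cut η h.contDiff n * u) + ((j : ℂ) + 1) • (cut η h.contDiff n * u) =
        cut _ h.mul_deriv.contDiff n * (cutFactor * u) +
          cut η h.contDiff n * (raising u + ((j : ℂ) + 1) • u) := by
      rw [raising_mul, raising_cut, mul_add, mul_smul_comm, mul_assoc, add_assoc]
    rw [creation_succ', e, smul_apply, norm_mul, map_add, add_apply, mul_assoc, add_mul]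
    exact mul_le_mul_of_nonneg_left
      ((norm_add_le _ _).trans (add_le_add (hC n z hz) (hD n z hz))) (norm_nonneg _)

theorem dz_eventuallyEq {u v : Smooth} {z : ℂ} (hz : z ∈ halfPlane)
    (h : (u : ℂ → ℂ) =ᶠ[nhds z] (v : ℂ → ℂ)) : (dz u : ℂ → ℂ) =ᶠ[nhds z] (dz v : ℂ → ℂ) := by
  filter_upwards [halfPlane.isOpen.mem_nhds hz, h.fderiv (𝕜 := ℝ)] with x hx hd
  rw [dz_eq, dz_eq, smul_apply, smul_apply, sub_apply, sub_apply, smul_apply, smul_apply,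
    dirDeriv_apply _ _ hx, dirDeriv_apply _ _ hx, dirDeriv_apply _ _ hx, dirDeriv_apply _ _ hx, hd]

theorem creation_eventuallyEq (j : ℕ) {u v : Smooth} {z : ℂ} (hz : z ∈ halfPlane)
    (h : (u : ℂ → ℂ) =ᶠ[nhds z] (v : ℂ → ℂ)) :
    (creation j u : ℂ → ℂ) =ᶠ[nhds z] (creation j v : ℂ → ℂ) := by
  induction j with
  | zero => simpa only [creation_zero] using h
  | succ j ih =>
    filter_upwards [dz_eventuallyEq hz ih, ih] with x h1 h2
    rw [creation_succ, creation_succ, smul_apply, smul_apply, add_apply, add_apply, raising_apply,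
      raising_apply]
    simp only [smul_apply, mul_apply, h1, h2]

/-- The cutoff profile. -/
def profile (t : ℝ) : ℝ := Real.smoothTransition (t - 1)

theorem isCutoff_profile : IsCutoff profile where
  contDiff := Real.smoothTransition.contDiff.comp (contDiff_id.sub contDiff_const)
  eq_zero t ht := Real.smoothTransition.zero_of_nonpos (by linarith)
  eq_const := ⟨1, fun t ht => Real.smoothTransition.one_of_one_le (by linarith)⟩

/-- The standard cutoff functions. -/
def cutoff (n : ℕ) : Smooth := cut profile isCutoff_profile.contDiff n

theorem tendsto_creation_cutoff (j : ℕ) (u : Smooth) {z : ℂ} (hz : z ∈ halfPlane) :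
    Filter.Tendsto (fun n => (creation j (cutoff n * u) : ℂ → ℂ) z) Filter.atTop
      (nhds ((creation j u : ℂ → ℂ) z)) := by
  have hb := bdry_pos hz
  refine tendsto_const_nhds.congr' ?_
  have h1 : ∀ᶠ n : ℕ in Filter.atTop, 2 < n * (bdry z / 2) :=
    (tendsto_natCast_atTop_atTop.atTop_mul_const (half_pos hb)).eventually_gt_atTop 2
  filter_upwards [h1] with n hn
  refine (creation_eventuallyEq j hz ?_).eq_of_nhds.symm
  have h2 : ∀ᶠ x in nhds z, bdry z / 2 < bdry x :=
    (contDiffOn_bdry.continuousOn.continuousAt (halfPlane.isOpen.mem_nhds hz)).eventually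
      (lt_mem_nhds (half_lt_self hb))
  filter_upwards [h2, halfPlane.isOpen.mem_nhds hz] with x hx hx'
  have h3 : (2 : ℝ) < n * bdry x :=
    hn.trans_le (mul_le_mul_of_nonneg_left hx.le (Nat.cast_nonneg n))
  rw [mul_apply, cutoff, cut_apply _ _ hx', profile,
    Real.smoothTransition.one_of_one_le (by linarith), Complex.ofReal_one, one_mul]

theorem tendsto_integral_creation_cutoff (j : ℕ) {u h : Smooth} (hu : u ∈ decay 2)
    (hh : MemLp (h : ℂ → ℂ) 2 areaMeasure) :
    Filter.Tendsto (fun n => ∫ z, (creation j (cutoff n * u) : ℂ → ℂ) z * conj ((h : ℂ → ℂ) z)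
      ∂areaMeasure) Filter.atTop
      (nhds (∫ z, (creation j u : ℂ → ℂ) z * conj ((h : ℂ → ℂ) z) ∂areaMeasure)) := by
  obtain ⟨C, hC⟩ := exists_norm_creation_cut_le j isCutoff_profile hu
  refine tendsto_integral_of_dominated_convergence
    (fun z => C * (‖(rhoS : ℂ → ℂ) z‖ ^ 2 * ‖(h : ℂ → ℂ) z‖)) (fun n => ?_) ?_ (fun n => ?_) ?_
  · exact aestronglyMeasurable_smooth (creation j (cutoff n * u) * conjS h)
  · exact (memLp_norm_rhoS_sq.integrable_mul hh.norm).const_mul C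
  · refine ae_areaMeasure fun z hz => ?_
    rw [norm_mul, RCLike.norm_conj, ← mul_assoc]
    exact mul_le_mul_of_nonneg_right (hC n z hz) (norm_nonneg _)
  · refine ae_areaMeasure fun z hz => ?_
    exact (tendsto_creation_cutoff j u hz).mul_const _

/-- The derivative `∂̄^j h` of a square integrable `h` is not controlled, so the integral on the
transposed side is used only as a limit along cutoffs. -/
theorem tendsto_integral_cutoff (j : ℕ) {u h : Smooth} (hu : u ∈ decay 2)
    (hh : MemLp (h : ℂ → ℂ) 2 areaMeasure) :
    Filter.Tendsto (fun n => (-1) ^ j * ((2 * Complex.I) ^ j / (j.factorial : ℂ)) *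
      ∫ z, ((yS ^ j * (cutoff n * u) : Smooth) : ℂ → ℂ) z *
        conj (((dzbar ^ j : Module.End ℂ Smooth) h : ℂ → ℂ) z) ∂areaMeasure) Filter.atTop
      (nhds (∫ z, (creation j u : ℂ → ℂ) z * conj ((h : ℂ → ℂ) z) ∂areaMeasure)) := by
  refine (tendsto_integral_creation_cutoff j hu hh).congr fun n => ?_
  exact integral_creation_mul j
    (mul_mem_compactlySupported (cut_mem_compactlySupported isCutoff_profile n)) h

theorem integral_creation_mul_eq_zero (j : ℕ) {u h : Smooth} (hu : u ∈ decay 2)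
    (hh : MemLp (h : ℂ → ℂ) 2 areaMeasure) (h0 : (dzbar ^ j : Module.End ℂ Smooth) h = 0) :
    ∫ z, (creation j u : ℂ → ℂ) z * conj ((h : ℂ → ℂ) z) ∂areaMeasure = 0 := by
  refine tendsto_nhds_unique (tendsto_integral_cutoff j hu hh) ?_
  simp [h0]

theorem creation_conjS (j : ℕ) {u : Smooth} (hu : u ∈ holomorphicFunctions) :
    creation j (conjS u) = conjS u := by
  have h0 : dz (conjS u) = 0 := by
    rw [dz_conjS, (mem_holomorphicFunctions_iff u).1 hu, map_zero]
  induction j with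
  | zero => exact creation_zero _
  | succ j ih =>
    rw [creation_succ, ih, raising_apply, h0, mul_zero, smul_zero, zero_add, smul_smul, one_div,
      inv_mul_cancel₀ (by exact_mod_cast j.succ_ne_zero), one_smul]

/-- Both sides are limits of multiples of `∫ y^j χ_n u · conj (∂^j v)`: the left one since `∂̄^j S^j
v = (-1)^j ∂^j v`, the right one by applying the same formula to `ū` and `v̄`, where `S^j ū = ū`,
and conjugating. -/
theorem integral_creation_mul_creation (j : ℕ) {u v : Smooth} (hu : u ∈ decay 2)
    (hv : v ∈ decay 2) (hu' : u ∈ holomorphicFunctions) (hv' : v ∈ holomorphicFunctions) :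
    ∫ z, (creation j u : ℂ → ℂ) z * conj ((creation j v : ℂ → ℂ) z) ∂areaMeasure =
      ∫ z, (u : ℂ → ℂ) z * conj ((v : ℂ → ℂ) z) ∂areaMeasure := by
  have h1 := tendsto_integral_cutoff j hu (memLp_of_mem_decay (creation_mem_decay j hv))
  have h2 := tendsto_integral_cutoff j (conjS_mem_decay hu)
    (memLp_of_mem_decay (conjS_mem_decay hv))
  rw [creation_conjS j hu'] at h2
  have h3 := (Complex.continuous_conj.tendsto _).comp h2
  have h4 : conj (∫ z, (conjS u : ℂ → ℂ) z * conj ((conjS v : ℂ → ℂ) z) ∂areaMeasure) =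
      ∫ z, (u : ℂ → ℂ) z * conj ((v : ℂ → ℂ) z) ∂areaMeasure := by
    rw [← integral_conj]
    refine integral_congr_ae (Filter.Eventually.of_forall fun z => ?_)
    simp [conjS_apply]
  rw [h4] at h3
  refine tendsto_nhds_unique h1 (h3.congr fun n => ?_)
  rw [iterate_dzbar_creation j ((mem_holomorphicFunctions_iff v).1 hv'), iterate_dzbar_conjS]
  have h5 : ∀ z, ((yS ^ j * (cutoff n * u) : Smooth) : ℂ → ℂ) z *
      conj ((((-1 : ℂ) ^ j • (dz ^ j : Module.End ℂ Smooth) v : Smooth) : ℂ → ℂ) z) =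
      (-1) ^ j * conj (((yS ^ j * (cutoff n * conjS u) : Smooth) : ℂ → ℂ) z *
        conj ((conjS ((dz ^ j : Module.End ℂ Smooth) v) : ℂ → ℂ) z)) := by
    intro z
    have hc : conj ((cutoff n : ℂ → ℂ) z) = (cutoff n : ℂ → ℂ) z := by
      by_cases hz : z ∈ halfPlane
      · rw [cutoff, cut_apply _ _ hz, Complex.conj_ofReal]
      · rw [(cutoff n).2.2 z hz, map_zero]
    have hy : conj (((yS ^ j : Smooth) : ℂ → ℂ) z) = ((yS ^ j : Smooth) : ℂ → ℂ) z := by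
      rw [← conjS_apply, map_pow, conjS_yS]
    simp only [mul_apply, smul_apply, conjS_apply, map_mul, hc, hy, Complex.conj_conj, map_pow,
      map_neg, map_one]
    ring
  simp only [h5, Function.comp_apply]
  rw [integral_const_mul, integral_conj]
  simp only [map_mul, map_pow, map_neg, map_one, map_div₀, Complex.conj_I, map_natCast, map_ofNat]
  have h6 : ((-1 : ℂ) ^ j) * (-1) ^ j = 1 := by rw [← mul_pow]; simp
  -- Conjugating `(2i)^j` yields the sign `(-1)^j` that matches the one in `∂̄^j S^j v`.
  have h7 : (2 * -Complex.I) ^ j = (-1) ^ j * (2 * Complex.I) ^ j := by rw [← mul_pow]; congr 1; ring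
  rw [h7]
  ring

/-! ### The Cayley transform -/

/-- The Cayley transform of `Π` onto the unit disc. -/
def cay (z : ℂ) : ℂ := 1 - 2 * Complex.I * (z + Complex.I)⁻¹

/-- The inverse Cayley transform. -/
def cayInv (w : ℂ) : ℂ := 2 * Complex.I * (1 - w)⁻¹ - Complex.I

/-- It makes the cutoffs, which are functions of `y/|z + i|²`, radial on the disc. -/
theorem normSq_cay {z : ℂ} (hz : z + Complex.I ≠ 0) :
    Complex.normSq (cay z) = 1 - 4 * bdry z := by
  have h1 : cay z = (z - Complex.I) / (z + Complex.I) := by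
    rw [cay]; field_simp; ring
  have h2 : Complex.normSq (z + Complex.I) ≠ 0 := fun h => hz (Complex.normSq_eq_zero.1 h)
  rw [h1, map_div₀, bdry]
  field_simp
  simp only [Complex.normSq_apply, Complex.sub_re, Complex.sub_im, Complex.add_re, Complex.add_im,
    Complex.I_re, Complex.I_im]
  ring

theorem cay_mem_ball {z : ℂ} (hz : z ∈ halfPlane) : cay z ∈ Metric.ball (0 : ℂ) 1 := by
  have h1 := normSq_cay (add_I_ne_zero (im_pos hz).le)
  rw [Complex.normSq_eq_norm_sq] at h1
  rw [mem_ball_zero_iff]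
  nlinarith [bdry_pos hz, norm_nonneg (cay z)]

theorem one_sub_ne_zero {w : ℂ} (hw : w ∈ Metric.ball (0 : ℂ) 1) : 1 - w ≠ 0 := by
  intro h
  rw [mem_ball_zero_iff, ← sub_eq_zero.1 h, norm_one] at hw
  exact lt_irrefl _ hw

theorem cayInv_add_I (w : ℂ) : cayInv w + Complex.I = 2 * Complex.I * (1 - w)⁻¹ := by
  rw [cayInv]; ring

theorem cay_cayInv {w : ℂ} (hw : w ∈ Metric.ball (0 : ℂ) 1) : cay (cayInv w) = w := by
  have := one_sub_ne_zero hw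
  rw [cay, cayInv_add_I, mul_inv, inv_inv, ← mul_assoc, mul_inv_cancel₀ (by simp)]
  ring

theorem cayInv_cay {z : ℂ} (hz : z ∈ halfPlane) : cayInv (cay z) = z := by
  have := add_I_ne_zero (im_pos hz).le
  rw [cayInv, cay, sub_sub_cancel, mul_inv, inv_inv, ← mul_assoc, mul_inv_cancel₀ (by simp)]
  ring

theorem cayInv_mem {w : ℂ} (hw : w ∈ Metric.ball (0 : ℂ) 1) : cayInv w ∈ halfPlane := by
  have h0 : cayInv w + Complex.I ≠ 0 := by
    rw [cayInv_add_I]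
    exact mul_ne_zero (by simp) (inv_ne_zero (one_sub_ne_zero hw))
  have h1 := normSq_cay h0
  rw [cay_cayInv hw, Complex.normSq_eq_norm_sq] at h1
  rw [mem_ball_zero_iff] at hw
  have h2 : 0 < bdry (cayInv w) := by nlinarith [norm_nonneg w]
  rw [bdry] at h2
  exact pos_of_mul_pos_left h2 (inv_nonneg.2 (Complex.normSq_nonneg _))

theorem image_cay : cay '' (halfPlane : Set ℂ) = Metric.ball 0 1 :=
  Subset.antisymm (image_subset_iff.2 fun _ hz => cay_mem_ball hz)
    fun w hw => ⟨cayInv w, cayInv_mem hw, cay_cayInv hw⟩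

theorem injOn_cay : InjOn cay (halfPlane : Set ℂ) := fun z hz w hw h => by
  rw [← cayInv_cay hz, h, cayInv_cay hw]

theorem det_smul_one (a : ℂ) : (a • (1 : ℂ →L[ℝ] ℂ)).det = Complex.normSq a := by
  rw [← Algebra.norm_complex_apply, Algebra.norm_apply]
  rfl

theorem hasDerivAt_cay {z : ℂ} (hz : z ∈ halfPlane) :
    HasDerivAt cay (2 * Complex.I * (z + Complex.I)⁻¹ ^ 2) z := by
  have h := (((hasDerivAt_id z).add_const Complex.I).inv (add_I_ne_zero (im_pos hz).le)).const_mul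
    (2 * Complex.I)
  have h2 := h.const_sub 1
  have h3 : -(2 * Complex.I * (-1 / (id z + Complex.I) ^ 2)) =
      2 * Complex.I * (z + Complex.I)⁻¹ ^ 2 := by
    rw [id, inv_pow, neg_div, one_div]; ring
  rw [h3] at h2
  exact h2

theorem integral_ball_eq (g : ℂ → ℂ) : ∫ w in Metric.ball (0 : ℂ) 1, g w =
    ∫ z, (4 * Complex.normSq (z + Complex.I)⁻¹ ^ 2) • g (cay z) ∂areaMeasure := by
  rw [← image_cay, integral_image_eq_integral_abs_det_fderiv_smul volume
    halfPlane.isOpen.measurableSet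
    (fun z hz => ((hasDerivAt_cay hz).complexToReal_fderiv).hasFDerivWithinAt) injOn_cay]
  refine setIntegral_congr_fun halfPlane.isOpen.measurableSet fun z _ => ?_
  simp only [det_smul_one, abs_of_nonneg (Complex.normSq_nonneg _)]
  congr 1
  simp only [map_mul, map_pow, Complex.normSq_I, Complex.normSq_ofNat]
  norm_num

/-! ### Totality of the standard basis -/

/-- The radial weights in the moment integrals. -/
def radialWeight (j n : ℕ) (r : ℝ) : ℝ :=
  profile (n * ((1 - r ^ 2) / 4)) * ((1 - r ^ 2) / 4) ^ j

theorem continuous_radialWeight (j n : ℕ) : Continuous (radialWeight j n) := by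
  have h := isCutoff_profile.contDiff.continuous
  unfold radialWeight
  fun_prop

/-- Here `1 - r² ≤ 2/n`, so the argument of the profile is at most `1/2`. -/
theorem radialWeight_eq_zero (j : ℕ) {n : ℕ} (hn : 0 < n) {r : ℝ} (hr : 1 - 1 / (n : ℝ) ≤ r) :
    radialWeight j n r = 0 := by
  have hn' : (1 : ℝ) ≤ n := by exact_mod_cast hn
  rw [radialWeight, isCutoff_profile.eq_zero, zero_mul]
  have h1 : (n : ℝ) * (1 / n) = 1 := by field_simp
  have h2 : 0 ≤ 1 - 1 / (n : ℝ) := by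
    rw [sub_nonneg, div_le_one (by linarith)]; exact hn'
  have h3 : (1 - 1 / (n : ℝ)) ^ 2 ≤ r ^ 2 := pow_le_pow_left₀ h2 hr 2
  nlinarith [sq_nonneg (1 / (n : ℝ))]

theorem monotone_profile : Monotone profile := fun _ _ h =>
  Real.smoothTransition.monotone (sub_le_sub_right h 1)

theorem profile_nonneg (t : ℝ) : 0 ≤ profile t := Real.smoothTransition.nonneg _

theorem radialWeight_mono (j : ℕ) {m n : ℕ} (h : m ≤ n) (hm : 0 < m) {r : ℝ} (hr : 0 < r) :
    radialWeight j m r ≤ radialWeight j n r := by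
  rcases le_or_gt 1 r with h1 | h1
  · rw [radialWeight_eq_zero j hm (by
      have : (0 : ℝ) ≤ 1 / (m : ℝ) := by positivity
      linarith), radialWeight_eq_zero j (hm.trans_le h) (by
      have : (0 : ℝ) ≤ 1 / (n : ℝ) := by positivity
      linarith)]
  · have h2 : 0 ≤ (1 - r ^ 2) / 4 := by nlinarith
    refine mul_le_mul_of_nonneg_right (monotone_profile ?_) (pow_nonneg h2 j)
    exact mul_le_mul_of_nonneg_right (by exact_mod_cast h) h2

theorem radialWeight_nonneg (j : ℕ) {n : ℕ} (hn : 0 < n) {r : ℝ} (hr : 0 < r) :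
    0 ≤ radialWeight j n r := by
  rcases le_or_gt 1 r with h1 | h1
  · rw [radialWeight_eq_zero j hn (by
      have : (0 : ℝ) ≤ 1 / (n : ℝ) := by positivity
      linarith)]
  · exact mul_nonneg (profile_nonneg _) (pow_nonneg (by nlinarith) j)

theorem integrableOn_radialWeight (j k : ℕ) {n : ℕ} (hn : 0 < n) :
    IntegrableOn (fun r => radialWeight j n r * r ^ (2 * k + 1)) (Ioi (0 : ℝ)) := by
  have h1 : IntegrableOn (fun r => radialWeight j n r * r ^ (2 * k + 1)) (Icc (0 : ℝ) 1) :=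
    ((continuous_radialWeight j n).mul (by fun_prop)).continuousOn.integrableOn_compact
      isCompact_Icc
  refine h1.of_forall_sdiff_eq_zero measurableSet_Ioi fun r hr => ?_
  rw [radialWeight_eq_zero j hn, zero_mul]
  have h2 : 1 < r := by
    by_contra h
    exact hr.2 ⟨le_of_lt hr.1, not_lt.1 h⟩
  have : (0 : ℝ) ≤ 1 / (n : ℝ) := by positivity
  linarith

/-- A lower bound uniform in `n` is needed so that a vanishing limit of the moment integrals forces
the Taylor coefficient to vanish. The weights increase with `n`, so a single one suffices. -/
theorem exists_radial_moment_bound (j k : ℕ) : ∃ c : ℝ, 0 < c ∧ ∀ n : ℕ, 8 ≤ n →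
    c ≤ ∫ r in Ioi (0 : ℝ), radialWeight j n r * r ^ (2 * k + 1) := by
  -- For `r < 1/2` and `n = 8` the argument of the profile is `2(1 - r²) > 1`, so the weight is
  -- positive.
  refine ⟨∫ r in (0 : ℝ)..(1 / 2), radialWeight j 8 r * r ^ (2 * k + 1), ?_, fun n hn => ?_⟩
  · refine intervalIntegral.intervalIntegral_pos_of_pos_on
      (((continuous_radialWeight j 8).mul (by fun_prop)).intervalIntegrable _ _)
      (fun r hr => ?_) (by norm_num)
    have h0 : 0 < r := hr.1
    have h1 : r < 1 / 2 := hr.2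
    refine mul_pos (mul_pos ?_ (pow_pos (by nlinarith) j)) (pow_pos h0 _)
    refine Real.smoothTransition.pos_of_pos ?_
    push_cast
    nlinarith
  · rw [intervalIntegral.integral_of_le (by norm_num)]
    have h8 : 0 < 8 := by norm_num
    have hn0 : 0 < n := by omega
    refine (setIntegral_mono_set (integrableOn_radialWeight j k h8) ?_
      Ioc_subset_Ioi_self.eventuallyLE).trans ?_
    · refine (ae_restrict_iff' measurableSet_Ioi).2 (Filter.Eventually.of_forall fun r hr => ?_)
      exact mul_nonneg (radialWeight_nonneg j h8 hr) (pow_nonneg (le_of_lt hr) _)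
    · refine setIntegral_mono_on (integrableOn_radialWeight j k h8)
        (integrableOn_radialWeight j k hn0) measurableSet_Ioi fun r hr => ?_
      exact mul_le_mul_of_nonneg_right (radialWeight_mono j hn h8 hr) (pow_nonneg (le_of_lt hr) _)

/-- The transplantation of `H` to the unit disc. -/
def discFun (j : ℕ) (H : ℂ → ℂ) (w : ℂ) : ℂ := H (cayInv w) * (cayInv w + Complex.I) ^ (j + 2)

theorem differentiableOn_discFun (j : ℕ) {H : Smooth} (hH : H ∈ holomorphicFunctions) :
    DifferentiableOn ℂ (discFun j H) (Metric.ball 0 1) := by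
  have h1 : DifferentiableOn ℂ cayInv (Metric.ball 0 1) :=
    ((DifferentiableOn.inv (by fun_prop) fun w hw => one_sub_ne_zero hw).const_mul _).sub_const _
  have h2 : DifferentiableOn ℂ (fun w => (H : ℂ → ℂ) (cayInv w)) (Metric.ball 0 1) :=
    DifferentiableOn.comp (t := (halfPlane : Set ℂ)) hH h1 fun w hw => cayInv_mem hw
  exact h2.mul ((h1.add_const _).pow _)

/-- The Jacobian `4 |z + i|^(-4)` and the weight `(y/|z + i|²)^j` together carry `j + 2` factors
`1/(z + i)`, cancelled by the power in `discFun`, and `j + 2` conjugate ones, which form the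
conjugate of the test function. -/
theorem integral_disc_eq (j k n : ℕ) (hn : 0 < n) (H : Smooth) :
    ∫ w, (radialWeight j n ‖w‖ : ℂ) * (conj w ^ k * discFun j H w) =
      4 * conj (∫ z, ((yS ^ j * (cutoff n * (cayS ^ k * rhoS ^ (j + 2))) : Smooth) : ℂ → ℂ) z *
        conj ((H : ℂ → ℂ) z) ∂areaMeasure) := by
  have h1 : ∫ w, (radialWeight j n ‖w‖ : ℂ) * (conj w ^ k * discFun j H w) =
      ∫ w in Metric.ball (0 : ℂ) 1,
        (radialWeight j n ‖w‖ : ℂ) * (conj w ^ k * discFun j H w) := by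
    refine (setIntegral_eq_integral_of_forall_compl_eq_zero fun w hw => ?_).symm
    rw [radialWeight_eq_zero j hn, Complex.ofReal_zero, zero_mul]
    have h2 : 1 ≤ ‖w‖ := by simpa using hw
    have : (0 : ℝ) ≤ 1 / (n : ℝ) := by positivity
    linarith
  rw [h1, integral_ball_eq, ← integral_conj, ← integral_const_mul]
  refine setIntegral_congr_fun halfPlane.isOpen.measurableSet fun z hz => ?_
  have hz : z ∈ halfPlane := hz
  have hne := add_I_ne_zero (im_pos hz).le
  have h2 : (1 - ‖cay z‖ ^ 2) / 4 = bdry z := by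
    rw [← Complex.normSq_eq_norm_sq, normSq_cay hne]; ring
  have h3 : (cayS : ℂ → ℂ) z = cay z := cayS_apply hz
  simp only [radialWeight, h2, discFun, cayInv_cay hz, mul_apply, pow_apply _ _ hz, yS_apply hz,
    rhoS_apply hz, h3, cutoff, cut_apply _ _ hz, map_mul, map_pow, Complex.conj_ofReal,
    Complex.conj_conj, Complex.real_smul, bdry]
  have h4 : ((Complex.normSq (z + Complex.I)⁻¹ : ℝ) : ℂ) =
      (z + Complex.I)⁻¹ * conj (z + Complex.I)⁻¹ := (Complex.mul_conj _).symm
  have h5 : (((Complex.normSq (z + Complex.I))⁻¹ : ℝ) : ℂ) =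
      (z + Complex.I)⁻¹ * conj (z + Complex.I)⁻¹ := by rw [← Complex.normSq_inv, h4]
  push_cast at h5 ⊢
  rw [h4, h5]
  generalize conj (z + Complex.I)⁻¹ = s
  field_simp
  rw [div_pow]
  field_simp
  ring

/-- `H = ∂̄^j h` is holomorphic, and orthogonality says that the cutoff integrals of `y^j u H̄` tend
to zero. For `u = cay^k (z + i)^(-j-2)` these are, up to constants and conjugation, radial moments
times the `k`-th Taylor coefficient of the transplant of `H`. -/
theorem iterate_dzbar_eq_zero_of_orthogonal (j : ℕ) {h : Smooth}
    (hh : MemLp (h : ℂ → ℂ) 2 areaMeasure)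
    (hker : h ∈ LinearMap.ker (dzbar ^ (j + 1) : Module.End ℂ Smooth))
    (horth : ∀ u ∈ basisSpan,
      ∫ z, (creation j u : ℂ → ℂ) z * conj ((h : ℂ → ℂ) z) ∂areaMeasure = 0) :
    (dzbar ^ j : Module.End ℂ Smooth) h = 0 := by
  set H := (dzbar ^ j : Module.End ℂ Smooth) h with hH
  have hHol : H ∈ holomorphicFunctions := by
    rw [mem_holomorphicFunctions_iff, hH, ← Module.End.mul_apply, ← pow_succ']
    exact hker
  have hG := differentiableOn_discFun j hHol
  obtain ⟨p, hp⟩ := hG.analyticAt (Metric.ball_mem_nhds 0 one_pos)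
  have hcoeff : ∀ k, p.coeff k = 0 := by
    intro k
    have hmem := cayS_pow_mul_rhoS_pow_mem_basisSpan k j
    have h1 := tendsto_integral_cutoff j (basisSpan_le_decay hmem) hh
    rw [horth _ hmem, ← hH] at h1
    have hc : (-1 : ℂ) ^ j * ((2 * Complex.I) ^ j / (j.factorial : ℂ)) ≠ 0 := by
      have : (j.factorial : ℂ) ≠ 0 := by exact_mod_cast j.factorial_ne_zero
      exact mul_ne_zero (by simp) (div_ne_zero (by simp) this)
    have h2 := h1.const_mul ((-1 : ℂ) ^ j * ((2 * Complex.I) ^ j / (j.factorial : ℂ)))⁻¹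
    simp only [inv_mul_cancel_left₀ hc, mul_zero] at h2
    have h3 := ((Complex.continuous_conj.tendsto _).comp h2).const_mul 4
    rw [map_zero, mul_zero] at h3
    have h4 := h3.norm
    rw [norm_zero] at h4
    obtain ⟨c, hc0, hcn⟩ := exists_radial_moment_bound j k
    -- For all `n ≥ 8` this number is a lower bound for quantities that tend to zero.
    have h5 : c * (2 * Real.pi * ‖p.coeff k‖) ≤ 0 := by
      refine ge_of_tendsto h4 ?_
      filter_upwards [Filter.eventually_ge_atTop 8] with n hn
      have hn0 : 0 < n := by omega
      have hn1 : 1 - 1 / (n : ℝ) < 1 := by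
        have : (0 : ℝ) < n := by exact_mod_cast hn0
        have : (0 : ℝ) < 1 / (n : ℝ) := by positivity
        linarith
      have h6 := integral_radial_eq_coeff hG hp hn1 (continuous_radialWeight j n)
        (fun r hr => radialWeight_eq_zero j hn0 hr) k
      rw [integral_disc_eq j k n hn0 H] at h6
      rw [Function.comp_apply, h6, norm_mul, Complex.norm_real, norm_mul]
      have h7 : ‖(2 * Real.pi : ℂ)‖ = 2 * Real.pi := by
        rw [norm_mul, Complex.norm_real, Real.norm_of_nonneg Real.pi_pos.le]; simp
      rw [h7]
      exact mul_le_mul_of_nonneg_right ((hcn n hn).trans (le_abs_self _))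
        (mul_nonneg Real.two_pi_pos.le (norm_nonneg _))
    have h6 : 0 ≤ ‖p.coeff k‖ := norm_nonneg _
    have h7 : ‖p.coeff k‖ = 0 := by
      by_contra hne
      have : 0 < c * (2 * Real.pi * ‖p.coeff k‖) :=
        mul_pos hc0 (mul_pos Real.two_pi_pos (lt_of_le_of_ne h6 (Ne.symm hne)))
      linarith
    exact norm_eq_zero.1 h7
  have hzero := eqOn_zero_of_coeff_eq_zero one_pos hG hp hcoeff
  refine Smooth.ext_on fun z hz => ?_
  have h1 := hzero (cay_mem_ball hz)
  simp only [discFun, cayInv_cay hz, Pi.zero_apply] at h1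
  rcases mul_eq_zero.1 h1 with h2 | h2
  · exact h2
  · exact absurd h2 (pow_ne_zero _ (add_I_ne_zero (im_pos hz).le))

/-! ### The unitary operator -/

/-- The class in `L²(Π, dA)` of a rational function with decay. -/
def decayClass : decay 2 →ₗ[ℂ] L2 where
  toFun u := (memLp_of_mem_decay u.2).toLp _
  map_add' _ _ := rfl
  map_smul' _ _ := rfl

theorem coeFn_decayClass (u : decay 2) :
    (decayClass u : ℂ → ℂ) =ᵐ[areaMeasure] ((u : Smooth) : ℂ → ℂ) :=
  (memLp_of_mem_decay u.2).coeFn_toLp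

/-- The classes of the finite linear combinations of the basis functions. -/
def basisClass : basisSpan →ₗ[ℂ] bergman :=
  (decayClass ∘ₗ Submodule.inclusion basisSpan_le_decay).codRestrict bergman fun u =>
    ⟨u, basisSpan_le_holomorphicFunctions u.2, coeFn_decayClass _⟩

theorem coeFn_basisClass (u : basisSpan) :
    ((basisClass u : L2) : ℂ → ℂ) =ᵐ[areaMeasure] ((u : Smooth) : ℂ → ℂ) :=
  coeFn_decayClass _

theorem inner_eq_integral {a b : L2} {u v : ℂ → ℂ} (ha : (a : ℂ → ℂ) =ᵐ[areaMeasure] u)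
    (hb : (b : ℂ → ℂ) =ᵐ[areaMeasure] v) :
    inner ℂ b a = ∫ z, u z * conj (v z) ∂areaMeasure := by
  rw [eq_toLp_of_ae_eq ha, eq_toLp_of_ae_eq hb, inner_toLp]

/-- The case `j = 0` of the totality argument, where `S^0` and `∂̄^0` are the identity. -/
theorem denseRange_basisClass : DenseRange basisClass := by
  have h : (LinearMap.range basisClass)ᗮ = ⊥ := by
    refine (Submodule.eq_bot_iff _).2 fun a ha => ?_
    obtain ⟨f, hf, haf⟩ := a.2
    have h1 := iterate_dzbar_eq_zero_of_orthogonal 0 (memLp_of_ae_eq haf)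
      (by rw [LinearMap.mem_ker, zero_add, pow_one]; exact (mem_holomorphicFunctions_iff f).1 hf)
      (fun u hu => by
        have h2 := (Submodule.mem_orthogonal' _ _).1 ha _ ⟨⟨u, hu⟩, rfl⟩
        rw [Submodule.coe_inner, inner_eq_integral (coeFn_basisClass ⟨u, hu⟩) haf] at h2
        simpa only [creation_zero] using h2)
    have h2 : f = 0 := h1
    rw [h2] at haf
    exact Subtype.ext (Lp.ext (haf.trans (Lp.coeFn_zero ℂ 2 areaMeasure).symm))
  have h2 := (Submodule.topologicalClosure_eq_top_iff (K := LinearMap.range basisClass)).2 h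
  have h3 := (Submodule.dense_iff_topologicalClosure_eq_top).2 h2
  exact h3

/-- The map `u ↦ S^j u` on the finite linear combinations of the basis functions. -/
def creationClass (j : ℕ) : basisSpan →ₗ[ℂ] L2 :=
  decayClass ∘ₗ ((creation j).restrict fun _ hu => creation_mem_decay j (basisSpan_le_decay hu) :
    basisSpan →ₗ[ℂ] decay 2)

theorem coeFn_creationClass (j : ℕ) (u : basisSpan) :
    (creationClass j u : ℂ → ℂ) =ᵐ[areaMeasure] (creation j (u : Smooth) : ℂ → ℂ) :=
  coeFn_decayClass _

theorem norm_creationClass (j : ℕ) (u : basisSpan) : ‖creationClass j u‖ = ‖basisClass u‖ := by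
  have h1 := inner_eq_integral (coeFn_creationClass j u) (coeFn_creationClass j u)
  have h2 := inner_eq_integral (coeFn_basisClass u) (coeFn_basisClass u)
  have hd := basisSpan_le_decay u.2
  have hh := basisSpan_le_holomorphicFunctions u.2
  rw [integral_creation_mul_creation j hd hd hh hh, ← h2, inner_self_eq_norm_sq_to_K,
    inner_self_eq_norm_sq_to_K] at h1
  have h3 : ‖creationClass j u‖ ^ 2 = ‖(basisClass u : L2)‖ ^ 2 := by exact_mod_cast h1
  exact (pow_left_inj₀ (norm_nonneg _) (norm_nonneg _) two_ne_zero).1 h3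

/-- The continuous extension of `S^j` to the Bergman space. -/
def creationExt (j : ℕ) : bergman →L[ℂ] L2 := (creationClass j).extendOfNorm basisClass

theorem creationExt_basisClass (j : ℕ) (u : basisSpan) :
    creationExt j (basisClass u) = creationClass j u :=
  LinearMap.extendOfNorm_eq denseRange_basisClass
    ⟨1, fun u => by rw [one_mul, norm_creationClass]⟩ u

theorem norm_creationExt (j : ℕ) (a : bergman) : ‖creationExt j a‖ = ‖a‖ := by
  refine denseRange_basisClass.induction_on a (isClosed_eq (by fun_prop) (by fun_prop)) fun u => ?_
  rw [creationExt_basisClass, norm_creationClass]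

/-- Approximants from the span converge to `f` locally uniformly with all derivatives, hence their
images under `S^j` converge pointwise to `S^j f`; a subsequence of the images converges almost
everywhere to the abstract extension. -/
theorem coeFn_creationExt (j : ℕ) {a : bergman} {f : Smooth}
    (haf : ((a : L2) : ℂ → ℂ) =ᵐ[areaMeasure] (f : ℂ → ℂ)) :
    (creationExt j a : ℂ → ℂ) =ᵐ[areaMeasure] (creation j f : ℂ → ℂ) := by
  obtain ⟨s, hs, hsa⟩ := mem_closure_iff_seq_limit.1 (denseRange_basisClass a)
  choose u hu using hs
  have h1 : Filter.Tendsto (fun n => (basisClass (u n) : L2)) Filter.atTop (nhds (a : L2)) := by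
    simp only [hu]
    exact (continuous_subtype_val.tendsto a).comp hsa
  obtain ⟨g, hg, hag, hloc⟩ := exists_tendstoLocallyUniformlyOn
    (f := fun n => (u n : Smooth)) (fun n => basisSpan_le_holomorphicFunctions (u n).2)
    (fun n => coeFn_basisClass (u n)) h1
  have hfg : f = g := eq_of_ae_eq (haf.symm.trans hag)
  subst hfg
  have h2 : Filter.Tendsto (fun n => creationClass j (u n)) Filter.atTop
      (nhds (creationExt j a)) := by
    simp only [← creationExt_basisClass, hu]
    exact ((creationExt j).continuous.tendsto a).comp hsa
  obtain ⟨ns, hmono, hns⟩ := (tendstoInMeasure_of_tendsto_Lp h2).exists_seq_tendsto_ae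
  have hall : ∀ᵐ z ∂areaMeasure, ∀ n, (creationClass j (u n) : ℂ → ℂ) z =
    (creation j (u n : Smooth) : ℂ → ℂ) z := ae_all_iff.2 fun n => coeFn_creationClass j (u n)
  filter_upwards [hns, hall, ae_areaMeasure fun z hz => hz] with z h3 h4 hz
  simp only [h4] at h3
  exact tendsto_nhds_unique h3 ((tendsto_creation_apply
    (fun n => basisSpan_le_holomorphicFunctions (u n).2) hg hloc j hz).comp hmono.tendsto_atTop)

theorem creationExt_mem (j : ℕ) (a : bergman) : creationExt j a ∈ truePolyBergman j := by
  refine ⟨?_, ?_⟩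
  · obtain ⟨f, hf, haf⟩ := a.2
    exact ⟨creation j f, creation_mem_ker j hf, coeFn_creationExt j haf⟩
  · refine denseRange_basisClass.induction_on (p := fun a => creationExt j a ∈ (polyBergman j)ᗮ) a
      ((Submodule.isClosed_orthogonal _).preimage (creationExt j).continuous) fun u => ?_
    rw [creationExt_basisClass]
    refine (Submodule.mem_orthogonal _ _).2 fun b hb => ?_
    obtain ⟨h, hh, hbh⟩ := hb
    rw [inner_eq_integral (coeFn_creationClass j u) hbh]
    exact integral_creation_mul_eq_zero j (basisSpan_le_decay u.2) (memLp_of_ae_eq hbh) hh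

/-- `S^j` as an isometry of the Bergman space into the true poly-Bergman space. -/
def creationIsometry (j : ℕ) : bergman →ₗᵢ[ℂ] truePolyBergman j where
  toLinearMap := (creationExt j).toLinearMap.codRestrict _ (creationExt_mem j)
  norm_map' := norm_creationExt j

theorem coe_creationIsometry (j : ℕ) (a : bergman) :
    (creationIsometry j a : L2) = creationExt j a := rfl

/-- The range is complete. A vector of the true poly-Bergman space orthogonal to it satisfies `∂̄^j
h = 0`, so it lies both in `A_j` and in its orthogonal complement. -/
theorem surjective_creationIsometry (j : ℕ) : Function.Surjective (creationIsometry j) := by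
  have hcomp : CompleteSpace (LinearMap.range (creationIsometry j).toLinearMap) := by
    refine IsComplete.completeSpace_coe ?_
    have := (creationIsometry j).isometry.isUniformInducing.isComplete_range
    exact this
  have h : (LinearMap.range (creationIsometry j).toLinearMap)ᗮ = ⊥ := by
    refine (Submodule.eq_bot_iff _).2 fun x hx => ?_
    obtain ⟨⟨h, hh, hxh⟩, hx2⟩ := x.2
    have h1 := iterate_dzbar_eq_zero_of_orthogonal j (memLp_of_ae_eq hxh) hh (fun u hu => by
      have h2 := (Submodule.mem_orthogonal' _ _).1 hx _ ⟨basisClass ⟨u, hu⟩, rfl⟩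
      have h3 : ((creationIsometry j (basisClass ⟨u, hu⟩) : L2) : ℂ → ℂ) =ᵐ[areaMeasure]
          (creation j u : ℂ → ℂ) := by
        rw [coe_creationIsometry, creationExt_basisClass]
        exact coeFn_creationClass j ⟨u, hu⟩
      rw [Submodule.coe_inner] at h2
      rw [← inner_eq_integral h3 hxh]
      exact h2)
    have h4 : (x : L2) ∈ polyBergman j := ⟨h, h1, hxh⟩
    have h5 := (Submodule.mem_orthogonal _ _).1 hx2 _ h4
    exact Subtype.ext (inner_self_eq_zero.1 h5)
  exact LinearMap.range_eq_top.1 (Submodule.orthogonal_eq_bot_iff.1 h)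

/-- `S^j` as a unitary operator. -/
def creationUnitary (j : ℕ) : bergman ≃ₗᵢ[ℂ] truePolyBergman j :=
  LinearIsometryEquiv.ofSurjective (creationIsometry j) (surjective_creationIsometry j)

theorem coeFn_creationUnitary (j : ℕ) {a : bergman} {f : Smooth}
    (haf : ((a : L2) : ℂ → ℂ) =ᵐ[areaMeasure] (f : ℂ → ℂ)) :
    ((creationUnitary j a : L2) : ℂ → ℂ) =ᵐ[areaMeasure] (creation j f : ℂ → ℂ) :=
  coeFn_creationExt j haf

instance (j : ℕ) : CompleteSpace (truePolyBergman j) :=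
  (creationUnitary j).toIsometryEquiv.symm.completeSpace

theorem l2norm_creation (j : ℕ) {u : Smooth} (hu : u ∈ basisSpan) :
    l2norm (creation j u) = l2norm u := by
  have h1 := norm_creationClass j ⟨u, hu⟩
  have h2 : ‖(basisClass ⟨u, hu⟩ : L2)‖ = l2norm u := by
    rw [Lp.norm_def, eLpNorm_congr_ae (coeFn_basisClass ⟨u, hu⟩)]; rfl
  have h3 : ‖creationClass j ⟨u, hu⟩‖ = l2norm (creation j u) := by
    rw [Lp.norm_def, eLpNorm_congr_ae (coeFn_creationClass j ⟨u, hu⟩)]; rfl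
  rw [← h3, h1, ← h2]
  rfl

/-! ### Toeplitz operators -/

/-- A linear space of smooth functions whose classes are dense in `H`. -/
structure IsCore (H : Submodule ℂ L2) (D : Submodule ℂ Smooth) (ι : D →ₗ[ℂ] H) : Prop where
  ae_eq : ∀ u : D, ((ι u : L2) : ℂ → ℂ) =ᵐ[areaMeasure] ((u : Smooth) : ℂ → ℂ)
  dense : DenseRange ι

theorem isCore_basisClass : IsCore bergman basisSpan basisClass :=
  ⟨coeFn_basisClass, denseRange_basisClass⟩

theorem exists_isCore_creationSpan (j : ℕ) :
    ∃ ι, IsCore (truePolyBergman j) (creationSpan j) ι := by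
  have hle : creationSpan j ≤ decay 2 := by
    rintro _ ⟨u, hu, rfl⟩
    exact creation_mem_decay j (basisSpan_le_decay hu)
  have hmem : ∀ u : creationSpan j, decayClass (Submodule.inclusion hle u) ∈
      truePolyBergman j := by
    rintro ⟨_, u, hu, rfl⟩
    have h1 : decayClass (Submodule.inclusion hle ⟨creation j u, u, hu, rfl⟩) =
        creationExt j (basisClass ⟨u, hu⟩) := by
      rw [creationExt_basisClass]; rfl
    rw [h1]
    exact creationExt_mem j _
  refine ⟨(decayClass ∘ₗ Submodule.inclusion hle).codRestrict _ hmem,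
    fun u => coeFn_decayClass _, ?_⟩
  have h2 : DenseRange fun u => creationUnitary j (basisClass u) :=
    (creationUnitary j).surjective.denseRange.comp denseRange_basisClass
      (creationUnitary j).continuous
  refine h2.mono ?_
  rintro _ ⟨u, rfl⟩
  refine ⟨⟨creation j u, u, u.2, rfl⟩, Subtype.ext ?_⟩
  change creationClass j u = creationExt j (basisClass u)
  rw [creationExt_basisClass]

section Core

variable {H : Submodule ℂ L2} {D : Submodule ℂ Smooth} {ι : D →ₗ[ℂ] H}

theorem IsCore.eq_of_ae_eq (hι : IsCore H D ι) {a : H} (u : D)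
    (h : ((a : L2) : ℂ → ℂ) =ᵐ[areaMeasure] ((u : Smooth) : ℂ → ℂ)) : a = ι u :=
  Subtype.ext (Lp.ext (h.trans (hι.ae_eq u).symm))

theorem IsCore.norm_eq (hι : IsCore H D ι) (u : D) : ‖ι u‖ = l2norm u := by
  have h : ‖ι u‖ = ‖(ι u : L2)‖ := rfl
  rw [h, Lp.norm_def, eLpNorm_congr_ae (hι.ae_eq u)]; rfl

theorem IsCore.isToeplitz_iff (hι : IsCore H D ι) {F : Functional} {T : H →L[ℂ] H} :
    IsToeplitz H D F T ↔ ∀ u v : D, HasValue F (mulConj u v) (inner ℂ (ι v) (T (ι u))) := by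
  constructor
  · intro h u v
    obtain ⟨a, b, ha, hb, hm, hv⟩ := h u u.2 v v.2
    rw [hι.eq_of_ae_eq u ha, hι.eq_of_ae_eq v hb] at hv
    exact ⟨hm, hv.symm⟩
  · intro h u hu v hv
    obtain ⟨hm, he⟩ := h ⟨u, hu⟩ ⟨v, hv⟩
    exact ⟨ι ⟨u, hu⟩, ι ⟨v, hv⟩, hι.ae_eq ⟨u, hu⟩, hι.ae_eq ⟨v, hv⟩, hm, he.symm⟩

theorem isClosed_inner_eq {E : Type*} [NormedAddCommGroup E] [InnerProductSpace ℂ E] (x y : E) :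
    IsClosed {b : E | inner ℂ b x = inner ℂ b y} :=
  isClosed_eq (Continuous.inner (𝕜 := ℂ) continuous_id continuous_const)
    (Continuous.inner (𝕜 := ℂ) continuous_id continuous_const)

theorem IsCore.ext (hι : IsCore H D ι) {x y : H}
    (h : ∀ v : D, inner ℂ (ι v) x = inner ℂ (ι v) y) : x = y := by
  have h1 : ∀ b : H, inner ℂ b x = inner ℂ b y := fun b =>
    hι.dense.induction_on b (isClosed_inner_eq (E := H) x y) h
  exact ext_inner_left ℂ h1

theorem mulConj_add_left (u u' v : Smooth) : mulConj (u + u') v = mulConj u v + mulConj u' v := by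
  simp only [mulConj_eq, add_mul]

theorem mulConj_smul_left (c : ℂ) (u v : Smooth) : mulConj (c • u) v = c • mulConj u v := by
  simp only [mulConj_eq, smul_mul_assoc]

theorem mulConj_add_right (u v v' : Smooth) : mulConj u (v + v') = mulConj u v + mulConj u v' := by
  simp only [mulConj_eq, map_add, mul_add]

theorem mulConj_smul_right (c : ℂ) (u v : Smooth) :
    mulConj u (c • v) = conj c • mulConj u v := by
  simp only [mulConj_eq, conjS_smul, mul_smul_comm]

/-- For fixed `u`, the conjugate of the form is linear and bounded in `v`; it extends to `H` by
density and is represented by Riesz' theorem. -/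
theorem IsCore.exists_vector [CompleteSpace H] (hι : IsCore H D ι) {F : Functional} {C : ℝ}
    (hC : ∀ u v : D, ∃ h : mulConj u v ∈ F.domain,
      ‖F ⟨mulConj u v, h⟩‖ ≤ C * ‖ι u‖ * ‖ι v‖) (hC0 : 0 ≤ C) (u : D) :
    ∃ x : H, ‖x‖ ≤ C * ‖ι u‖ ∧ ∀ v : D, HasValue F (mulConj u v) (inner ℂ (ι v) x) := by
  choose hm hb using hC
  let L : D →ₗ[ℂ] ℂ :=
    { toFun := fun v => conj (F ⟨mulConj u v, hm u v⟩)
      map_add' := fun v v' => by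
        rw [← map_add]
        congr 1
        exact (hasValue_of_mem (hm u (v + v'))).unique (by
          rw [Submodule.coe_add, mulConj_add_right]
          exact (hasValue_of_mem (hm u v)).add (hasValue_of_mem (hm u v')))
      map_smul' := fun c v => by
        rw [RingHom.id_apply, smul_eq_mul]
        have : F ⟨mulConj u (c • v : D), hm u (c • v)⟩ = conj c * F ⟨mulConj u v, hm u v⟩ :=
          (hasValue_of_mem (hm u (c • v))).unique (by
            rw [Submodule.coe_smul, mulConj_smul_right]
            exact (hasValue_of_mem (hm u v)).smul (conj c))
        rw [this, map_mul, Complex.conj_conj] }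
  have hL : ∀ v, ‖L v‖ ≤ (C * ‖ι u‖) * ‖ι v‖ := fun v => by
    change ‖conj (F ⟨mulConj u v, hm u v⟩)‖ ≤ _
    rw [RCLike.norm_conj]
    exact hb u v
  refine ⟨(InnerProductSpace.toDual ℂ H).symm (L.extendOfNorm ι), ?_, fun v => ⟨hm u v, ?_⟩⟩
  · rw [LinearIsometryEquiv.norm_map]
    exact LinearMap.opNorm_extendOfNorm_le hι.dense (mul_nonneg hC0 (norm_nonneg _)) hL
  · have h1 : inner ℂ ((InnerProductSpace.toDual ℂ H).symm (L.extendOfNorm ι)) (ι v) =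
        conj (F ⟨mulConj u v, hm u v⟩) := by
      rw [InnerProductSpace.toDual_symm_apply, LinearMap.extendOfNorm_eq hι.dense ⟨_, hL⟩]
      rfl
    rw [← Complex.conj_conj (F _), ← h1]
    exact inner_conj_symm (𝕜 := ℂ) (E := H) _ _

theorem IsCore.existsUnique_isToeplitz [CompleteSpace H] (hι : IsCore H D ι) {F : Functional}
    (hF : FormBounded D F) : ∃! T, IsToeplitz H D F T := by
  obtain ⟨C, hC⟩ := hF
  -- `FormBounded` does not require its constant to be nonnegative, while the operator norm bounds
  -- do.
  have hC' : ∀ u v : D, ∃ h : mulConj u v ∈ F.domain,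
      ‖F ⟨mulConj u v, h⟩‖ ≤ |C| * ‖ι u‖ * ‖ι v‖ := fun u v => by
    obtain ⟨h, hb⟩ := hC u u.2 v v.2
    refine ⟨h, hb.trans ?_⟩
    rw [hι.norm_eq, hι.norm_eq, mul_assoc, mul_assoc]
    exact mul_le_mul_of_nonneg_right (le_abs_self C)
      (mul_nonneg ENNReal.toReal_nonneg ENNReal.toReal_nonneg)
  choose x hx hxv using hι.exists_vector hC' (abs_nonneg C)
  let X : D →ₗ[ℂ] H :=
    { toFun := x
      map_add' := fun u u' => hι.ext fun v => by
        rw [inner_add_right]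
        refine (hxv (u + u') v).unique ?_
        rw [Submodule.coe_add, mulConj_add_left]
        exact (hxv u v).add (hxv u' v)
      map_smul' := fun c u => hι.ext fun v => by
        rw [RingHom.id_apply, inner_smul_right]
        refine (hxv (c • u) v).unique ?_
        rw [Submodule.coe_smul, mulConj_smul_left]
        exact (hxv u v).smul c }
  refine ⟨X.extendOfNorm ι, hι.isToeplitz_iff.2 fun u v => ?_, fun T hT => ?_⟩
  · rw [LinearMap.extendOfNorm_eq hι.dense ⟨|C|, hx⟩]
    exact hxv u v
  · refine (LinearMap.extendOfNorm_unique hι.dense |C| hx T ?_).symm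
    ext1 u
    exact hι.ext fun v => ((hι.isToeplitz_iff.1 hT) u v).unique (hxv u v)

end Core

/-! ### Unitarily equivalent operators -/

section Unitary

variable {H H' : Type} [NormedAddCommGroup H] [InnerProductSpace ℂ H] [NormedAddCommGroup H']
  [InnerProductSpace ℂ H']

/-- `T'` is the image of `T` under the unitary operator `V`. -/
def Intertwines (V : H ≃ₗᵢ[ℂ] H') (T : H →L[ℂ] H) (T' : H' →L[ℂ] H') : Prop :=
  ∀ a, T' (V a) = V (T a)

theorem Intertwines.symm {V : H ≃ₗᵢ[ℂ] H'} {T : H →L[ℂ] H} {T' : H' →L[ℂ] H'}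
    (h : Intertwines V T T') : Intertwines V.symm T' T := fun a => by
  rw [LinearIsometryEquiv.eq_symm_apply, ← h, V.apply_symm_apply]

/-- Conjugation of operators by a unitary operator. -/
def conjOp (V : H ≃ₗᵢ[ℂ] H') (T : H →L[ℂ] H) : H' →L[ℂ] H' :=
  (V.toContinuousLinearEquiv : H →L[ℂ] H').comp
    (T.comp (V.symm.toContinuousLinearEquiv : H' →L[ℂ] H))

theorem conjOp_apply (V : H ≃ₗᵢ[ℂ] H') (T : H →L[ℂ] H) (a : H') :
    conjOp V T a = V (T (V.symm a)) := rfl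

theorem Intertwines.eq_conjOp {V : H ≃ₗᵢ[ℂ] H'} {T : H →L[ℂ] H} {T' : H' →L[ℂ] H'}
    (h : Intertwines V T T') : T' = conjOp V T := by
  ext1 a
  rw [conjOp_apply, ← h, V.apply_symm_apply]

theorem Intertwines.isCompactOperator {V : H ≃ₗᵢ[ℂ] H'} {T : H →L[ℂ] H} {T' : H' →L[ℂ] H'}
    (h : Intertwines V T T') (hT : IsCompactOperator T) : IsCompactOperator T' := by
  rw [h.eq_conjOp]
  exact (hT.comp_clm (V.symm.toContinuousLinearEquiv : H' →L[ℂ] H)).clm_comp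
    (V.toContinuousLinearEquiv : H →L[ℂ] H')

theorem Intertwines.eq_zero {V : H ≃ₗᵢ[ℂ] H'} {T : H →L[ℂ] H} {T' : H' →L[ℂ] H'}
    (h : Intertwines V T T') (hT : T = 0) : T' = 0 := by
  rw [h.eq_conjOp, hT]
  ext1 a
  simp [conjOp_apply]

theorem norm_conjOp_le (V : H ≃ₗᵢ[ℂ] H') (T : H →L[ℂ] H) : ‖conjOp V T‖ ≤ ‖T‖ :=
  (conjOp V T).opNorm_le_bound (norm_nonneg _) fun a => by
    rw [conjOp_apply, LinearIsometryEquiv.norm_map, ← V.symm.norm_map a]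
    exact T.le_opNorm _

theorem norm_conjOp (V : H ≃ₗᵢ[ℂ] H') (T : H →L[ℂ] H) : ‖conjOp V T‖ = ‖T‖ := by
  refine le_antisymm (norm_conjOp_le V T) ?_
  have h : T = conjOp V.symm (conjOp V T) := by
    ext1 a
    simp [conjOp_apply]
  calc ‖T‖ = ‖conjOp V.symm (conjOp V T)‖ := by rw [← h]
    _ ≤ ‖conjOp V T‖ := norm_conjOp_le _ _

theorem rank_conjOp_le (V : H ≃ₗᵢ[ℂ] H') (T : H →L[ℂ] H) :
    (conjOp V T : H' →ₗ[ℂ] H').rank ≤ (T : H →ₗ[ℂ] H).rank := by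
  have h : (conjOp V T : H' →ₗ[ℂ] H') = V.toLinearEquiv.toLinearMap ∘ₗ ((T : H →ₗ[ℂ] H) ∘ₗ
      V.symm.toLinearEquiv.toLinearMap) := rfl
  rw [h]
  exact (LinearMap.rank_comp_le_right _ _).trans (LinearMap.rank_comp_le_left _ _)

theorem Intertwines.finiteDimensional_range {V : H ≃ₗᵢ[ℂ] H'} {T : H →L[ℂ] H}
    {T' : H' →L[ℂ] H'} (h : Intertwines V T T')
    (hT : FiniteDimensional ℂ T.toLinearMap.range) :
    FiniteDimensional ℂ T'.toLinearMap.range := by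
  have h1 : T'.toLinearMap.range ≤ T.toLinearMap.range.map V.toLinearEquiv.toLinearMap := by
    rw [h.eq_conjOp]
    rintro _ ⟨a, rfl⟩
    exact ⟨T (V.symm a), ⟨_, rfl⟩, rfl⟩
  exact Submodule.finiteDimensional_of_le h1

theorem singularNumber_set_subset {V : H ≃ₗᵢ[ℂ] H'} {T : H →L[ℂ] H} {T' : H' →L[ℂ] H'}
    (h : Intertwines V T T') (n : ℕ) :
    {r : ℝ | ∃ R : H →L[ℂ] H, (R : H →ₗ[ℂ] H).rank ≤ n ∧ r = ‖T - R‖} ⊆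
      {r : ℝ | ∃ R : H' →L[ℂ] H', (R : H' →ₗ[ℂ] H').rank ≤ n ∧ r = ‖T' - R‖} := by
  rintro r ⟨R, hR, rfl⟩
  refine ⟨conjOp V R, (rank_conjOp_le V R).trans hR, ?_⟩
  have h1 : T' - conjOp V R = conjOp V (T - R) := by
    rw [h.eq_conjOp]
    ext1 a
    simp [conjOp_apply]
  rw [h1, norm_conjOp]

theorem Intertwines.singularNumber_eq {V : H ≃ₗᵢ[ℂ] H'} {T : H →L[ℂ] H} {T' : H' →L[ℂ] H'}
    (h : Intertwines V T T') (n : ℕ) : singularNumber T n = singularNumber T' n := by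
  rw [singularNumber, singularNumber]
  congr 1
  exact Subset.antisymm (singularNumber_set_subset h n) (singularNumber_set_subset h.symm n)

theorem Intertwines.isSchatten {V : H ≃ₗᵢ[ℂ] H'} {T : H →L[ℂ] H} {T' : H' →L[ℂ] H'}
    (h : Intertwines V T T') {p : ℝ} (hT : IsSchatten p T) : IsSchatten p T' := by
  rw [IsSchatten] at hT ⊢
  simpa only [h.singularNumber_eq] using hT

end Unitary

/-! ### Toeplitz operators on the Bergman space and on the true poly-Bergman space -/

section Symbol

variable {j : ℕ} {P : OpPoly} {F : Functional}

theorem wordTrans_mem_domain (hF : IsSymbol F) {φ : Smooth} (hφ : φ ∈ decay 4) (w : List Gen) :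
    wordTrans w φ ∈ F.domain :=
  hF.1 _ (isSmoothUpToBoundaryL1_of_mem_decay (isGraded_decay.wordTrans_mem w hφ))

theorem mulConj_mem_act_domain (hF : IsSymbol F) {f g : Smooth} (hf : f ∈ basisSpan)
    (hg : g ∈ basisSpan) : mulConj f g ∈ (P.act F).domain := by
  have h1 : ∀ w ∈ P.support, wordTrans w (mulConj f g) ∈ F.domain := fun w _ =>
    wordTrans_mem_domain hF (mulConj_mem_decay (basisSpan_le_decay hf) (basisSpan_le_decay hg)) w
  have h2 : polyTrans P (mulConj f g) ∈ F.domain := by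
    rw [polyTrans, Finsupp.linearCombination_apply, Finsupp.sum, LinearMap.sum_apply]
    exact sum_mem fun w hw => F.domain.smul_mem _ (h1 w hw)
  exact ((hasValue_act h1).2 (hasValue_of_mem h2)).1

theorem mulConj_creation_mem_domain (hF : IsSymbol F) {f g : Smooth} (hf : f ∈ basisSpan)
    (hg : g ∈ basisSpan) : mulConj (creation j f) (creation j g) ∈ F.domain :=
  hF.1 _ (isSmoothUpToBoundaryL1_of_mem_decay
    (mulConj_mem_decay (creation_mem_decay j (basisSpan_le_decay hf))
      (creation_mem_decay j (basisSpan_le_decay hg))))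

/-- Statement 1 for arbitrary holomorphic functions: if the side with `K` is defined, so is the
other, with the same value. -/
theorem HasValue.creation (hP : polyTrans P = symbolTrans j) {f g : Smooth}
    (hf : f ∈ holomorphicFunctions) (hg : g ∈ holomorphicFunctions) {v : ℂ}
    (h : HasValue (P.act F) (mulConj f g) v) :
    HasValue F (mulConj (creation j f) (creation j g)) v := by
  have h1 := (hasValue_act (wordTrans_mem_of_mem_domain h.1)).1 h
  rwa [hP, symbolTrans_mulConj j hf hg] at h1

theorem eqAsDistributions_act (hP : polyTrans P = symbolTrans j) (hF : IsSymbol F) :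
    EqAsDistributions (P.act F) (∑ k ∈ Finset.range (j + 1), ∑ l ∈ Finset.range (j + 1),
      symbolCoeff j k l • distDz^[k] (distDzbar^[l] (distMulY^[k + l] F))) := by
  intro φ
  have hφ := ofTest_mem_compactlySupported φ
  have hmem : ∀ u ∈ compactlySupported, u ∈ F.domain := fun u hu =>
    hF.1 _ (isSmoothUpToBoundaryL1_of_mem_compactlySupported hu)
  have h1 : ∀ w ∈ P.support, wordTrans w (ofTest φ) ∈ F.domain := fun w _ =>
    hmem _ (isGraded_compactlySupported.wordTrans_mem (m := 0) w hφ)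
  have h2 : ∀ k l, weightZero k l (ofTest φ) ∈ F.domain := fun k l =>
    hmem _ (isGraded_compactlySupported.weightZero_mem (m := 0) k l hφ)
  have h3 : symbolTrans j (ofTest φ) ∈ F.domain := by
    rw [symbolTrans, LinearMap.sum_apply]
    refine sum_mem fun k _ => ?_
    rw [LinearMap.sum_apply]
    exact sum_mem fun l _ => F.domain.smul_mem _ (h2 k l)
  have h4 : HasValue (P.act F) (ofTest φ) (F ⟨_, h3⟩) :=
    (hasValue_act h1).2 (by rw [hP]; exact hasValue_of_mem h3)
  obtain ⟨h5, h5'⟩ := h4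
  obtain ⟨h6, h6'⟩ := hasValue_symbol_sum h2 (hasValue_of_mem h3)
  exact ⟨h5, h6, h5'.trans h6'.symm⟩

/-- The two forms take the same values and `S^j` preserves norms on the span, so the same constant
serves both. -/
theorem formBounded_iff (hP : polyTrans P = symbolTrans j) (hF : IsSymbol F) :
    FormBounded (creationSpan j) F ↔ FormBounded basisSpan (P.act F) := by
  have key : ∀ f ∈ basisSpan, ∀ g ∈ basisSpan, ∃ v,
      HasValue F (mulConj (creation j f) (creation j g)) v ∧
      HasValue (P.act F) (mulConj f g) v := fun f hf g hg =>
    ⟨_, HasValue.creation hP (basisSpan_le_holomorphicFunctions hf)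
      (basisSpan_le_holomorphicFunctions hg)
      (hasValue_of_mem (mulConj_mem_act_domain hF hf hg)), hasValue_of_mem _⟩
  constructor
  · rintro ⟨C, hC⟩
    refine ⟨C, fun f hf g hg => ?_⟩
    obtain ⟨v, h1, h2, h2'⟩ := key f hf g hg
    obtain ⟨h3, h4⟩ := hC _ ⟨f, hf, rfl⟩ _ ⟨g, hg, rfl⟩
    refine ⟨h2, ?_⟩
    rw [h2', ← (hasValue_of_mem h3).unique h1, ← l2norm_creation j hf, ← l2norm_creation j hg]
    exact h4
  · rintro ⟨C, hC⟩
    refine ⟨C, ?_⟩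
    rintro _ ⟨f, hf, rfl⟩ _ ⟨g, hg, rfl⟩
    obtain ⟨v, ⟨h1, h1'⟩, h2⟩ := key f hf g hg
    obtain ⟨h3, h4⟩ := hC f hf g hg
    refine ⟨h1, ?_⟩
    rw [h1', ← (hasValue_of_mem h3).unique h2, l2norm_creation j hf, l2norm_creation j hg]
    exact h4

theorem inner_creationUnitary (hP : polyTrans P = symbolTrans j)
    {T₁ : truePolyBergman j →L[ℂ] truePolyBergman j} {T₂ : bergman →L[ℂ] bergman}
    (h₁ : IsToeplitz (truePolyBergman j) (creationSpan j) F T₁)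
    (h₂ : IsToeplitz bergman basisSpan (P.act F) T₂) (a b : bergman) :
    inner ℂ (creationUnitary j b) (T₁ (creationUnitary j a)) = inner ℂ b (T₂ a) := by
  obtain ⟨ι, hι⟩ := exists_isCore_creationSpan j
  have key : ∀ u v : basisSpan, inner ℂ (creationUnitary j (basisClass v))
      (T₁ (creationUnitary j (basisClass u))) = inner ℂ (basisClass v) (T₂ (basisClass u)) := by
    intro u v
    have h3 : ∀ u : basisSpan, creationUnitary j (basisClass u) =
        ι ⟨creation j u, u, u.2, rfl⟩ := fun u =>
      hι.eq_of_ae_eq _ (coeFn_creationUnitary j (coeFn_basisClass u))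
    have h4 := hι.isToeplitz_iff.1 h₁ ⟨creation j u, u, u.2, rfl⟩ ⟨creation j v, v, v.2, rfl⟩
    have h5 := isCore_basisClass.isToeplitz_iff.1 h₂ u v
    rw [h3, h3]
    exact h4.unique (HasValue.creation hP (basisSpan_le_holomorphicFunctions u.2)
      (basisSpan_le_holomorphicFunctions v.2) h5)
  have hU := (creationUnitary j).continuous
  refine denseRange_basisClass.induction_on a (isClosed_eq
    (continuous_const.inner (T₁.continuous.comp hU)) (continuous_const.inner T₂.continuous))
    fun u => ?_
  exact denseRange_basisClass.induction_on b (isClosed_eq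
    (hU.inner continuous_const)
    (Continuous.inner (𝕜 := ℂ) (E := bergman) continuous_id continuous_const)) fun v => key u v

theorem intertwines_creationUnitary (hP : polyTrans P = symbolTrans j)
    {T₁ : truePolyBergman j →L[ℂ] truePolyBergman j} {T₂ : bergman →L[ℂ] bergman}
    (h₁ : IsToeplitz (truePolyBergman j) (creationSpan j) F T₁)
    (h₂ : IsToeplitz bergman basisSpan (P.act F) T₂) :
    Intertwines (creationUnitary j) T₂ T₁ := by
  intro a
  refine ext_inner_left ℂ fun c => ?_
  obtain ⟨b, rfl⟩ := (creationUnitary j).surjective c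
  rw [inner_creationUnitary hP h₁ h₂, LinearIsometryEquiv.inner_map_map]

end Symbol

end PolyBergman

end

/-! ### The theorem -/

theorem mainTheorem1 (j : ℕ) :
    ∃ U : bergman ≃ₗᵢ[ℂ] truePolyBergman j,
      -- `U` is the restriction of `S_Π^j` to `A(Π)`
      (∀ (a : bergman) (f : Smooth),
        ((a : L2) : ℂ → ℂ) =ᵐ[areaMeasure] (f : ℂ → ℂ) →
        ((U a : L2) : ℂ → ℂ) =ᵐ[areaMeasure] (creation j f : ℂ → ℂ)) ∧
      ∃ P : OpPoly,
        P.HasDegree j ∧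
        (∀ w ∈ P.support, monomialWeight w = 0) ∧
        -- the operator has order `2 * j`, and all its terms have weight zero
        (∃ c : ℕ → ℕ → ℂ, c j j ≠ 0 ∧
          ∀ F : Functional, IsSymbol F →
            EqAsDistributions (P.act F)
              (∑ k ∈ Finset.range (j + 1), ∑ l ∈ Finset.range (j + 1),
                c k l • distDz^[k] (distDzbar^[l] (distMulY^[k + l] F)))) ∧
        ∀ F : Functional, IsSymbol F →
          (∀ f ∈ basisSpan, ∀ g ∈ basisSpan,
            mulConj (creation j f) (creation j g) ∈ F.domain ∧
            mulConj f g ∈ (P.act F).domain) ∧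
          (∀ f g : Smooth, IsBergmanFunction f → IsBergmanFunction g →
            ∀ (h : mulConj (creation j f) (creation j g) ∈ F.domain)
              (h' : mulConj f g ∈ (P.act F).domain),
              F ⟨mulConj (creation j f) (creation j g), h⟩ = P.act F ⟨mulConj f g, h'⟩) ∧
          (FormBounded (creationSpan j) F ↔ FormBounded basisSpan (P.act F)) ∧
          (FormBounded (creationSpan j) F →
            (∃! T₁, IsToeplitz (truePolyBergman j) (creationSpan j) F T₁) ∧
            (∃! T₂, IsToeplitz bergman basisSpan (P.act F) T₂) ∧
            ∀ (T₁ : truePolyBergman j →L[ℂ] truePolyBergman j) (T₂ : bergman →L[ℂ] bergman),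
              IsToeplitz (truePolyBergman j) (creationSpan j) F T₁ →
              IsToeplitz bergman basisSpan (P.act F) T₂ →
              (∀ a, T₁ (U a) = U (T₂ a)) ∧
              (∀ a b, inner ℂ (U b) (T₁ (U a)) = inner ℂ b (T₂ a)) ∧
              (IsCompactOperator T₁ ↔ IsCompactOperator T₂) ∧
              (∀ p : ℝ, 0 < p → (IsSchatten p T₁ ↔ IsSchatten p T₂)) ∧
              (FiniteDimensional ℂ T₁.toLinearMap.range ↔
                FiniteDimensional ℂ T₂.toLinearMap.range) ∧
              (T₁ = 0 ↔ T₂ = 0)) := by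
  obtain ⟨P, hdeg, hP⟩ := exists_poly j
  refine ⟨creationUnitary j, fun a f haf => coeFn_creationUnitary j haf, P, hdeg,
    fun w _ => monomialWeight_eq_zero w, ⟨symbolCoeff j, ?_, fun F hF =>
      eqAsDistributions_act hP hF⟩, fun F hF => ⟨fun f hf g hg =>
        ⟨mulConj_creation_mem_domain hF hf hg, mulConj_mem_act_domain hF hf hg⟩,
      fun f g hf hg h h' => (hasValue_of_mem h).unique
        (HasValue.creation hP hf.1 hg.1 (hasValue_of_mem h')),
      formBounded_iff hP hF, fun hb => ?_⟩⟩
  · exact mul_ne_zero (by simp) (mul_ne_zero (creationCoeff_self_ne_zero j)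
      ((map_ne_zero _).2 (creationCoeff_self_ne_zero j)))
  · obtain ⟨ι, hι⟩ := exists_isCore_creationSpan j
    refine ⟨hι.existsUnique_isToeplitz hb,
      isCore_basisClass.existsUnique_isToeplitz ((formBounded_iff hP hF).1 hb),
      fun T₁ T₂ h₁ h₂ => ?_⟩
    have hT := intertwines_creationUnitary hP h₁ h₂
    exact ⟨hT, inner_creationUnitary hP h₁ h₂,
      ⟨hT.symm.isCompactOperator, hT.isCompactOperator⟩,
      fun p _ => ⟨hT.symm.isSchatten, hT.isSchatten⟩,
      ⟨hT.symm.finiteDimensional_range, hT.finiteDimensional_range⟩,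
      ⟨hT.symm.eq_zero, hT.eq_zero⟩⟩
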